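/- Let $N$ be a positive integer and $\lambda\in\mathbb{Z}^N$. Let $F\colon \mathbb{Z}^N\to\mathbb{C}$ (supported on the cone $\mathbb{Z}_{\ge 0}^N+\lambda$) be an element of $$\delta(y\in\mathbb{Z}_{\ge 0}^N+\lambda)\cdot\mathbb{C}\bigl[\,y_i,\ \delta(y_i\in a+k\mathbb{Z})\ \big|\ 1\le i\le N,\ a,k\in\mathbb{Z}\,\bigr],$$ that is, the product of the indicator function of the cone with an element of the algebra of functions on $\mathbb{Z}^N$ generated over $\mathbb{C}$ by the coordinates $y_i$ and the indicator functions $\delta(y_i\in a+k\mathbb{Z})$, where $a+k\mathbb{Z}=\{a\}$ for $k=0$. (i) For every $u\in\mathbb{C}^N$ the series $$\varphi_{F,u}(t_1,\dots,t_N)=\sum_{l\in\mathbb{Z}_{\ge 0}^N+\lambda}F(l)\,e^{t_1(l_1+u_1)+\cdots+t_N(l_N+u_N)}$$ converges absolutely when $\operatorname{Re}t_i<0$ for all $i$, and there is a unique formal Laurent series $\sum_{m\in\mathbb{Z}^N}B_m(u)\,t_1^{m_1}\cdots t_N^{m_N}$, with coefficients $B_m(u)\in\mathbb{C}[u_1,\dots,u_N]$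 and with exponents bounded below in each variable, that for every $u\in\mathbb{C}^N$ converges absolutely to $\varphi_{F,u}(t)$ for all $t\in\mathbb{C}^N$ sufficiently close to $0$ with $\operatorname{Re}t_i<0$ for all $i$. Denote this Laurent series by $\varphi_{F,u}$ as well. (ii) Let $\alpha\in\mathbb{R}^N$ and let $f\colon\mathbb{R}^N\to\mathbb{C}$ be a $C^\infty$ function of rapid decay as $x_1,\dots,x_N\to\infty$: for all $m,n\in\mathbb{Z}_{\ge 0}^N$ and all $R\in\mathbb{R}$, the function $x_1^{m_1}\cdots x_N^{m_N}f^{(n)}(x)$ is bounded on $[R,\infty)^N$. Then $\sum_{l\in\mathbb{Z}_{\ge 0}^N+\lambda}F(l)\,f(t(l+\alpha))$ converges absolutely for every $t>0$, and $$\sum_{l\in\mathbb{Z}_{\ge 0}^N+\lambda}F(l)\,f(t(l+\alpha))\ \sim\ \varphi_{F,\alpha}\odot f(t)\qquad\text{as }t\to+0.$$ Here $\varphi_{F,\alpha}\odot f(t)=\sum_{m\in\mathbb{Z}^N}B_m(\alpha)\,f^{(m)}(0)\,t^{m_1+\cdots+m_N}\in\mathbb{C}((t))$ is the Hadamard product,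 where $f^{(m)}=\partial_{x_1}^{m_1}\cdots\partial_{x_N}^{m_N}f$ for $m\in\mathbb{Z}^N$ and a negative power of $\partial_{x_i}$ is an iterate of $\partial_{x_i}^{-1}g(x)=-\int_{x_i}^\infty g(x_1,\dots,x_{i-1},s,x_{i+1},\dots,x_N)\,ds$. For a formal Laurent series, $\Phi(t)\sim\sum_{m\ge -L}a_mt^m$ as $t\to+0$ (with $L$ a positive integer) means that for every real $M>0$ there are $K_M>0$ and $\varepsilon>0$ with $\bigl|\Phi(t)-\sum_{-L\le m\le M}a_mt^m\bigr|\le K_Mt^M$ for all $t\in(0,\varepsilon)$. -/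

import Mathlib

open scoped ContDiff

noncomputable section

namespace AsympLim

variable {N : ℕ}

/-! ### Derivatives and iterated antiderivatives of integer order -/

/-- The partial derivative `∂g/∂x_i`. -/
def partialDeriv (i : Fin N) (g : (Fin N → ℝ) → ℂ) : (Fin N → ℝ) → ℂ :=
  fun x => fderiv ℝ g x (Pi.single i 1)

/-- The antiderivative in the variable `x_i` that vanishes at infinity:
`x ↦ -∫_{x_i}^∞ g(x_1, …, s, …, x_N) ds`, with `s` in position `i`. -/
def partialAntideriv (i : Fin N) (g : (Fin N → ℝ) → ℂ) : (Fin N → ℝ) → ℂ :=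
  fun x => -∫ s in Set.Ioi (x i), g (Function.update x i s)

/-- `∂^k/∂x_i^k` for an integer `k`; for `k < 0` this is the `(-k)`-fold antiderivative. -/
def partialPow (i : Fin N) : ℤ → ((Fin N → ℝ) → ℂ) → ((Fin N → ℝ) → ℂ)
  | Int.ofNat k => (partialDeriv i)^[k]
  | Int.negSucc k => (partialAntideriv i)^[k + 1]

/-- The mixed derivative `f^{(m)}` for `m ∈ ℤ^N`, i.e.
`∂^{m_1}/∂x_1^{m_1} (⋯ (∂^{m_N}/∂x_N^{m_N} f))`.  (For smooth functions of rapid decay the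
operators commute, so that the order does not matter.) -/
def mixedDeriv (m : Fin N → ℤ) (f : (Fin N → ℝ) → ℂ) : (Fin N → ℝ) → ℂ :=
  (List.finRange N).foldr (fun i g => partialPow i (m i) g) f

/-- `f` is a smooth function of rapid decay as `x_1, …, x_N → ∞`: all the functions
`x_1^{m_1} ⋯ x_N^{m_N} f^{(n)}(x)` with `m, n ∈ ℤ_{≥ 0}^N` are bounded on every set
`[R, ∞)^N`, so that `f` decays when any of the variables tend to `+∞` while the remaining ones
are merely bounded below. -/
structure IsRapidDecay (f : (Fin N → ℝ) → ℂ) : Prop where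
  smooth : ContDiff ℝ ∞ f
  bounded : ∀ (m n : Fin N → ℕ) (R : ℝ), ∃ C : ℝ, ∀ x : Fin N → ℝ, (∀ i, R ≤ x i) →
    ‖(∏ i, (x i : ℂ) ^ m i) * mixedDeriv (fun i => (n i : ℤ)) f x‖ ≤ C

/-! ### Asymptotic expansions in the sense of Poincaré -/

/-- `φ(t) ∼ ∑_{m ≥ -L} a_m t^m` as `t → +0`. -/
def IsAsymptotic (φ : ℝ → ℂ) (L : ℕ) (a : ℤ → ℂ) : Prop :=
  ∀ M : ℝ, 0 < M → ∃ K : ℝ, 0 < K ∧ ∃ ε : ℝ, 0 < ε ∧ ∀ t : ℝ, 0 < t → t < ε →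
    ‖φ t - ∑ m ∈ Finset.Icc (-(L : ℤ)) ⌊M⌋, a m * (t : ℂ) ^ m‖ ≤ K * t ^ M

/-- `φ(t) ∼ a(t)` as `t → +0`, for a formal Laurent series `a ∈ ℂ((t))`. -/
def HasAsymptoticExpansion (φ : ℝ → ℂ) (a : LaurentSeries ℂ) : Prop :=
  ∃ L : ℕ, 0 < L ∧ (∀ m : ℤ, m < -(L : ℤ) → a.coeff m = 0) ∧ IsAsymptotic φ L a.coeff

/-! ### Formal Laurent series in several variables and the Hadamard product -/

/-- Formal Laurent series `R((t_1, …, t_N)) = R[[t_1, …, t_N]][t_1⁻¹, …, t_N⁻¹]`: families of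
coefficients on `ℤ^N` whose support is partially well-ordered for the componentwise order, which
in `ℤ^N` means that the exponents are bounded below. -/
abbrev MvLaurentSeries (N : ℕ) (R : Type) [Zero R] : Type := HahnSeries (Fin N → ℤ) R

/-- Only finitely many terms of a Laurent series have a given total degree, so that the sums in
the Hadamard product below are finite. -/
theorem finite_support_totalDegree (φ : MvLaurentSeries N ℂ) (d : ℤ) :
    {m : Fin N → ℤ | m ∈ φ.support ∧ ∑ i, m i = d}.Finite := by
  have hp : {m : Fin N → ℤ | m ∈ φ.support ∧ ∑ i, m i = d}.IsPWO :=
    φ.isPWO_support.mono fun _ h => h.1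
  by_contra hinf
  let e := Set.Infinite.natEmbedding _ hinf
  obtain ⟨g, hg⟩ := hp.exists_monotone_subseq (f := fun n => (e n).1) fun n => (e n).2
  have hle : (e (g 0)).1 ≤ (e (g 1)).1 := hg (Nat.zero_le 1)
  have hne : (e (g 0)).1 ≠ (e (g 1)).1 := fun h =>
    absurd (g.injective (e.injective (Subtype.ext h))) (by decide)
  apply hne
  funext i
  by_contra hi
  have hlt : ∑ j, (e (g 0)).1 j < ∑ j, (e (g 1)).1 j :=
    Finset.sum_lt_sum (fun j _ => hle j) ⟨i, Finset.mem_univ i, lt_of_le_of_ne (hle i) hi⟩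
  rw [(e (g 0)).2.2, (e (g 1)).2.2] at hlt
  exact lt_irrefl _ hlt

/-- The Hadamard product
`φ ⊙ f (t) = ∑_{m ∈ ℤ^N} B_m f^{(m)}(0) t^{m_1 + ⋯ + m_N} ∈ ℂ((t))`
of `φ = ∑_m B_m t_1^{m_1} ⋯ t_N^{m_N}` and `f`. -/
def hadamard (φ : MvLaurentSeries N ℂ) (f : (Fin N → ℝ) → ℂ) : LaurentSeries ℂ where
  coeff d := ∑ᶠ m ∈ {m : Fin N → ℤ | ∑ i, m i = d}, φ.coeff m * mixedDeriv m f 0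
  isPWO_support' := by
    have hmono : Monotone fun m : Fin N → ℤ => ∑ i, m i :=
      fun _ _ h => Finset.sum_le_sum fun i _ => h i
    refine (φ.isPWO_support.image_of_monotone hmono).mono ?_
    intro d hd
    obtain ⟨m, hm⟩ := exists_ne_zero_of_finsum_mem_ne_zero hd
    exact ⟨m, fun h0 => hm.2 (by rw [h0, zero_mul]), hm.1⟩

/-! ### The summands `F` and their generating functions -/

/-- The cone `ℤ_{≥ 0}^N + λ`. -/
def cone (lam : Fin N → ℤ) : Set (Fin N → ℤ) :=
  {l | ∃ n : Fin N → ℕ, ∀ i, l i = (n i : ℤ) + lam i}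

/-- The function `y ↦ δ(y_i ∈ a + kℤ)`; for `k = 0` the progression is `{a}`. -/
def progressionDelta (i : Fin N) (a k : ℤ) : (Fin N → ℤ) → ℂ :=
  Set.indicator {y | ∃ j : ℤ, y i = a + k * j} 1

/-- The algebra `ℂ[y_i, δ(y_i ∈ a + kℤ) ∣ 1 ≤ i ≤ N, a, k ∈ ℤ]` of functions on `ℤ^N`. -/
def deltaPolynomials (N : ℕ) : Subalgebra ℂ ((Fin N → ℤ) → ℂ) :=
  Algebra.adjoin ℂ
    (Set.range (fun (i : Fin N) (y : Fin N → ℤ) => (y i : ℂ)) ∪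
      {g | ∃ (i : Fin N) (a k : ℤ), g = progressionDelta i a k})

/-- The set `δ(y ∈ ℤ_{≥ 0}^N + λ) · ℂ[y_i, δ(y_i ∈ a + kℤ)]`. -/
def coneDeltaPolynomials (lam : Fin N → ℤ) : Set ((Fin N → ℤ) → ℂ) :=
  {F | ∃ G ∈ deltaPolynomials N, F = Set.indicator (cone lam) 1 * G}

/-- The term `F(l) e^{t_1 (l_1 + u_1) + ⋯ + t_N (l_N + u_N)}`. -/
def genTerm (F : (Fin N → ℤ) → ℂ) (u t : Fin N → ℂ) (l : Fin N → ℤ) : ℂ :=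
  F l * Complex.exp (∑ i, t i * ((l i : ℂ) + u i))

/-- `φ` is the generating function
`φ_{F,u}(t) = ∑_{l ∈ ℤ_{≥ 0}^N + λ} F(l) e^{t_1 (l_1 + u_1) + ⋯ + t_N (l_N + u_N)}`
as a formal Laurent series in `t` with coefficients in `ℂ[u_1, …, u_N]`: for every `u`, the sum
converges absolutely when all `t_i` have negative real part, and, for those `t` near the origin,
it is the sum of the convergent Laurent series `φ`. -/
def IsGeneratingSeries (lam : Fin N → ℤ) (F : (Fin N → ℤ) → ℂ)
    (φ : MvLaurentSeries N (MvPolynomial (Fin N) ℂ)) : Prop :=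
  ∀ u : Fin N → ℂ,
    (∀ t : Fin N → ℂ, (∀ i, (t i).re < 0) →
      Summable fun l : cone lam => genTerm F u t l) ∧
    ∃ r : ℝ, 0 < r ∧ ∀ t : Fin N → ℂ, (∀ i, (t i).re < 0 ∧ ‖t i‖ < r) →
      HasSum (fun m : Fin N → ℤ => MvPolynomial.eval u (φ.coeff m) * ∏ i, t i ^ m i)
        (∑' l : cone lam, genTerm F u t l)

/-- The specialization `φ_{F,α} ∈ ℂ((t_1, …, t_N))` at `u = α ∈ ℝ^N`. -/
def specialize (α : Fin N → ℝ) (φ : MvLaurentSeries N (MvPolynomial (Fin N) ℂ)) :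
    MvLaurentSeries N ℂ :=
  φ.map (MvPolynomial.eval fun i => (α i : ℂ))

end AsympLim

end

open scoped ContDiff
open MeasureTheory Filter Topology

noncomputable section

namespace AsympLim

variable {N : ℕ}

/-! ### Partial derivatives of smooth functions -/

/-! The mechanism is operator calculus. On smooth functions of rapid decay each `∂_i` is invertible,
its inverse being the antiderivative that vanishes at infinity, and these automorphisms commute.
Hence a Laurent series `φ` can be applied formally to `t∂ = (t∂_1, …, t∂_N)`, and `φ ⊙ f (t)` is
exactly `φ(t∂) f` evaluated at `0`. Since `f(t(l+α))` is formally `e^{∑ (l_i+α_i) t∂_i} f (0)`, the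
sum against `F` is formally `φ_{F,α}(t∂) f (0)`; the work lies in making this an asymptotic
statement.

Both sides are linear in `F`, so `F` is first decomposed into products of functions of one
coordinate, each living on a progression `a + K ℤ_{≥0}` with weight `multichoose p n`, the
coefficient of `x^n` in `(1-x)^{-p}` (`coneDeltaPolynomials_subset_span`). For such a product the
generating function is `∏ e^{(a_i+u_i)t_i} (1-e^{K_i t_i})^{-p_i}`. Its Laurent expansion comes from
the exponential and Bernoulli series, with coefficients polynomial in `u`
(`isGeneratingSeries_coneSeries`).

For the asymptotics, the functional `f ↦ ∑ W_p(n) f(t(Kn+c))` is built up from evaluation at `0`,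
whose symbol is `1`. Translating `c` multiplies the symbol by an exponential, by Taylor's formula
(`latticeSum_shift`). Raising `p_i` by one divides it by `1-e^{K_i t_i}`, by summation by parts
applied to a truncated solution `G` of the difference equation `(e^{tK_i∂_i}-1)G = tK_i f`
(`latticeSum_div`). Remainders are estimated crudely: a lattice sum costs at most a fixed power
`t^{-q}`, which is recovered by carrying the expansion further (`HasSymbol.operator`).

Uniqueness follows by restricting to rays: the homogeneous parts of a Laurent series converging to
`0` vanish one after another, and each is a finite Laurent polynomial (`eq_zero_of_hasEval_zero`).
-/

theorem contDiff_partialDeriv {f : (Fin N → ℝ) → ℂ} (hf : ContDiff ℝ ∞ f) (i : Fin N) :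
    ContDiff ℝ ∞ (partialDeriv i f) :=
  (contDiff_infty_iff_fderiv.1 hf).2.clm_apply contDiff_const

theorem partialDeriv_comm {f : (Fin N → ℝ) → ℂ} (hf : ContDiff ℝ ∞ f) (i j : Fin N) :
    partialDeriv i (partialDeriv j f) = partialDeriv j (partialDeriv i f) := by
  have hd : Differentiable ℝ (fderiv ℝ f) :=
    (contDiff_infty_iff_fderiv.1 (contDiff_infty_iff_fderiv.1 hf).2).1
  have key : ∀ (a b : Fin N) (x : Fin N → ℝ), partialDeriv a (partialDeriv b f) x =
      fderiv ℝ (fderiv ℝ f) x (Pi.single a 1) (Pi.single b 1) := by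
    intro a b x
    have h := ((hd x).hasFDerivAt.clm_apply
      (hasFDerivAt_const (Pi.single b (1 : ℝ) : Fin N → ℝ) x)).fderiv
    change fderiv ℝ (fun y => fderiv ℝ f y (Pi.single b 1)) x (Pi.single a 1) = _
    rw [h]
    simp
  funext x
  rw [key, key]
  exact (hf.contDiffAt.isSymmSndFDerivAt
    (by rw [minSmoothness_of_isRCLikeNormedField]
        exact WithTop.coe_le_coe.2 (le_top (a := (2 : ℕ∞))))).eq _ _

theorem contDiff_iterate_partialDeriv {f : (Fin N → ℝ) → ℂ} (hf : ContDiff ℝ ∞ f) (i : Fin N)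
    (k : ℕ) : ContDiff ℝ ∞ ((partialDeriv i)^[k] f) := by
  induction k with
  | zero => exact hf
  | succ k ih => rw [Function.iterate_succ_apply']; exact contDiff_partialDeriv ih i

theorem partialDeriv_iterate_comm {f : (Fin N → ℝ) → ℂ} (hf : ContDiff ℝ ∞ f) (i j : Fin N)
    (k : ℕ) : partialDeriv j ((partialDeriv i)^[k] f) = (partialDeriv i)^[k] (partialDeriv j f) := by
  induction k with
  | zero => rfl
  | succ k ih =>
    rw [Function.iterate_succ_apply', Function.iterate_succ_apply', ← ih,
      partialDeriv_comm (contDiff_iterate_partialDeriv hf i k)]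

theorem contDiff_foldr_partialPow {f : (Fin N → ℝ) → ℂ} (hf : ContDiff ℝ ∞ f) (n : Fin N → ℕ)
    (l : List (Fin N)) :
    ContDiff ℝ ∞ (l.foldr (fun i g => partialPow i (n i : ℤ) g) f) := by
  induction l with
  | nil => exact hf
  | cons i l ih => exact contDiff_iterate_partialDeriv ih i (n i)

/-- The additional `∂_j` arises in the middle of the ordered product and is carried outwards by
commuting it past the operators applied later. Absence of repetitions ensures that it arises only
once. -/
theorem partialDeriv_foldr_partialPow {f : (Fin N → ℝ) → ℂ} (hf : ContDiff ℝ ∞ f)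
    (n : Fin N → ℕ) (j : Fin N) (l : List (Fin N)) (hl : l.Nodup) :
    l.foldr (fun i g => partialPow i ((n + Pi.single j 1 : Fin N → ℕ) i : ℤ) g) f =
      if j ∈ l then partialDeriv j (l.foldr (fun i g => partialPow i (n i : ℤ) g) f)
      else l.foldr (fun i g => partialPow i (n i : ℤ) g) f := by
  induction l with
  | nil => simp
  | cons i l ih =>
    have hl' := List.nodup_cons.1 hl
    rw [List.foldr_cons, List.foldr_cons, ih hl'.2]
    rcases eq_or_ne j i with rfl | hij
    · rw [if_neg hl'.1, if_pos (by simp)]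
      have : (n + Pi.single j 1 : Fin N → ℕ) j = n j + 1 := by simp
      rw [this]
      exact Function.iterate_succ_apply' _ _ _
    · have h1 : (n + Pi.single j 1 : Fin N → ℕ) i = n i := by simp [hij.symm]
      rw [h1]
      by_cases hj : j ∈ l
      · rw [if_pos hj, if_pos (by simp [hj])]
        exact (partialDeriv_iterate_comm (contDiff_foldr_partialPow hf n l) i j (n i)).symm
      · rw [if_neg hj, if_neg (by simp [hj, hij])]

/-- The definition of rapid decay controls only derivatives in the standard order. By commutation
these account for derivatives in every order, a family visibly stable under one more derivative. -/
theorem exists_mixedDeriv_eq_foldr {f : (Fin N → ℝ) → ℂ} (hf : ContDiff ℝ ∞ f)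
    (l : List (Fin N)) :
    ∃ n : Fin N → ℕ, mixedDeriv (fun i => (n i : ℤ)) f = l.foldr partialDeriv f := by
  induction l with
  | nil =>
    refine ⟨0, ?_⟩
    have : ∀ l : List (Fin N), l.foldr (fun i g => partialPow i ((0 : ℕ) : ℤ) g) f = f := by
      intro l
      induction l with
      | nil => rfl
      | cons i l ih => rw [List.foldr_cons, ih]; rfl
    exact this _
  | cons j l ih =>
    obtain ⟨n, hn⟩ := ih
    refine ⟨n + Pi.single j 1, ?_⟩
    have h := partialDeriv_foldr_partialPow hf n j (List.finRange N) (List.nodup_finRange N)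
    rw [if_pos (List.mem_finRange j)] at h
    rw [List.foldr_cons, ← hn]
    exact h

theorem exists_foldr_eq_mixedDeriv (f : (Fin N → ℝ) → ℂ) (n : Fin N → ℕ) :
    ∃ l : List (Fin N), mixedDeriv (fun i => (n i : ℤ)) f = l.foldr partialDeriv f := by
  have hrep : ∀ (i : Fin N) (k : ℕ) (l : List (Fin N)),
      (partialDeriv i)^[k] (l.foldr partialDeriv f) =
        (List.replicate k i ++ l).foldr partialDeriv f := by
    intro i k l
    induction k with
    | zero => rfl
    | succ k ih => rw [Function.iterate_succ_apply', ih]; rfl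
  have : ∀ l : List (Fin N), ∃ l' : List (Fin N),
      l.foldr (fun i g => partialPow i (n i : ℤ) g) f = l'.foldr partialDeriv f := by
    intro l
    induction l with
    | nil => exact ⟨[], rfl⟩
    | cons i l ih =>
      obtain ⟨l', h⟩ := ih
      refine ⟨List.replicate (n i) i ++ l', ?_⟩
      rw [List.foldr_cons, h]
      exact hrep i (n i) l'
  exact this _

/-! ### Weights and decay -/

/-- The weight `∏ (1 + |x_j|)`. -/
def weight (x : Fin N → ℝ) : ℝ := ∏ j, (1 + |x j|)

theorem one_le_weight (x : Fin N → ℝ) : 1 ≤ weight x :=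
  Finset.one_le_prod fun j _ => by linarith [abs_nonneg (x j)]

theorem weight_pos (x : Fin N → ℝ) : 0 < weight x := zero_lt_one.trans_le (one_le_weight x)

theorem weight_eq_mul (x : Fin N → ℝ) (i : Fin N) :
    weight x = (1 + |x i|) * ∏ j ∈ Finset.univ.erase i, (1 + |x j|) :=
  (Finset.mul_prod_erase _ _ (Finset.mem_univ i)).symm

theorem one_add_abs_le_weight (x : Fin N → ℝ) (i : Fin N) : 1 + |x i| ≤ weight x := by
  rw [weight_eq_mul x i]
  refine le_mul_of_one_le_right (by positivity) ?_
  exact Finset.one_le_prod fun j _ => by linarith [abs_nonneg (x j)]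

theorem weight_le_mul_weight_add_single {x : Fin N → ℝ} {i : Fin N} {s c : ℝ}
    (h : 1 + |x i| ≤ c * (1 + |x i + s|)) :
    weight x ≤ c * weight (x + s • Pi.single i 1) := by
  rw [weight_eq_mul x i, weight_eq_mul _ i, ← mul_assoc]
  have h2 : ∏ j ∈ Finset.univ.erase i, (1 + |(x + s • Pi.single i 1 : Fin N → ℝ) j|) =
      ∏ j ∈ Finset.univ.erase i, (1 + |x j|) := by
    refine Finset.prod_congr rfl fun j hj => ?_
    simp [Finset.ne_of_mem_erase hj]
  rw [h2]
  refine mul_le_mul_of_nonneg_right ?_ (Finset.prod_nonneg fun j _ => by positivity)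
  simpa using h

/-- Rapid decay of a function, without its derivatives. -/
def Decays (g : (Fin N → ℝ) → ℂ) : Prop :=
  ∀ (k : ℕ) (R : ℝ), ∃ C : ℝ, 0 ≤ C ∧ ∀ x : Fin N → ℝ, (∀ i, R ≤ x i) → ‖g x‖ * weight x ^ k ≤ C

/-- Since `(1+|x|)^k ≤ 2^k (1+|x|^k)`, the power of the weight is dominated by a product that
expands over subsets of the coordinates into finitely many monomials. -/
theorem decays_of_bounded {g : (Fin N → ℝ) → ℂ}
    (h : ∀ (m : Fin N → ℕ) (R : ℝ), ∃ C : ℝ, ∀ x : Fin N → ℝ, (∀ i, R ≤ x i) →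
      ‖(∏ i, (x i : ℂ) ^ m i) * g x‖ ≤ C) : Decays g := by
  intro k R
  choose C hC using fun s : Finset (Fin N) => h (fun i => if i ∈ s then k else 0) R
  refine ⟨∑ s ∈ (Finset.univ : Finset (Fin N)).powerset, (2 ^ k) ^ N * |C s|, by positivity, ?_⟩
  intro x hx
  have h1 : weight x ^ k ≤ (2 ^ k) ^ N * ∏ j, (1 + |x j| ^ k) := by
    have : (2 ^ k : ℝ) ^ N = ∏ _j : Fin N, (2 ^ k : ℝ) := by simp
    rw [weight, ← Finset.prod_pow, this, ← Finset.prod_mul_distrib]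
    refine Finset.prod_le_prod (fun j _ => by positivity) fun j _ => ?_
    rcases le_total |x j| 1 with hj | hj
    · calc (1 + |x j|) ^ k ≤ 2 ^ k := by gcongr; linarith
        _ ≤ 2 ^ k * (1 + |x j| ^ k) := le_mul_of_one_le_right (by positivity)
            (by linarith [pow_nonneg (abs_nonneg (x j)) k])
    · calc (1 + |x j|) ^ k ≤ (2 * |x j|) ^ k := by gcongr; linarith
        _ = 2 ^ k * |x j| ^ k := mul_pow _ _ _
        _ ≤ 2 ^ k * (1 + |x j| ^ k) := by gcongr; linarith
  rw [Finset.prod_one_add] at h1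
  calc ‖g x‖ * weight x ^ k ≤ ‖g x‖ * ((2 ^ k) ^ N * ∑ s ∈ (Finset.univ : Finset (Fin N)).powerset,
        ∏ j ∈ s, |x j| ^ k) := by gcongr
    _ = ∑ s ∈ (Finset.univ : Finset (Fin N)).powerset,
        (2 ^ k) ^ N * ((∏ j ∈ s, |x j| ^ k) * ‖g x‖) := by
      rw [Finset.mul_sum, Finset.mul_sum]
      exact Finset.sum_congr rfl fun s _ => by ring
    _ ≤ _ := by
      refine Finset.sum_le_sum fun s _ => ?_
      gcongr
      refine le_trans (le_of_eq ?_) ((hC s x hx).trans (le_abs_self _))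
      rw [norm_mul, norm_prod]
      congr 1
      rw [← Finset.prod_subset (Finset.subset_univ s)]
      · exact Finset.prod_congr rfl fun j hj => by simp [hj]
      · intro j _ hj
        simp [hj]

theorem Decays.bounded {g : (Fin N → ℝ) → ℂ} (hg : Decays g) (m : Fin N → ℕ) (R : ℝ) :
    ∃ C : ℝ, ∀ x : Fin N → ℝ, (∀ i, R ≤ x i) → ‖(∏ i, (x i : ℂ) ^ m i) * g x‖ ≤ C := by
  obtain ⟨C, -, hC⟩ := hg (∑ i, m i) R
  refine ⟨C, fun x hx => le_trans ?_ (hC x hx)⟩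
  rw [norm_mul, mul_comm, norm_prod]
  refine mul_le_mul_of_nonneg_left ?_ (norm_nonneg _)
  rw [← Finset.prod_pow_eq_pow_sum]
  refine Finset.prod_le_prod (fun j _ => norm_nonneg _) fun j _ => ?_
  rw [norm_pow]
  have h0 : ‖(x j : ℂ)‖ ≤ 1 + |x j| := by
    rw [Complex.norm_real, Real.norm_eq_abs]; linarith
  exact pow_le_pow_left₀ (norm_nonneg _) (h0.trans (one_add_abs_le_weight x j)) _

/-- This is the working form of rapid decay: a single weight replaces all monomials and lists of
derivatives replace multi-indices, so closure properties reduce to those of `Decays`. -/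
theorem isRapidDecay_iff {f : (Fin N → ℝ) → ℂ} :
    IsRapidDecay f ↔ ContDiff ℝ ∞ f ∧ ∀ l : List (Fin N), Decays (l.foldr partialDeriv f) := by
  constructor
  · intro hf
    refine ⟨hf.smooth, fun l => ?_⟩
    obtain ⟨n, hn⟩ := exists_mixedDeriv_eq_foldr hf.smooth l
    rw [← hn]
    exact decays_of_bounded fun m R => hf.bounded m n R
  · rintro ⟨h1, h2⟩
    refine ⟨h1, fun m n R => ?_⟩
    obtain ⟨l, hl⟩ := exists_foldr_eq_mixedDeriv f n
    rw [hl]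
    exact (h2 l).bounded m R

theorem IsRapidDecay.decays {f : (Fin N → ℝ) → ℂ} (hf : IsRapidDecay f) : Decays f :=
  (isRapidDecay_iff.1 hf).2 []

theorem IsRapidDecay.partialDeriv {f : (Fin N → ℝ) → ℂ} (hf : IsRapidDecay f) (i : Fin N) :
    IsRapidDecay (partialDeriv i f) := by
  rw [isRapidDecay_iff] at hf ⊢
  refine ⟨contDiff_partialDeriv hf.1 i, fun l => ?_⟩
  have := hf.2 (l ++ [i])
  rwa [List.foldr_append] at this

theorem Decays.add {f g : (Fin N → ℝ) → ℂ} (hf : Decays f) (hg : Decays g) : Decays (f + g) := by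
  intro k R
  obtain ⟨C, hC0, hC⟩ := hf k R
  obtain ⟨D, hD0, hD⟩ := hg k R
  refine ⟨C + D, by positivity, fun x hx => ?_⟩
  refine le_trans ?_ (add_le_add (hC x hx) (hD x hx))
  rw [← add_mul]
  have := (weight_pos x).le
  gcongr
  exact norm_add_le _ _

theorem Decays.smul {f : (Fin N → ℝ) → ℂ} (hf : Decays f) (c : ℂ) : Decays (c • f) := by
  intro k R
  obtain ⟨C, hC0, hC⟩ := hf k R
  refine ⟨‖c‖ * C, by positivity, fun x hx => ?_⟩
  rw [Pi.smul_apply, norm_smul, mul_assoc]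
  exact mul_le_mul_of_nonneg_left (hC x hx) (norm_nonneg c)

theorem partialDeriv_add {f g : (Fin N → ℝ) → ℂ} (hf : ContDiff ℝ ∞ f) (hg : ContDiff ℝ ∞ g)
    (i : Fin N) : partialDeriv i (f + g) = partialDeriv i f + partialDeriv i g := by
  funext x
  have h1 := (contDiff_infty_iff_fderiv.1 hf).1 x
  have h2 := (contDiff_infty_iff_fderiv.1 hg).1 x
  simp [partialDeriv, fderiv_add h1 h2]

theorem partialDeriv_smul {f : (Fin N → ℝ) → ℂ} (hf : ContDiff ℝ ∞ f) (c : ℂ)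
    (i : Fin N) : partialDeriv i (c • f) = c • partialDeriv i f := by
  funext x
  have h1 := (contDiff_infty_iff_fderiv.1 hf).1 x
  simp [partialDeriv, fderiv_const_smul h1 c]

theorem contDiff_foldr_partialDeriv {f : (Fin N → ℝ) → ℂ} (hf : ContDiff ℝ ∞ f)
    (l : List (Fin N)) : ContDiff ℝ ∞ (l.foldr partialDeriv f) := by
  induction l with
  | nil => exact hf
  | cons i l ih => exact contDiff_partialDeriv ih i

theorem foldr_partialDeriv_add {f g : (Fin N → ℝ) → ℂ} (hf : ContDiff ℝ ∞ f)
    (hg : ContDiff ℝ ∞ g) (l : List (Fin N)) :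
    l.foldr partialDeriv (f + g) = l.foldr partialDeriv f + l.foldr partialDeriv g := by
  induction l with
  | nil => rfl
  | cons i l ih =>
    rw [List.foldr_cons, ih, partialDeriv_add (contDiff_foldr_partialDeriv hf l)
      (contDiff_foldr_partialDeriv hg l)]
    rfl

theorem foldr_partialDeriv_smul {f : (Fin N → ℝ) → ℂ} (hf : ContDiff ℝ ∞ f) (c : ℂ)
    (l : List (Fin N)) : l.foldr partialDeriv (c • f) = c • l.foldr partialDeriv f := by
  induction l with
  | nil => rfl
  | cons i l ih =>
    rw [List.foldr_cons, ih, partialDeriv_smul (contDiff_foldr_partialDeriv hf l)]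
    rfl

theorem IsRapidDecay.add {f g : (Fin N → ℝ) → ℂ} (hf : IsRapidDecay f) (hg : IsRapidDecay g) :
    IsRapidDecay (f + g) := by
  rw [isRapidDecay_iff] at *
  refine ⟨hf.1.add hg.1, fun l => ?_⟩
  rw [foldr_partialDeriv_add hf.1 hg.1]
  exact (hf.2 l).add (hg.2 l)

theorem IsRapidDecay.smul {f : (Fin N → ℝ) → ℂ} (hf : IsRapidDecay f) (c : ℂ) :
    IsRapidDecay (c • f) := by
  rw [isRapidDecay_iff] at *
  refine ⟨contDiff_const.smul hf.1, fun l => ?_⟩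
  rw [foldr_partialDeriv_smul hf.1]
  exact (hf.2 l).smul c

/-! ### Integration along half-lines -/

/-- At the translated point `y`, both `weight x` and `1 + s` are at most `(1+2|R|) weight y`. Of
`k+2` powers of the weight at `y`, `k` pay for `weight x ^ k` and two for the integrable factor in
`s`. -/
theorem Decays.along {g : (Fin N → ℝ) → ℂ} (hg : Decays g) (i : Fin N) (k : ℕ) (R : ℝ) :
    ∃ C : ℝ, 0 ≤ C ∧ ∀ x : Fin N → ℝ, (∀ j, R ≤ x j) → ∀ s : ℝ, 0 ≤ s →
      ‖g (x + s • Pi.single i 1)‖ * weight x ^ k ≤ C * (1 + s ^ 2)⁻¹ := by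
  obtain ⟨C, hC0, hC⟩ := hg (k + 2) R
  have hc : 0 ≤ 1 + 2 * |R| := by positivity
  refine ⟨C * (1 + 2 * |R|) ^ (k + 2), by positivity, fun x hx s hs => ?_⟩
  set y := x + s • (Pi.single i 1 : Fin N → ℝ) with hy
  have hyR : ∀ j, R ≤ y j := by
    intro j
    refine (hx j).trans ?_
    simp only [hy, Pi.add_apply, Pi.smul_apply, smul_eq_mul]
    have : (0 : ℝ) ≤ (Pi.single i 1 : Fin N → ℝ) j := by
      rcases eq_or_ne j i with rfl | h <;> simp [*]
    nlinarith
  have h1 : weight x ≤ (1 + 2 * |R|) * weight y := by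
    apply weight_le_mul_weight_add_single
    have h3 : |x i| ≤ 2 * |R| + |x i + s| := by
      rcases le_total 0 (x i) with h | h
      · rw [abs_of_nonneg h]; linarith [abs_nonneg R, le_abs_self (x i + s)]
      · rw [abs_of_nonpos h]
        linarith [hx i, neg_abs_le R, abs_nonneg R, abs_nonneg (x i + s)]
    nlinarith [mul_nonneg (abs_nonneg R) (abs_nonneg (x i + s))]
  have h2 : 1 + s ≤ (1 + 2 * |R|) * weight y := by
    have h4 : 1 + s ≤ (1 + 2 * |R|) * (1 + |y i|) := by
      have : y i = x i + s := by simp [hy]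
      rw [this]
      have := hx i
      have h5 := le_abs_self (x i + s)
      nlinarith [mul_nonneg (abs_nonneg R) (abs_nonneg (x i + s)), neg_abs_le R]
    exact h4.trans (mul_le_mul_of_nonneg_left (one_add_abs_le_weight y i) hc)
  rw [← div_eq_mul_inv, le_div_iff₀ (by positivity)]
  have hwx := weight_pos x
  have hwy := weight_pos y
  calc ‖g y‖ * weight x ^ k * (1 + s ^ 2) ≤ ‖g y‖ * weight x ^ k * (1 + s) ^ 2 := by
        gcongr; nlinarith
    _ ≤ ‖g y‖ * ((1 + 2 * |R|) * weight y) ^ k * ((1 + 2 * |R|) * weight y) ^ 2 := by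
        gcongr
    _ = (‖g y‖ * weight y ^ (k + 2)) * (1 + 2 * |R|) ^ (k + 2) := by rw [mul_pow, mul_pow]; ring
    _ ≤ _ := by gcongr; exact hC y hyR

/-- The integral of `g` over the half-line from `x` in direction `i`. -/
def halfLine (i : Fin N) (g : (Fin N → ℝ) → ℂ) (x : Fin N → ℝ) : ℂ :=
  ∫ s in Set.Ioi (0 : ℝ), g (x + s • Pi.single i 1)

/-- Translating the half-line to a fixed domain makes differentiation under the integral sign
available in every direction, including the `i`-th. -/
theorem partialAntideriv_eq (i : Fin N) (g : (Fin N → ℝ) → ℂ) :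
    partialAntideriv i g = -halfLine i g := by
  funext x
  have h := (measurePreserving_add_left volume (x i)).setIntegral_preimage_emb
    (MeasurableEquiv.addLeft (x i)).measurableEmbedding (fun s => g (Function.update x i s))
    (Set.Ioi (x i))
  simp only [partialAntideriv, halfLine, Pi.neg_apply]
  rw [← h]
  have h2 : (fun s => x i + s) ⁻¹' Set.Ioi (x i) = Set.Ioi (0 : ℝ) := by
    ext s; simp
  rw [h2]
  congr 2
  funext s
  congr 1
  funext j
  rcases eq_or_ne j i with rfl | hj
  · simp
  · simp [hj]

theorem norm_clm_le_sum (L : (Fin N → ℝ) →L[ℝ] ℂ) : ‖L‖ ≤ ∑ j, ‖L (Pi.single j 1)‖ := by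
  refine L.opNorm_le_bound (Finset.sum_nonneg fun j _ => norm_nonneg _) fun v => ?_
  have hv : v = ∑ j, v j • (Pi.single j 1 : Fin N → ℝ) := by
    funext k
    simp [Finset.sum_apply, Pi.single_apply]
  conv_lhs => rw [hv]
  rw [map_sum, Finset.sum_mul]
  refine (norm_sum_le _ _).trans (Finset.sum_le_sum fun j _ => ?_)
  rw [map_smul, norm_smul, mul_comm]
  exact mul_le_mul_of_nonneg_left (norm_le_pi_norm v j) (norm_nonneg _)

theorem integrableOn_along {g : (Fin N → ℝ) → ℂ} (hc : Continuous g) (hg : Decays g) (i : Fin N)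
    (x : Fin N → ℝ) :
    IntegrableOn (fun s : ℝ => g (x + s • Pi.single i 1)) (Set.Ioi 0) := by
  obtain ⟨C, -, hC⟩ := hg.along i 0 (-‖x‖)
  refine Integrable.mono' ((integrable_inv_one_add_sq.const_mul C).integrableOn)
    (Continuous.aestronglyMeasurable (by fun_prop)) ?_
  refine (ae_restrict_mem measurableSet_Ioi).mono fun s hs => ?_
  simpa using hC x (fun j => (abs_le.1 (norm_le_pi_norm x j)).1) s (le_of_lt hs)

theorem hasFDerivAt_halfLine {g : (Fin N → ℝ) → ℂ} (hg : IsRapidDecay g) (i : Fin N)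
    (x : Fin N → ℝ) :
    IntegrableOn (fun s : ℝ => fderiv ℝ g (x + s • Pi.single i 1)) (Set.Ioi 0) ∧
    HasFDerivAt (halfLine i g)
      (∫ s in Set.Ioi (0 : ℝ), fderiv ℝ g (x + s • Pi.single i 1)) x := by
  have hd := contDiff_infty_iff_fderiv.1 hg.smooth
  have hcf : Continuous (fderiv ℝ g) := hd.2.continuous
  have hcg : Continuous g := hg.smooth.continuous
  -- The unit ball around `x` lies in the orthant with all coordinates at least `-(‖x‖+1)`, so one
  -- integrable majorant serves for all nearby points.
  choose C hC0 hC using fun j => (hg.partialDeriv j).decays.along i 0 (-(‖x‖ + 1))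
  have hint : IntegrableOn (fun s : ℝ => (∑ j, C j) * (1 + s ^ 2)⁻¹) (Set.Ioi 0) :=
    (integrable_inv_one_add_sq.const_mul _).integrableOn
  have hb : ∀ s ∈ Set.Ioi (0 : ℝ), ∀ y ∈ Metric.ball x 1,
      ‖fderiv ℝ g (y + s • Pi.single i 1)‖ ≤ (∑ j, C j) * (1 + s ^ 2)⁻¹ := by
    intro s hs y hy
    refine (norm_clm_le_sum _).trans ?_
    rw [Finset.sum_mul]
    refine Finset.sum_le_sum fun j _ => ?_
    have hy' : ∀ k, -(‖x‖ + 1) ≤ y k := by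
      intro k
      have h1 := (abs_le.1 (norm_le_pi_norm x k)).1
      have h2 := (abs_le.1 ((norm_le_pi_norm (y - x) k).trans (mem_ball_iff_norm.1 hy).le)).1
      rw [Pi.sub_apply] at h2
      linarith
    simpa [AsympLim.partialDeriv] using hC j y hy' s (le_of_lt hs)
  refine ⟨?_, ?_⟩
  · refine Integrable.mono' hint (Continuous.aestronglyMeasurable (by fun_prop)) ?_
    exact (ae_restrict_mem measurableSet_Ioi).mono fun s hs =>
      hb s hs x (Metric.mem_ball_self one_pos)
  · refine hasFDerivAt_integral_of_dominated_of_fderiv_le (Metric.ball_mem_nhds x one_pos)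
      (Eventually.of_forall fun y => Continuous.aestronglyMeasurable (by fun_prop))
      (integrableOn_along hcg hg.decays i x).integrable
      (Continuous.aestronglyMeasurable (by fun_prop))
      ((ae_restrict_mem measurableSet_Ioi).mono fun s hs => hb s hs) hint
      (Eventually.of_forall fun s y _ => ?_)
    exact (hasFDerivAt_comp_add_right _).2 (hd.1 (y + s • Pi.single i 1)).hasFDerivAt

theorem fderiv_halfLine_apply {g : (Fin N → ℝ) → ℂ} (hg : IsRapidDecay g) (i : Fin N)
    (x v : Fin N → ℝ) :
    fderiv ℝ (halfLine i g) x v = ∫ s in Set.Ioi (0 : ℝ), fderiv ℝ g (x + s • Pi.single i 1) v := by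
  rw [(hasFDerivAt_halfLine hg i x).2.fderiv,
    ContinuousLinearMap.integral_apply (hasFDerivAt_halfLine hg i x).1]

theorem partialDeriv_halfLine {g : (Fin N → ℝ) → ℂ} (hg : IsRapidDecay g) (i j : Fin N) :
    partialDeriv j (halfLine i g) = halfLine i (partialDeriv j g) :=
  funext fun x => fderiv_halfLine_apply hg i x _

/-- The partial derivatives of a half-line integral are half-line integrals of partial derivatives,
again of rapidly decaying functions; hence the induction is over all `g` simultaneously. -/
theorem contDiff_halfLine (i : Fin N) (n : ℕ) : ∀ {g : (Fin N → ℝ) → ℂ}, IsRapidDecay g →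
    ContDiff ℝ n (halfLine i g) := by
  induction n with
  | zero =>
    intro g hg
    refine contDiff_zero.2 (continuous_iff_continuousAt.2 fun x => ?_)
    exact (hasFDerivAt_halfLine hg i x).2.continuousAt
  | succ n ih =>
    intro g hg
    push_cast
    refine contDiff_succ_iff_fderiv.2 ⟨fun x => (hasFDerivAt_halfLine hg i x).2.differentiableAt,
      fun h => absurd h (by simp), contDiff_clm_apply_iff.2 fun v => ?_⟩
    have hv : v = ∑ j, v j • (Pi.single j 1 : Fin N → ℝ) := by
      funext k
      simp [Finset.sum_apply, Pi.single_apply]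
    have : (fun x => fderiv ℝ (halfLine i g) x v) =
        fun x => ∑ j, v j • halfLine i (partialDeriv j g) x := by
      funext x
      conv_lhs => rw [hv]
      rw [map_sum]
      refine Finset.sum_congr rfl fun j _ => ?_
      rw [map_smul, ← partialDeriv_halfLine hg]
      rfl
    rw [this]
    exact ContDiff.sum fun j _ => (ih (hg.partialDeriv j)).const_smul (v j)

theorem Decays.halfLine {g : (Fin N → ℝ) → ℂ} (hg : Decays g) (i : Fin N) :
    Decays (halfLine i g) := by
  intro k R
  obtain ⟨C, hC0, hC⟩ := hg.along i k R
  refine ⟨C * ∫ s in Set.Ioi (0 : ℝ), (1 + s ^ 2)⁻¹, ?_, fun x hx => ?_⟩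
  · exact mul_nonneg hC0 (integral_nonneg fun s => by positivity)
  · have hw := pow_pos (weight_pos x) k
    rw [← le_div_iff₀ hw, mul_div_assoc, mul_comm C, div_mul_eq_mul_div, mul_comm _ C,
      mul_div_right_comm, ← integral_const_mul]
    refine norm_integral_le_of_norm_le
      ((integrable_inv_one_add_sq.const_mul _).integrableOn) ?_
    refine (ae_restrict_mem measurableSet_Ioi).mono fun s hs => ?_
    rw [div_mul_eq_mul_div, le_div_iff₀ hw]
    exact hC x hx s (le_of_lt hs)

theorem IsRapidDecay.foldr {f : (Fin N → ℝ) → ℂ} (hf : IsRapidDecay f) (l : List (Fin N)) :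
    IsRapidDecay (l.foldr AsympLim.partialDeriv f) := by
  induction l with
  | nil => exact hf
  | cons i l ih => exact ih.partialDeriv i

theorem IsRapidDecay.halfLine {g : (Fin N → ℝ) → ℂ} (hg : IsRapidDecay g) (i : Fin N) :
    IsRapidDecay (halfLine i g) := by
  rw [isRapidDecay_iff]
  refine ⟨contDiff_infty.2 fun n => contDiff_halfLine i n hg, fun l => ?_⟩
  have : l.foldr AsympLim.partialDeriv (AsympLim.halfLine i g) =
      AsympLim.halfLine i (l.foldr AsympLim.partialDeriv g) := by
    induction l with
    | nil => rfl
    | cons j l ih => rw [List.foldr_cons, ih, partialDeriv_halfLine (hg.foldr l)]; rfl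
  rw [this]
  exact (hg.foldr l).decays.halfLine i

theorem hasDerivAt_along {g : (Fin N → ℝ) → ℂ} (hg : ContDiff ℝ ∞ g) (i : Fin N) (c : ℝ)
    (x : Fin N → ℝ) (s : ℝ) :
    HasDerivAt (fun s : ℝ => g (x + (s * c) • Pi.single i 1))
      (c * partialDeriv i g (x + (s * c) • Pi.single i 1)) s := by
  have h1 : HasDerivAt (fun s : ℝ => x + (s * c) • (Pi.single i 1 : Fin N → ℝ))
      (c • Pi.single i 1) s := by
    have := (((hasDerivAt_id s).mul_const c).smul_const
      (Pi.single i 1 : Fin N → ℝ)).const_add x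
    simpa using this
  have h2 := ((contDiff_infty_iff_fderiv.1 hg).1
    (x + (s * c) • Pi.single i 1)).hasFDerivAt.comp_hasDerivAt s h1
  rw [map_smul] at h2
  simpa [partialDeriv, Function.comp_def] using h2

/-- The fundamental theorem of calculus, with the boundary term at infinity killed by decay. With
`partialDeriv_halfLine` it makes `partialAntideriv` a two-sided inverse of `∂_i`. -/
theorem halfLine_partialDeriv {g : (Fin N → ℝ) → ℂ} (hg : IsRapidDecay g) (i : Fin N) :
    halfLine i (partialDeriv i g) = -g := by
  funext x
  have hder : ∀ s : ℝ, HasDerivAt (fun s : ℝ => g (x + s • Pi.single i 1))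
      (partialDeriv i g (x + s • Pi.single i 1)) s := by
    intro s
    simpa using hasDerivAt_along hg.smooth i 1 x s
  obtain ⟨C, -, hC⟩ := hg.decays.along i 0 (-‖x‖)
  have hlim : Tendsto (fun s : ℝ => g (x + s • Pi.single i 1)) atTop (𝓝 0) := by
    refine squeeze_zero_norm' (a := fun s : ℝ => C * (1 + s ^ 2)⁻¹) ?_ ?_
    · filter_upwards [eventually_ge_atTop 0] with s hs
      simpa using hC x (fun j => (abs_le.1 (norm_le_pi_norm x j)).1) s hs
    · have h1 : Tendsto (fun s : ℝ => 1 + s ^ 2) atTop atTop :=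
        tendsto_atTop_add_const_left _ _ (tendsto_pow_atTop two_ne_zero)
      simpa using h1.inv_tendsto_atTop.const_mul C
  have := integral_Ioi_of_hasDerivAt_of_tendsto (hder 0).continuousAt.continuousWithinAt
    (fun s _ => hder s) (integrableOn_along (hg.partialDeriv i).smooth.continuous
      (hg.partialDeriv i).decays i x) hlim
  simpa [halfLine] using this

/-! ### The space of rapidly decaying functions and its commuting automorphisms `∂_i` -/

/-- The space of smooth functions of rapid decay. -/
def rapidDecay (N : ℕ) : Submodule ℂ ((Fin N → ℝ) → ℂ) where
  carrier := {f | IsRapidDecay f}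
  add_mem' hf hg := IsRapidDecay.add hf hg
  zero_mem' := by
    have h : ∀ l : List (Fin N), l.foldr partialDeriv (0 : (Fin N → ℝ) → ℂ) = 0 := by
      intro l
      induction l with
      | nil => rfl
      | cons i l ih => rw [List.foldr_cons, ih]; funext x; simp [partialDeriv]
    refine isRapidDecay_iff.2 ⟨contDiff_const, fun l k R => ⟨0, le_rfl, fun x _ => ?_⟩⟩
    rw [h]; simp
  smul_mem' c _ hf := IsRapidDecay.smul hf c

/-- `∂_i` as an automorphism of the space of smooth functions of rapid decay. -/
def derivEquiv (i : Fin N) : rapidDecay N ≃ₗ[ℂ] rapidDecay N where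
  toFun f := ⟨partialDeriv i f, IsRapidDecay.partialDeriv f.2 i⟩
  map_add' f g := Subtype.ext (partialDeriv_add f.2.smooth g.2.smooth i)
  map_smul' c f := Subtype.ext (partialDeriv_smul f.2.smooth c i)
  invFun f := ⟨partialAntideriv i f, by
    rw [partialAntideriv_eq]
    exact (rapidDecay N).neg_mem (IsRapidDecay.halfLine f.2 i)⟩
  left_inv f := Subtype.ext (by
    change partialAntideriv i (partialDeriv i f) = f
    rw [partialAntideriv_eq, halfLine_partialDeriv f.2, neg_neg])
  right_inv f := Subtype.ext (by
    change partialDeriv i (partialAntideriv i f) = f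
    have h := partialDeriv_smul (IsRapidDecay.halfLine f.2 i).smooth (-1) i
    rw [neg_one_smul, neg_one_smul] at h
    rw [partialAntideriv_eq, h, partialDeriv_halfLine f.2, halfLine_partialDeriv f.2, neg_neg])

theorem derivEquiv_commute (i j : Fin N) : Commute (derivEquiv i) (derivEquiv j) :=
  LinearEquiv.ext fun f => Subtype.ext (partialDeriv_comm f.2.smooth i j)

theorem coe_derivEquiv_zpow (i : Fin N) (k : ℤ) (f : rapidDecay N) :
    ((derivEquiv i ^ k) f : (Fin N → ℝ) → ℂ) = partialPow i k f := by
  cases k with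
  | ofNat k =>
    change ((derivEquiv i ^ (k : ℤ)) f : (Fin N → ℝ) → ℂ) = (partialDeriv i)^[k] f
    rw [zpow_natCast]
    induction k with
    | zero => rfl
    | succ k ih =>
      rw [pow_succ', Function.iterate_succ_apply', ← ih]
      rfl
  | negSucc k =>
    change _ = (partialAntideriv i)^[k + 1] f
    rw [zpow_negSucc, ← inv_pow]
    induction k with
    | zero => rfl
    | succ k ih =>
      rw [pow_succ', Function.iterate_succ_apply', ← ih]
      rfl

theorem list_prod_map_mul_of_commute {M ι : Type*} [Monoid M] (g h : ι → M)
    (hc : ∀ i j, Commute (g i) (h j)) (l : List ι) :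
    (l.map fun i => g i * h i).prod = (l.map g).prod * (l.map h).prod := by
  induction l with
  | nil => simp
  | cons i l ih =>
    have : Commute (h i) (l.map g).prod := Commute.list_prod_right _ _ fun x hx => by
      obtain ⟨j, -, rfl⟩ := List.mem_map.1 hx
      exact (hc j i).symm
    simp only [List.map_cons, List.prod_cons, ih]
    rw [mul_assoc, mul_assoc, ← mul_assoc (h i), this.eq, mul_assoc]

theorem list_prod_map_mulSingle {M ι : Type*} [Monoid M] [DecidableEq ι] (i : ι) (x : M)
    (l : List ι) (hl : l.Nodup) :
    (l.map (Pi.mulSingle i x : ι → M)).prod = if i ∈ l then x else 1 := by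
  induction l with
  | nil => simp
  | cons j l ih =>
    have hl' := List.nodup_cons.1 hl
    rw [List.map_cons, List.prod_cons, ih hl'.2]
    rcases eq_or_ne i j with rfl | hij
    · simp [hl'.1]
    · simp [hij]

theorem mixedDeriv_eq_prod (m : Fin N → ℤ) (f : rapidDecay N) :
    mixedDeriv m f = (((List.finRange N).map fun i => derivEquiv i ^ m i).prod f : rapidDecay N) := by
  unfold mixedDeriv
  generalize List.finRange N = l
  induction l with
  | nil => rfl
  | cons i l ih =>
    rw [List.foldr_cons, ih, List.map_cons, List.prod_cons, ← coe_derivEquiv_zpow]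
    rfl

/-- Commutativity of the automorphisms `∂_i` lets the additional power leave its place in the
ordered product and act first. This is what makes the Hadamard product compatible with monomial
multiplication. -/
theorem mixedDeriv_add_single (m : Fin N → ℤ) (i : Fin N) (j : ℤ) (f : rapidDecay N) :
    mixedDeriv (m + Pi.single i j) f = mixedDeriv m ((derivEquiv i ^ j) f) := by
  rw [mixedDeriv_eq_prod, mixedDeriv_eq_prod]
  have h : (fun k => derivEquiv k ^ (m + Pi.single i j : Fin N → ℤ) k) =
      fun k : Fin N => derivEquiv k ^ m k *
        (Pi.mulSingle i (derivEquiv i ^ j) : Fin N → (rapidDecay N ≃ₗ[ℂ] rapidDecay N)) k := by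
    funext k
    rcases eq_or_ne k i with rfl | hk
    · simp [zpow_add]
    · simp [hk]
  rw [h, list_prod_map_mul_of_commute, list_prod_map_mulSingle _ _ _ (List.nodup_finRange N),
    if_pos (List.mem_finRange i)]
  · rfl
  · intro a b
    rcases eq_or_ne b i with rfl | hb
    · rw [Pi.mulSingle_eq_same]
      exact (derivEquiv_commute a b).zpow_zpow _ _
    · rw [Pi.mulSingle_eq_of_ne hb]
      exact Commute.one_right _

theorem mixedDeriv_zero (f : (Fin N → ℝ) → ℂ) : mixedDeriv 0 f = f := by
  unfold mixedDeriv
  generalize List.finRange N = l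
  induction l with
  | nil => rfl
  | cons i l ih => rw [List.foldr_cons, ih]; rfl

/-! ### Taylor expansion with decaying remainder -/

/-- The remainder of order `n+1` of `ψ j` vanishes at `0` and has as derivative the remainder of
order `n` of `ψ (j+1)`, so the mean value inequality gains one factor `t` per step. The factor
`1/n!` is not needed. -/
theorem norm_sub_taylor_le {ψ : ℕ → ℝ → ℂ} (hψ : ∀ j s, HasDerivAt (ψ j) (ψ (j + 1) s) s)
    {t B : ℝ} (n : ℕ) : ∀ j : ℕ, (∀ s ∈ Set.Icc 0 t, ‖ψ (j + n) s‖ ≤ B) → ∀ s ∈ Set.Icc 0 t,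
      ‖ψ j s - ∑ q ∈ Finset.range n, (s : ℂ) ^ q / (q.factorial : ℂ) * ψ (j + q) 0‖ ≤ B * t ^ n := by
  induction n with
  | zero =>
    intro j hB s hs
    simpa using hB s hs
  | succ n ih =>
    intro j hB s hs
    have ht : 0 ≤ t := hs.1.trans hs.2
    have hB0 : 0 ≤ B := (norm_nonneg _).trans (hB s hs)
    have ih' := ih (j + 1) (fun s hs => by
      have := hB s hs
      rwa [show j + (n + 1) = j + 1 + n by ring] at this)
    have hder : ∀ x : ℝ, HasDerivAt (fun s : ℝ => ψ j s -
        ∑ q ∈ Finset.range (n + 1), (s : ℂ) ^ q / (q.factorial : ℂ) * ψ (j + q) 0)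
        (ψ (j + 1) x - ∑ q ∈ Finset.range n,
          (x : ℂ) ^ q / (q.factorial : ℂ) * ψ (j + 1 + q) 0) x := by
      intro x
      have hsum : HasDerivAt (fun s : ℝ => ∑ q ∈ Finset.range (n + 1),
          (s : ℂ) ^ q / (q.factorial : ℂ) * ψ (j + q) 0)
          (∑ q ∈ Finset.range (n + 1), (q * (x : ℂ) ^ (q - 1)) / (q.factorial : ℂ) * ψ (j + q) 0)
          x := by
        refine HasDerivAt.fun_sum fun q _ => ?_
        have := (((hasDerivAt_pow q (x : ℂ)).comp_ofReal).div_const (q.factorial : ℂ)).mul_const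
          (ψ (j + q) 0)
        simpa using this
      rw [Finset.sum_range_succ'] at hsum
      have heq : ∑ q ∈ Finset.range n, (((q + 1 : ℕ) : ℂ) * (x : ℂ) ^ (q + 1 - 1)) /
          ((q + 1).factorial : ℂ) * ψ (j + (q + 1)) 0 +
          ((0 : ℕ) : ℂ) * (x : ℂ) ^ (0 - 1) / ((0 : ℕ).factorial : ℂ) * ψ (j + 0) 0 =
          ∑ q ∈ Finset.range n, (x : ℂ) ^ q / (q.factorial : ℂ) * ψ (j + 1 + q) 0 := by
        rw [Nat.cast_zero, zero_mul, zero_div, zero_mul, add_zero]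
        refine Finset.sum_congr rfl fun q _ => ?_
        rw [Nat.factorial_succ, Nat.cast_mul, Nat.add_sub_cancel,
          mul_div_mul_left _ _ (Nat.cast_ne_zero.2 (Nat.succ_ne_zero q)),
          show j + (q + 1) = j + 1 + q by ring]
      rw [heq] at hsum
      exact (hψ j x).sub hsum
    have hmv := norm_image_sub_le_of_norm_deriv_le_segment' (a := 0) (b := t) (C := B * t ^ n)
      (fun x _ => (hder x).hasDerivWithinAt) (fun x hx => ih' x ⟨hx.1, hx.2.le⟩) s hs
    have h0 : ψ j 0 - ∑ q ∈ Finset.range (n + 1),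
        ((0 : ℝ) : ℂ) ^ q / (q.factorial : ℂ) * ψ (j + q) 0 = 0 := by
      rw [Finset.sum_range_succ', Finset.sum_eq_zero]
      · simp
      · intro q _; simp
    rw [h0, sub_zero, sub_zero] at hmv
    refine hmv.trans ?_
    rw [pow_succ, ← mul_assoc]
    exact mul_le_mul_of_nonneg_left hs.2 (by positivity)

/-- Taylor expansion in direction `i` at scale `t`, with a remainder that is `O(t^n)` uniformly and
of prescribed decay. -/
theorem exists_taylor_bound (f : rapidDecay N) (i : Fin N) (c : ℝ) (n k : ℕ) (R : ℝ) :
    ∃ C : ℝ, 0 ≤ C ∧ ∀ t ∈ Set.Icc (0 : ℝ) 1, ∀ x : Fin N → ℝ, (∀ j, R ≤ x j) →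
      ‖f.1 (x + (t * c) • Pi.single i 1) - ∑ q ∈ Finset.range n,
        ((t : ℂ) * c) ^ q / (q.factorial : ℂ) * ((derivEquiv i ^ q) f).1 x‖ * weight x ^ k
        ≤ C * t ^ n := by
  have hG : IsRapidDecay ((derivEquiv i ^ n) f).1 := ((derivEquiv i ^ n) f).2
  -- For `0 ≤ s ≤ 1` the translation by `s c` moves a coordinate by at most `|c|`, so the bound is
  -- taken on an orthant enlarged by that amount.
  obtain ⟨C, hC0, hC⟩ := hG.decays k (R - |c|)
  refine ⟨|c| ^ n * C * (1 + |c|) ^ k, by positivity, fun t ht x hx => ?_⟩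
  have hw := weight_pos x
  have hder : ∀ (j : ℕ) (s : ℝ), HasDerivAt
      (fun s : ℝ => (c : ℂ) ^ j * ((derivEquiv i ^ j) f).1 (x + (s * c) • Pi.single i 1))
      ((c : ℂ) ^ (j + 1) * ((derivEquiv i ^ (j + 1)) f).1 (x + (s * c) • Pi.single i 1)) s := by
    intro j s
    have h := (hasDerivAt_along ((derivEquiv i ^ j) f).2.smooth i c x s).const_mul ((c : ℂ) ^ j)
    rw [← mul_assoc, ← pow_succ] at h
    rw [pow_succ' (derivEquiv i)]
    exact h
  have hB : ∀ s ∈ Set.Icc (0 : ℝ) t,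
      ‖(c : ℂ) ^ n * ((derivEquiv i ^ n) f).1 (x + (s * c) • Pi.single i 1)‖ ≤
        |c| ^ n * C * (1 + |c|) ^ k / weight x ^ k := by
    intro s hs
    have hsc : |s * c| ≤ |c| := by
      rw [abs_mul, abs_of_nonneg hs.1]
      exact mul_le_of_le_one_left (abs_nonneg c) (hs.2.trans ht.2)
    set y := x + (s * c) • (Pi.single i 1 : Fin N → ℝ) with hy
    have hyR : ∀ j, R - |c| ≤ y j := by
      intro j
      rcases eq_or_ne j i with rfl | hj
      · simp only [hy, Pi.add_apply, Pi.smul_apply, Pi.single_eq_same, smul_eq_mul, mul_one]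
        linarith [hx j, neg_abs_le (s * c)]
      · simp only [hy, Pi.add_apply, Pi.smul_apply, Pi.single_eq_of_ne hj, smul_eq_mul, mul_zero]
        linarith [hx j, abs_nonneg c]
    have hwt : weight x ≤ (1 + |c|) * weight y := by
      apply weight_le_mul_weight_add_single
      have h1 : |x i| ≤ |x i + s * c| + |s * c| := by
        have := abs_sub (x i + s * c) (s * c)
        rwa [add_sub_cancel_right] at this
      nlinarith [mul_nonneg (abs_nonneg c) (abs_nonneg (x i + s * c))]
    rw [le_div_iff₀ (by positivity), norm_mul, norm_pow, Complex.norm_real, Real.norm_eq_abs]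
    have hwy := weight_pos y
    calc |c| ^ n * ‖((derivEquiv i ^ n) f).1 y‖ * weight x ^ k
        ≤ |c| ^ n * ‖((derivEquiv i ^ n) f).1 y‖ * ((1 + |c|) * weight y) ^ k := by gcongr
      _ = |c| ^ n * (‖((derivEquiv i ^ n) f).1 y‖ * weight y ^ k) * (1 + |c|) ^ k := by rw [mul_pow]; ring
      _ ≤ _ := by gcongr; exact hC y hyR
  have hmain := norm_sub_taylor_le hder n 0 (by simpa using hB) t ⟨ht.1, le_rfl⟩
  rw [div_mul_eq_mul_div, le_div_iff₀ (by positivity)] at hmain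
  refine le_trans (le_of_eq ?_) hmain
  congr 2
  simp only [pow_zero, one_mul, zero_add, zero_mul, zero_smul, add_zero]
  congr 1
  refine Finset.sum_congr rfl fun q _ => ?_
  ring

/-! ### Sums over `ℕ^N` with binomial weights -/

/-- Every finite set of indices lies in the box spanned by its projections, where the sum of
products factors into a product of partial sums. -/
theorem summable_pi_prod {f : Fin N → ℕ → ℝ} (h0 : ∀ i n, 0 ≤ f i n) (hf : ∀ i, Summable (f i)) :
    Summable fun n : Fin N → ℕ => ∏ i, f i (n i) := by
  refine summable_of_sum_le (c := ∏ i, ∑' n, f i n)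
    (fun n => Finset.prod_nonneg fun i _ => h0 i _) fun s => ?_
  calc ∑ n ∈ s, ∏ i, f i (n i)
      ≤ ∑ n ∈ Fintype.piFinset (fun i => s.image fun n => n i), ∏ i, f i (n i) := by
        refine Finset.sum_le_sum_of_subset_of_nonneg (fun n hn => ?_)
          fun n _ _ => Finset.prod_nonneg fun i _ => h0 i _
        exact Fintype.mem_piFinset.2 fun i => Finset.mem_image_of_mem _ hn
    _ = ∏ i, ∑ n ∈ s.image (fun n => n i), f i n := (Finset.prod_univ_sum _ _).symm
    _ ≤ _ := by
        refine Finset.prod_le_prod (fun i _ => Finset.sum_nonneg fun n _ => h0 i n) fun i _ => ?_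
        exact (hf i).sum_le_tsum _ fun n _ => h0 i n

theorem multichoose_le_pow (p n : ℕ) : p.multichoose n ≤ (n + 1) ^ p := by
  induction p generalizing n with
  | zero => cases n <;> simp
  | succ p ih =>
    induction n with
    | zero => simp
    | succ n ihn =>
      rw [Nat.multichoose_succ_succ]
      calc p.multichoose (n + 1) + (p + 1).multichoose n
          ≤ (n + 1 + 1) ^ p + (n + 1) ^ (p + 1) := add_le_add (ih _) ihn
        _ ≤ (n + 1 + 1) ^ p + (n + 1 + 1) ^ p * (n + 1) := by
          rw [pow_succ (n + 1)]
          gcongr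
          omega
        _ = (n + 1 + 1) ^ (p + 1) := by ring

/-- The product of the numbers of multisets of size `n_i` from `p_i` elements. -/
def multiWeight (p n : Fin N → ℕ) : ℕ := ∏ i, (p i).multichoose (n i)

theorem multiWeight_zero_left (n : Fin N → ℕ) : multiWeight 0 n = if n = 0 then 1 else 0 := by
  unfold multiWeight
  split_ifs with h
  · subst h; simp
  · obtain ⟨i, hi⟩ := Function.ne_iff.1 h
    refine Finset.prod_eq_zero (Finset.mem_univ i) ?_
    obtain ⟨k, hk⟩ := Nat.exists_eq_succ_of_ne_zero hi
    rw [hk]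
    simp

theorem multiWeight_eq_mul (p n : Fin N → ℕ) (i : Fin N) : multiWeight p n =
    (p i).multichoose (n i) * ∏ j ∈ Finset.univ.erase i, (p j).multichoose (n j) :=
  (Finset.mul_prod_erase _ _ (Finset.mem_univ i)).symm

theorem prod_erase_add_single_left (p n : Fin N → ℕ) (i : Fin N) :
    ∏ j ∈ Finset.univ.erase i, ((p + Pi.single i 1 : Fin N → ℕ) j).multichoose (n j) =
      ∏ j ∈ Finset.univ.erase i, (p j).multichoose (n j) :=
  Finset.prod_congr rfl fun j hj => by simp [Finset.ne_of_mem_erase hj]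

/-- Pascal's rule in the `i`-th coordinate: `multiWeight p` is the coefficient sequence of `∏
(1-x_j)^{-p_j}`, and multiplication by `1 - x_i` lowers `p_i` by one. -/
theorem multiWeight_add_single (p n : Fin N → ℕ) (i : Fin N) :
    multiWeight (p + Pi.single i 1) (n + Pi.single i 1) =
      multiWeight p (n + Pi.single i 1) + multiWeight (p + Pi.single i 1) n := by
  rw [multiWeight_eq_mul _ _ i, multiWeight_eq_mul p _ i, multiWeight_eq_mul _ n i,
    prod_erase_add_single_left, prod_erase_add_single_left]
  have : ∏ j ∈ Finset.univ.erase i, (p j).multichoose ((n + Pi.single i 1 : Fin N → ℕ) j) =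
      ∏ j ∈ Finset.univ.erase i, (p j).multichoose (n j) :=
    Finset.prod_congr rfl fun j hj => by simp [Finset.ne_of_mem_erase hj]
  rw [this]
  simp only [Pi.add_apply, Pi.single_eq_same, Nat.multichoose_succ_succ]
  ring

theorem multiWeight_add_single_of_eq_zero (p : Fin N → ℕ) {n : Fin N → ℕ} {i : Fin N}
    (h : n i = 0) : multiWeight (p + Pi.single i 1) n = multiWeight p n := by
  rw [multiWeight_eq_mul _ _ i, multiWeight_eq_mul p _ i, prod_erase_add_single_left, h]
  simp

theorem add_single_mem_range {n : Fin N → ℕ} {i : Fin N} (h : n i ≠ 0) :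
    ∃ m : Fin N → ℕ, m + Pi.single i 1 = n := by
  refine ⟨n - Pi.single i 1, funext fun j => ?_⟩
  rcases eq_or_ne j i with rfl | hj
  · simp; omega
  · simp [hj]

theorem multiWeight_le_add_single (p n : Fin N → ℕ) (i : Fin N) :
    multiWeight p n ≤ multiWeight (p + Pi.single i 1) n := by
  by_cases h : n i = 0
  · rw [multiWeight_add_single_of_eq_zero p h]
  · obtain ⟨m, rfl⟩ := add_single_mem_range h
    rw [multiWeight_add_single]
    exact Nat.le_add_right _ _

/-- Summation by parts in one variable. -/
theorem tsum_multiWeight_add_single (p : Fin N → ℕ) (i : Fin N) {g : (Fin N → ℕ) → ℂ}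
    (hg : Summable fun n => (multiWeight (p + Pi.single i 1) n : ℂ) * g n) :
    Summable (fun n => (multiWeight p n : ℂ) * g n) ∧
    ∑' n, (multiWeight (p + Pi.single i 1) n : ℂ) * g n = ∑' n, (multiWeight p n : ℂ) * g n +
      ∑' n, (multiWeight (p + Pi.single i 1) n : ℂ) * g (n + Pi.single i 1) := by
  have h1 : Summable fun n => (multiWeight p n : ℂ) * g n := by
    refine Summable.of_norm_bounded hg.norm fun n => ?_
    rw [norm_mul, norm_mul, Complex.norm_natCast, Complex.norm_natCast]
    gcongr
    exact multiWeight_le_add_single p n i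
  refine ⟨h1, ?_⟩
  -- The translated sum is reindexed along `n ↦ n + e_i`. The indices missed have `n i = 0`, where
  -- the two weights agree and the difference vanishes.
  have h2 : ∑' n, (multiWeight (p + Pi.single i 1) n : ℂ) * g (n + Pi.single i 1) =
      ∑' n, ((multiWeight (p + Pi.single i 1) n : ℂ) * g n - (multiWeight p n : ℂ) * g n) := by
    refine Eq.trans ?_ (Function.Injective.tsum_eq
      (add_left_injective (Pi.single i 1 : Fin N → ℕ)) ?_)
    · refine tsum_congr fun n => ?_
      rw [multiWeight_add_single]
      push_cast
      ring
    · intro n hn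
      by_contra hr
      refine hn ?_
      have : n i = 0 := by
        by_contra h
        exact hr (add_single_mem_range h)
      simp [multiWeight_add_single_of_eq_zero p this]
  rw [h2, hg.tsum_sub h1]
  ring

/-- The point `t (K n + c)`. -/
def samplePoint (K : Fin N → ℕ) (c : Fin N → ℝ) (t : ℝ) (n : Fin N → ℕ) : Fin N → ℝ :=
  fun i => t * (K i * n i + c i)

/-! ### Bounds for lattice sums, uniform in the scale -/

theorem le_samplePoint (K : Fin N → ℕ) (c : Fin N → ℝ) {t : ℝ} (ht : 0 ≤ t) (n : Fin N → ℕ)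
    (i : Fin N) : -(t * ‖c‖) ≤ samplePoint K c t n i := by
  have h1 := (abs_le.1 (norm_le_pi_norm c i)).1
  have h2 : (0 : ℝ) ≤ (K i : ℝ) * n i := by positivity
  unfold samplePoint
  nlinarith

/-- In each coordinate `min t 1 * (n_i + 1)` is at most a constant times `1 + |x_i|` at the sample
point `x`. Of its `P + 2` powers, `P` absorb the multiset number and two make the sum over `n_i`
converge. -/
theorem multiWeight_le_weight (p K : Fin N → ℕ) (hK : ∀ i, 0 < K i) (c : Fin N → ℝ) :
    ∃ (k q : ℕ) (B : (Fin N → ℕ) → ℝ), Summable B ∧ (∀ n, 0 ≤ B n) ∧ ∀ t : ℝ, 0 < t → ∀ n,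
      (multiWeight p n : ℝ) * min t 1 ^ q ≤ B n * weight (samplePoint K c t n) ^ k := by
  set P := ∑ i, p i with hP
  refine ⟨P + 2, (P + 2) * N, fun n => ∏ i, (1 + |c i|) ^ (P + 2) / (n i + 1 : ℝ) ^ 2,
    summable_pi_prod (f := fun i n => (1 + |c i|) ^ (P + 2) / (n + 1 : ℝ) ^ 2)
      (fun i n => by positivity) fun i => ?_, fun n => by positivity, fun t ht n => ?_⟩
  · have h := (summable_nat_add_iff 1).2 (Real.summable_one_div_nat_pow.2 one_lt_two)
    have h' := h.mul_left ((1 + |c i|) ^ (P + 2))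
    refine h'.congr fun n => ?_
    push_cast
    ring
  · have hm : 0 < min t 1 := lt_min ht one_pos
    rw [weight, ← Finset.prod_pow, ← Finset.prod_mul_distrib, multiWeight, pow_mul]
    push_cast
    have hN : (min t 1 ^ (P + 2)) ^ N = ∏ _i : Fin N, min t 1 ^ (P + 2) := by simp
    rw [hN, ← Finset.prod_mul_distrib]
    refine Finset.prod_le_prod (fun i _ => by positivity) fun i _ => ?_
    have hn0 : (0 : ℝ) ≤ n i := Nat.cast_nonneg _
    have hK1 : (1 : ℝ) ≤ K i := by exact_mod_cast hK i
    have key : min t 1 * (n i + 1) ≤ (1 + |c i|) * (1 + |samplePoint K c t n i|) := by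
      have ha : (n i : ℝ) ≤ |K i * n i + c i| + |c i| := by
        have h1 : (K i * n i : ℝ) ≤ |K i * n i + c i| + |c i| := by
          linarith [le_abs_self ((K i : ℝ) * n i + c i), neg_abs_le (c i)]
        nlinarith
      have hb : min t 1 * |K i * n i + c i| ≤ |samplePoint K c t n i| := by
        rw [samplePoint, abs_mul, abs_of_pos ht]
        exact mul_le_mul_of_nonneg_right (min_le_left _ _) (abs_nonneg _)
      have h1 : min t 1 ≤ 1 := min_le_right _ _
      have hc := abs_nonneg (c i)
      have hs := abs_nonneg (samplePoint K c t n i)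
      calc min t 1 * (n i + 1) ≤ min t 1 * (|K i * n i + c i| + |c i| + 1) := by gcongr
        _ = min t 1 * |K i * n i + c i| + min t 1 * (|c i| + 1) := by ring
        _ ≤ |samplePoint K c t n i| + 1 * (|c i| + 1) := by gcongr
        _ ≤ _ := by nlinarith
    have hp : p i ≤ P := Finset.single_le_sum (f := p) (fun _ _ => Nat.zero_le _) (Finset.mem_univ i)
    have hmc : ((p i).multichoose (n i) : ℝ) ≤ (n i + 1 : ℝ) ^ P := by
      calc ((p i).multichoose (n i) : ℝ) ≤ ((n i + 1) ^ p i : ℕ) := by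
            exact_mod_cast multichoose_le_pow _ _
        _ = (n i + 1 : ℝ) ^ p i := by push_cast; rfl
        _ ≤ _ := pow_le_pow_right₀ (by linarith) hp
    rw [div_mul_eq_mul_div, le_div_iff₀ (by positivity), ← mul_pow]
    calc ((p i).multichoose (n i) : ℝ) * min t 1 ^ (P + 2) * (n i + 1 : ℝ) ^ 2
        ≤ (n i + 1 : ℝ) ^ P * min t 1 ^ (P + 2) * (n i + 1 : ℝ) ^ 2 := by gcongr
      _ = (min t 1 * (n i + 1)) ^ (P + 2) := by rw [mul_pow]; ring
      _ ≤ _ := by gcongr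

/-- The sum `∑ W_p(n) g(t (K n + c))` over `n ∈ ℕ^N`. -/
def latticeSum (p K : Fin N → ℕ) (c : Fin N → ℝ) (t : ℝ) (g : (Fin N → ℝ) → ℂ) : ℂ :=
  ∑' n, (multiWeight p n : ℂ) * g (samplePoint K c t n)

/-- The loss `t^{-q}` depends only on `p`, `K` and `c`, not on the function summed. Although far
from sharp, it is harmless, because expansions may be truncated arbitrarily late. -/
theorem exists_latticeSum_bound (p K : Fin N → ℕ) (hK : ∀ i, 0 < K i) (c : Fin N → ℝ) :
    ∃ (k q : ℕ) (A : ℝ), 0 ≤ A ∧ ∀ t : ℝ, 0 < t → ∀ (g : (Fin N → ℝ) → ℂ) (C : ℝ),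
      (∀ n, ‖g (samplePoint K c t n)‖ * weight (samplePoint K c t n) ^ k ≤ C) →
      (Summable fun n => (multiWeight p n : ℂ) * g (samplePoint K c t n)) ∧
      ‖latticeSum p K c t g‖ * min t 1 ^ q ≤ A * C := by
  obtain ⟨k, q, B, hB, hB0, h⟩ := multiWeight_le_weight p K hK c
  refine ⟨k, q, ∑' n, B n, tsum_nonneg hB0, fun t ht g C hg => ?_⟩
  have hm : 0 < min t 1 ^ q := pow_pos (lt_min ht one_pos) q
  have hb : ∀ n, ‖(multiWeight p n : ℂ) * g (samplePoint K c t n)‖ ≤ B n * (C / min t 1 ^ q) := by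
    intro n
    have hw := pow_pos (weight_pos (samplePoint K c t n)) k
    rw [norm_mul, Complex.norm_natCast, ← mul_div_assoc, le_div_iff₀ hm]
    calc (multiWeight p n : ℝ) * ‖g (samplePoint K c t n)‖ * min t 1 ^ q
        = (multiWeight p n : ℝ) * min t 1 ^ q * ‖g (samplePoint K c t n)‖ := by ring
      _ ≤ B n * weight (samplePoint K c t n) ^ k * ‖g (samplePoint K c t n)‖ := by
        exact mul_le_mul_of_nonneg_right (h t ht n) (norm_nonneg _)
      _ = B n * (‖g (samplePoint K c t n)‖ * weight (samplePoint K c t n) ^ k) := by ring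
      _ ≤ B n * C := mul_le_mul_of_nonneg_left (hg n) (hB0 n)
  have hs := hB.mul_right (C / min t 1 ^ q)
  refine ⟨Summable.of_norm_bounded hs hb, ?_⟩
  have := tsum_of_norm_bounded hs.hasSum hb
  rw [tsum_mul_right, ← mul_div_assoc, le_div_iff₀ hm] at this
  exact this

theorem summable_latticeSum (p K : Fin N → ℕ) (hK : ∀ i, 0 < K i) (c : Fin N → ℝ) {t : ℝ}
    (ht : 0 < t) {g : (Fin N → ℝ) → ℂ} (hg : Decays g) :
    Summable fun n => (multiWeight p n : ℂ) * g (samplePoint K c t n) := by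
  obtain ⟨k, q, A, -, h⟩ := exists_latticeSum_bound p K hK c
  obtain ⟨C, -, hC⟩ := hg k (-(t * ‖c‖))
  exact (h t ht g C fun n => hC _ (le_samplePoint K c ht.le n)).1

/-- The functionals `T'` arise from the functionals `T` by applying the operator `∑ c_j (t ∂_i)^j`,
in the sense of asymptotic expansions as `t → +0`. -/
def IsOperatorExpansion (T T' : ℝ → rapidDecay N → ℂ) (i : Fin N) (c : ℕ → ℂ) : Prop :=
  ∃ q : ℕ, ∀ (f : rapidDecay N) (n : ℕ), ∃ J, n ≤ J ∧ ∃ C : ℝ, ∀ t : ℝ, 0 < t → t ≤ 1 →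
    ‖T' t f - ∑ j ∈ Finset.range J, c j * (t : ℂ) ^ j * T t ((derivEquiv i ^ j) f)‖ * t ^ q ≤
      C * t ^ n

/-! ### Translation and division as operator expansions of lattice sums -/

theorem samplePoint_add_single (K : Fin N → ℕ) (c : Fin N → ℝ) (t s : ℝ) (n : Fin N → ℕ)
    (i : Fin N) : samplePoint K (c + s • Pi.single i 1) t n =
      samplePoint K c t n + (t * s) • Pi.single i 1 := by
  funext j
  simp only [samplePoint, Pi.add_apply, Pi.smul_apply, smul_eq_mul]
  ring

theorem samplePoint_add_single_right (K : Fin N → ℕ) (c : Fin N → ℝ) (t : ℝ) (n : Fin N → ℕ)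
    (i : Fin N) : samplePoint K c t (n + Pi.single i 1) =
      samplePoint K c t n + (t * K i) • Pi.single i 1 := by
  funext j
  rcases eq_or_ne j i with rfl | hj
  · simp [samplePoint]; ring
  · simp [samplePoint, hj]

theorem latticeSum_sum (p K : Fin N → ℕ) (hK : ∀ i, 0 < K i) (c : Fin N → ℝ) {t : ℝ} (ht : 0 < t)
    (s : Finset ℕ) (a : ℕ → ℂ) (g : ℕ → rapidDecay N) :
    latticeSum p K c t (fun x => ∑ j ∈ s, a j * (g j).1 x) =
      ∑ j ∈ s, a j * latticeSum p K c t (g j) := by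
  have hs : ∀ j, Summable fun n => (multiWeight p n : ℂ) * (g j).1 (samplePoint K c t n) :=
    fun j => summable_latticeSum p K hK c ht (IsRapidDecay.decays (g j).2)
  simp only [latticeSum, ← tsum_mul_left]
  rw [← Summable.tsum_finsetSum fun j _ => (hs j).mul_left (a j)]
  refine tsum_congr fun n => ?_
  rw [Finset.mul_sum]
  exact Finset.sum_congr rfl fun j _ => by ring

theorem decays_sum (s : Finset ℕ) (a : ℕ → ℂ) (g : ℕ → rapidDecay N) :
    Decays fun x => ∑ j ∈ s, a j * (g j).1 x := by
  have h := (∑ j ∈ s, a j • g j : rapidDecay N).2.decays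
  convert h using 1
  funext x
  simp [Finset.sum_apply]

/-- Moving `c_i` by `s` composes the functional with the translation `e^{s t ∂_i}`. Its Taylor
remainder is `O(t^n)` with enough decay to be summed over the lattice. -/
theorem latticeSum_shift (p K : Fin N → ℕ) (hK : ∀ i, 0 < K i) (c : Fin N → ℝ) (s : ℝ)
    (i : Fin N) :
    IsOperatorExpansion (fun t f => latticeSum p K c t f)
      (fun t f => latticeSum p K (c + s • Pi.single i 1) t f) i
      (fun j => (s : ℂ) ^ j / (j.factorial : ℂ)) := by
  obtain ⟨k, q, A, hA0, hA⟩ := exists_latticeSum_bound p K hK c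
  refine ⟨q, fun f n => ⟨n, le_rfl, ?_⟩⟩
  obtain ⟨C, hC0, hC⟩ := exists_taylor_bound f i s n k (-‖c‖)
  refine ⟨A * C, fun t ht ht1 => ?_⟩
  have hR : ∀ n i, -‖c‖ ≤ samplePoint K c t n i := fun n i =>
    (neg_le_neg (mul_le_of_le_one_left (norm_nonneg c) ht1)).trans (le_samplePoint K c ht.le n i)
  set F : ℕ → rapidDecay N := fun j => (derivEquiv i ^ j) f with hF
  set a : ℕ → ℂ := fun j => ((t : ℂ) * s) ^ j / (j.factorial : ℂ) with ha
  set E : (Fin N → ℝ) → ℂ := fun x => f.1 (x + (t * s) • Pi.single i 1) -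
    ∑ j ∈ Finset.range n, a j * (F j).1 x with hE
  have hb : ∀ m, ‖E (samplePoint K c t m)‖ * weight (samplePoint K c t m) ^ k ≤ C * t ^ n := by
    intro m
    have := hC t ⟨ht.le, ht1⟩ (samplePoint K c t m) (hR m)
    simpa only [hE, ha, hF] using this
  have h := (hA t ht E (C * t ^ n) hb).2
  rw [min_eq_left ht1, ← mul_assoc] at h
  have h2 := summable_latticeSum p K hK c ht (decays_sum (Finset.range n) a F)
  have h3 := summable_latticeSum p K hK (c + s • Pi.single i 1) ht (IsRapidDecay.decays f.2)
  have h4 : ∑ j ∈ Finset.range n, (s : ℂ) ^ j / (j.factorial : ℂ) * (t : ℂ) ^ j *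
      latticeSum p K c t (F j) = ∑ j ∈ Finset.range n, a j * latticeSum p K c t (F j) :=
    Finset.sum_congr rfl fun j _ => by simp only [ha, mul_pow]; ring
  have hval : latticeSum p K (c + s • Pi.single i 1) t f - ∑ j ∈ Finset.range n,
      (s : ℂ) ^ j / (j.factorial : ℂ) * (t : ℂ) ^ j * latticeSum p K c t (F j) =
      latticeSum p K c t E := by
    rw [h4, ← latticeSum_sum p K hK c ht]
    simp only [latticeSum]
    rw [← h3.tsum_sub h2]
    refine tsum_congr fun m => ?_
    rw [samplePoint_add_single, mul_sub]
  rw [← hval] at h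
  exact h

/-- Division by `1 - e^{t K_i ∂_i}`, for the power series `b` with `b (e^X - 1) = X`. -/
theorem latticeSum_div (p K : Fin N → ℕ) (hK : ∀ i, 0 < K i) (c : Fin N → ℝ) (i : Fin N)
    (b : ℕ → ℂ) (hb : ∀ d, ∑ k ∈ Finset.range (d + 1), b k * (((d - k).factorial : ℕ) : ℂ)⁻¹ =
      b d + if d = 1 then 1 else 0) :
    IsOperatorExpansion
      (fun t f => (t : ℂ)⁻¹ * latticeSum p K c t ((derivEquiv i ^ (-1 : ℤ)) f))
      (fun t f => latticeSum (p + Pi.single i 1) K c t f) i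
      (fun j => -(K i : ℂ)⁻¹ * ((K i : ℂ) ^ j * b j)) := by
  obtain ⟨k, q, A, hA0, hA⟩ := exists_latticeSum_bound (p + Pi.single i 1) K hK c
  -- One power of `t` is spent on the division by `h`. Taking two further terms also keeps the index
  -- `1`, which produces `h f`, in the range when `n = 0`.
  refine ⟨q, fun f n => ⟨n + 2, by omega, ?_⟩⟩
  set F : ℕ → rapidDecay N := fun m => (derivEquiv i ^ m) ((derivEquiv i ^ (-1 : ℤ)) f) with hF
  have hF1 : F 1 = f := by simp [hF]
  have hFm : ∀ m j, (derivEquiv i ^ j) (F m) = F (m + j) := by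
    intro m j
    simp only [hF]
    rw [add_comm, pow_add]
    rfl
  have hFn : ∀ m, (derivEquiv i ^ (-1 : ℤ)) ((derivEquiv i ^ m) f) = F m := by
    intro m
    simp only [hF]
    have : derivEquiv i ^ (-1 : ℤ) * derivEquiv i ^ m = derivEquiv i ^ m * derivEquiv i ^ (-1 : ℤ) :=
      ((Commute.refl (derivEquiv i)).zpow_left _).pow_right _
    exact congrArg (fun e => e f) this
  choose C hC0 hC using fun m => exists_taylor_bound (F m) i (K i) (n + 2 - m) k (-‖c‖)
  have hKi : (K i : ℂ) ≠ 0 := Nat.cast_ne_zero.2 (hK i).ne'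
  have hKr : (0 : ℝ) < K i := Nat.cast_pos.2 (hK i)
  set C' : ℝ := ∑ m ∈ Finset.range (n + 2), ‖b m‖ * (K i : ℝ) ^ m * C m with hC'
  refine ⟨(K i : ℝ)⁻¹ * (A * C'), fun t ht ht1 => ?_⟩
  have ht0 : (t : ℂ) ≠ 0 := Complex.ofReal_ne_zero.2 ht.ne'
  have hR : ∀ n i, -‖c‖ ≤ samplePoint K c t n i := fun n i =>
    (neg_le_neg (mul_le_of_le_one_left (norm_nonneg c) ht1)).trans (le_samplePoint K c ht.le n i)
  set h : ℂ := t * K i with hh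
  have hh0 : h ≠ 0 := mul_ne_zero ht0 hKi
  -- As `F m` is `∂_i^{m-1} f`, this is the truncation of `b(h∂_i) ∂_i^{-1} f`, the formal solution
  -- of `(e^{h∂_i} - 1) G = h f`.
  set G : (Fin N → ℝ) → ℂ := fun x => ∑ m ∈ Finset.range (n + 2), (b m * h ^ m) * (F m).1 x with hG
  set E : (Fin N → ℝ) → ℂ := fun x => ∑ m ∈ Finset.range (n + 2), (b m * h ^ m) *
    ((F m).1 (x + (t * K i) • Pi.single i 1) - ∑ j ∈ Finset.range (n + 2 - m),
      h ^ j / (j.factorial : ℂ) * (F (m + j)).1 x) with hE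
  -- The `m`-th term is expanded to order `n + 2 - m` only, so that its remainder has total order `n
  -- + 2`. Collecting the main terms along diagonals turns `hb` into the difference equation, with
  -- error `E`.
  have hGE : ∀ x, G (x + (t * K i) • Pi.single i 1) = G x + h * f.1 x + E x := by
    intro x
    have h1 : ∑ m ∈ Finset.range (n + 2), (b m * h ^ m) * ∑ j ∈ Finset.range (n + 2 - m),
        h ^ j / (j.factorial : ℂ) * (F (m + j)).1 x = G x + h * f.1 x := by
      have h2 := Finset.sum_range_diag_flip (n + 2)
        (fun m j => (b m * h ^ m) * (h ^ j / (j.factorial : ℂ) * (F (m + j)).1 x))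
      simp only [Finset.mul_sum]
      rw [← h2]
      have h3 : ∀ d ∈ Finset.range (n + 2), ∑ m ∈ Finset.range (d + 1),
          (b m * h ^ m) * (h ^ (d - m) / ((d - m).factorial : ℂ) * (F (m + (d - m))).1 x) =
          (b d * h ^ d) * (F d).1 x + if d = 1 then h * f.1 x else 0 := by
        intro d _
        have h4 : ∀ m ∈ Finset.range (d + 1),
            (b m * h ^ m) * (h ^ (d - m) / ((d - m).factorial : ℂ) * (F (m + (d - m))).1 x) =
            (b m * (((d - m).factorial : ℕ) : ℂ)⁻¹) * (h ^ d * (F d).1 x) := by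
          intro m hm
          have hmd : m + (d - m) = d := by
            have := Finset.mem_range.1 hm
            omega
          rw [hmd]
          have : h ^ d = h ^ m * h ^ (d - m) := by rw [← pow_add, hmd]
          rw [this]
          ring
        rw [Finset.sum_congr rfl h4, ← Finset.sum_mul, hb]
        split_ifs with hd
        · subst hd
          rw [hF1]
          ring
        · ring
      rw [Finset.sum_congr rfl h3, Finset.sum_add_distrib, Finset.sum_ite_eq', if_pos (by simp)]
    rw [← h1, hE, hG, ← Finset.sum_add_distrib]
    exact Finset.sum_congr rfl fun m _ => by ring
  have hEb : ∀ m, ‖E (samplePoint K c t m)‖ * weight (samplePoint K c t m) ^ k ≤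
      C' * t ^ (n + 2) := by
    intro m
    have hw := pow_pos (weight_pos (samplePoint K c t m)) k
    rw [hE, hC', Finset.sum_mul]
    refine (mul_le_mul_of_nonneg_right (norm_sum_le _ _) hw.le).trans ?_
    rw [Finset.sum_mul]
    refine Finset.sum_le_sum fun j hj => ?_
    have h5 := hC j t ⟨ht.le, ht1⟩ (samplePoint K c t m) (hR m)
    have hn : n + 2 = j + (n + 2 - j) := by
      have := Finset.mem_range.1 hj
      omega
    have h6 : ‖b j * h ^ j‖ = ‖b j‖ * (K i : ℝ) ^ j * t ^ j := by
      rw [norm_mul, norm_pow, hh, norm_mul, Complex.norm_real, Complex.norm_natCast,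
        Real.norm_eq_abs, abs_of_pos ht, mul_pow]
      ring
    rw [norm_mul, h6, mul_assoc]
    simp only [hFm] at h5
    calc ‖b j‖ * (K i : ℝ) ^ j * t ^ j * _ ≤ ‖b j‖ * (K i : ℝ) ^ j * t ^ j *
          (C j * t ^ (n + 2 - j)) := by
          refine mul_le_mul_of_nonneg_left ?_ (by positivity)
          simpa [hh] using h5
      _ = ‖b j‖ * (K i : ℝ) ^ j * C j * (t ^ j * t ^ (n + 2 - j)) := by ring
      _ = _ := by rw [← pow_add, ← hn]
  have hEs := hA t ht E (C' * t ^ (n + 2)) hEb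
  have hGs := summable_latticeSum (p + Pi.single i 1) K hK c ht
    (decays_sum (Finset.range (n + 2)) (fun m => b m * h ^ m) F)
  have hfs := summable_latticeSum (p + Pi.single i 1) K hK c ht (IsRapidDecay.decays f.2)
  -- Once the translated sum is rewritten by `hGE`, the sum of `G` with weight `p + e_i` stands on
  -- both sides and cancels. What remains expresses the sum of `f` through that of `G` with weight
  -- `p`, up to the sum of `E`.
  have habel := (tsum_multiWeight_add_single p i
    (g := fun n => G (samplePoint K c t n)) hGs).2
  have hshift : ∑' n, (multiWeight (p + Pi.single i 1) n : ℂ) *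
      G (samplePoint K c t (n + Pi.single i 1)) = latticeSum (p + Pi.single i 1) K c t G +
        h * latticeSum (p + Pi.single i 1) K c t f + latticeSum (p + Pi.single i 1) K c t E := by
    simp only [latticeSum]
    rw [← tsum_mul_left, ← hGs.tsum_add (hfs.mul_left h), ← (hGs.add (hfs.mul_left h)).tsum_add hEs.1]
    refine tsum_congr fun m => ?_
    rw [samplePoint_add_single_right, hGE]
    ring
  rw [hshift] at habel
  have hlin : latticeSum p K c t G = ∑ m ∈ Finset.range (n + 2), (b m * h ^ m) *
      latticeSum p K c t (F m) := latticeSum_sum p K hK c ht _ _ _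
  have hval : latticeSum (p + Pi.single i 1) K c t f - ∑ j ∈ Finset.range (n + 2),
      -(K i : ℂ)⁻¹ * ((K i : ℂ) ^ j * b j) * (t : ℂ) ^ j *
        ((t : ℂ)⁻¹ * latticeSum p K c t (F j)) =
      -(h⁻¹ * latticeSum (p + Pi.single i 1) K c t E) := by
    have h7 : ∑ j ∈ Finset.range (n + 2), -(K i : ℂ)⁻¹ * ((K i : ℂ) ^ j * b j) * (t : ℂ) ^ j *
        ((t : ℂ)⁻¹ * latticeSum p K c t (F j)) = -(h⁻¹ * latticeSum p K c t G) := by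
      rw [hlin, Finset.mul_sum, ← Finset.sum_neg_distrib]
      refine Finset.sum_congr rfl fun j _ => ?_
      rw [hh, mul_pow, mul_inv]
      ring
    have h8 : latticeSum p K c t G + h * latticeSum (p + Pi.single i 1) K c t f +
        latticeSum (p + Pi.single i 1) K c t E = 0 := by
      have h9 : latticeSum (p + Pi.single i 1) K c t G = latticeSum p K c t G +
          (latticeSum (p + Pi.single i 1) K c t G + h * latticeSum (p + Pi.single i 1) K c t f +
            latticeSum (p + Pi.single i 1) K c t E) := habel
      linear_combination -h9
    rw [h7]
    field_simp
    linear_combination h8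
  simp only [hFn]
  rw [hval, norm_neg, norm_mul, norm_inv, hh, norm_mul, Complex.norm_real, Complex.norm_natCast,
    Real.norm_eq_abs, abs_of_pos ht]
  have h10 := hEs.2
  rw [min_eq_left ht1] at h10
  calc (t * (K i : ℝ))⁻¹ * ‖latticeSum (p + Pi.single i 1) K c t E‖ * t ^ q
      = (t * (K i : ℝ))⁻¹ * (‖latticeSum (p + Pi.single i 1) K c t E‖ * t ^ q) := by ring
    _ ≤ (t * (K i : ℝ))⁻¹ * (A * (C' * t ^ (n + 2))) := by gcongr
    _ = (K i : ℝ)⁻¹ * (A * C') * (t ^ n * t) := by rw [pow_add]; field_simp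
    _ ≤ (K i : ℝ)⁻¹ * (A * C') * (t ^ n * 1) := by
      have : 0 ≤ C' := Finset.sum_nonneg fun m _ =>
        mul_nonneg (by positivity) (hC0 m)
      gcongr
    _ = _ := by ring

/-! ### Power series in one of the variables -/

/-- Substitution of the variable `t_i` into a power series. -/
def varSeries {R : Type} [CommRing R] (i : Fin N) : PowerSeries R →+* MvLaurentSeries N R :=
  (HahnSeries.embDomainRingHom
    ((AddMonoidHom.single (fun _ : Fin N => ℤ) i).comp (Nat.castAddMonoidHom ℤ))
    ((Pi.single_injective i).comp Nat.cast_injective) (fun a b => by simp)).comp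
    (HahnSeries.toPowerSeries.symm : PowerSeries R ≃+* HahnSeries ℕ R).toRingHom

theorem varSeries_coeff_single {R : Type} [CommRing R] (i : Fin N) (c : PowerSeries R) (n : ℕ) :
    (varSeries i c).coeff (Pi.single i (n : ℤ)) = PowerSeries.coeff n c := by
  have h := HahnSeries.embDomain_coeff
    (f := (⟨⟨((AddMonoidHom.single (fun _ : Fin N => ℤ) i).comp (Nat.castAddMonoidHom ℤ)),
      ((Pi.single_injective i).comp Nat.cast_injective)⟩, by intro a b; simp⟩ : ℕ ↪o (Fin N → ℤ)))
    (x := HahnSeries.toPowerSeries.symm c) (a := n)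
  rw [HahnSeries.toPowerSeries_symm_apply_coeff] at h
  exact h

theorem varSeries_coeff_of_forall_ne {R : Type} [CommRing R] (i : Fin N) (c : PowerSeries R)
    {m : Fin N → ℤ} (hm : ∀ n : ℕ, Pi.single i (n : ℤ) ≠ m) : (varSeries i c).coeff m = 0 :=
  HahnSeries.embDomain_of_notMem_range (by rintro ⟨n, hn⟩; exact hm n hn)

theorem varSeries_X {R : Type} [CommRing R] (i : Fin N) :
    varSeries i (PowerSeries.X : PowerSeries R) = HahnSeries.single (Pi.single i 1) 1 := by
  classical
  ext m
  by_cases h : ∃ n : ℕ, Pi.single i (n : ℤ) = m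
  · obtain ⟨n, rfl⟩ := h
    rw [varSeries_coeff_single, PowerSeries.coeff_X, HahnSeries.coeff_single]
    have : (Pi.single i (n : ℤ) : Fin N → ℤ) = Pi.single i 1 ↔ n = 1 := by
      rw [(Pi.single_injective i).eq_iff]; norm_cast
    simp only [this]
  · push Not at h
    rw [varSeries_coeff_of_forall_ne i _ h, HahnSeries.coeff_single_of_ne]
    intro h1
    exact h 1 (by rw [h1]; rfl)

theorem varSeries_C {R : Type} [CommRing R] (i : Fin N) (a : R) :
    varSeries i (PowerSeries.C a) = HahnSeries.single 0 a := by
  classical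
  ext m
  by_cases h : ∃ n : ℕ, Pi.single i (n : ℤ) = m
  · obtain ⟨n, rfl⟩ := h
    rw [varSeries_coeff_single, PowerSeries.coeff_C, HahnSeries.coeff_single]
    have : (Pi.single i (n : ℤ) : Fin N → ℤ) = 0 ↔ n = 0 := by
      rw [Pi.single_eq_zero_iff]; norm_cast
    simp only [this]
  · push Not at h
    rw [varSeries_coeff_of_forall_ne i _ h, HahnSeries.coeff_single_of_ne]
    intro h1
    exact h 0 (by rw [h1]; simp)

theorem map_varSeries {R S : Type} [CommRing R] [CommRing S] (f : R →+* S) (i : Fin N)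
    (c : PowerSeries R) : (varSeries i c).map f = varSeries i (PowerSeries.map f c) := by
  ext m
  rw [HahnSeries.map_coeff]
  by_cases h : ∃ n : ℕ, Pi.single i (n : ℤ) = m
  · obtain ⟨n, rfl⟩ := h
    rw [varSeries_coeff_single, varSeries_coeff_single, PowerSeries.coeff_map]
  · push Not at h
    rw [varSeries_coeff_of_forall_ne i _ h, varSeries_coeff_of_forall_ne i _ h, map_zero]

/-- The expansion of `1 / (1 - e^{k t_i})`. -/
def geomSeries (R : Type) [CommRing R] [Algebra ℚ R] (i : Fin N) (k : ℕ) : MvLaurentSeries N R :=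
  HahnSeries.single (-Pi.single i 1) 1 * varSeries i
    (PowerSeries.C (algebraMap ℚ R (-(k : ℚ)⁻¹)) *
      PowerSeries.rescale (k : R) (bernoulliPowerSeries R))

/-- The expansion of `∏ e^{c_i t_i} / (1 - e^{K_i t_i})^{p_i}`. -/
def symbolSeries {R : Type} [CommRing R] [Algebra ℚ R] (p K : Fin N → ℕ) (c : Fin N → R) :
    MvLaurentSeries N R :=
  (∏ i, varSeries i (PowerSeries.rescale (c i) (PowerSeries.exp R))) *
    ∏ i, geomSeries R i (K i) ^ p i

/-- Coefficientwise application of a ring homomorphism. -/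
def mapSeries {R S : Type} [CommRing R] [CommRing S] (f : R →+* S) :
    MvLaurentSeries N R →+* MvLaurentSeries N S where
  toFun φ := φ.map f
  map_one' := HahnSeries.map_one f.toMonoidWithZeroHom
  map_mul' _ _ := HahnSeries.map_mul f.toNonUnitalRingHom
  map_zero' := HahnSeries.map_zero (f : ZeroHom R S)
  map_add' _ _ := HahnSeries.map_add f.toAddMonoidHom

theorem map_bernoulliPowerSeries {R S : Type} [CommRing R] [CommRing S] [Algebra ℚ R]
    [Algebra ℚ S] (f : R →+* S) :
    PowerSeries.map f (bernoulliPowerSeries R) = bernoulliPowerSeries S := by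
  ext n
  rw [PowerSeries.coeff_map, bernoulliPowerSeries, bernoulliPowerSeries, PowerSeries.coeff_mk,
    PowerSeries.coeff_mk, RingHom.map_rat_algebraMap]

theorem map_rescale {R S : Type} [CommRing R] [CommRing S] (f : R →+* S) (a : R)
    (c : PowerSeries R) : PowerSeries.map f (PowerSeries.rescale a c) =
      PowerSeries.rescale (f a) (PowerSeries.map f c) := by
  ext n
  simp [PowerSeries.coeff_map, PowerSeries.coeff_rescale]

/-- The series is thus built once over `ℂ[u]` and specialized at each `u`; this is where polynomial
dependence of the coefficients on `u` comes from. -/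
theorem map_symbolSeries {R S : Type} [CommRing R] [CommRing S] [Algebra ℚ R] [Algebra ℚ S]
    (f : R →+* S) (p K : Fin N → ℕ) (c : Fin N → R) :
    (symbolSeries p K c).map f = symbolSeries p K (fun i => f (c i)) := by
  change mapSeries f (symbolSeries p K c) = _
  have h1 : ∀ (i : Fin N) (c : PowerSeries R),
      mapSeries f (varSeries i c) = varSeries i (PowerSeries.map f c) := map_varSeries f
  have h2 : ∀ (i : Fin N) (k : ℕ), mapSeries f (geomSeries R i k) = geomSeries S i k := by
    intro i k
    rw [geomSeries, map_mul, h1, map_mul, map_rescale, map_bernoulliPowerSeries]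
    have h3 : mapSeries f (HahnSeries.single (-Pi.single i 1 : Fin N → ℤ) (1 : R)) =
        HahnSeries.single (-Pi.single i 1) (1 : S) := by
      change (HahnSeries.single (-Pi.single i 1 : Fin N → ℤ) (1 : R)).map (f : ZeroHom R S) = _
      rw [HahnSeries.map_single]
      congr 1
      exact map_one f
    rw [h3, PowerSeries.map_C, RingHom.map_rat_algebraMap, map_natCast]
    rfl
  rw [symbolSeries, map_mul, map_prod, map_prod]
  simp only [h1, map_pow, h2, map_rescale, PowerSeries.map_exp]
  rfl

theorem symbolSeries_zero {R : Type} [CommRing R] [Algebra ℚ R] (K : Fin N → ℕ) :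
    symbolSeries 0 K (0 : Fin N → R) = 1 := by
  simp [symbolSeries, PowerSeries.rescale_zero]

theorem symbolSeries_add_single_left {R : Type} [CommRing R] [Algebra ℚ R] (p K : Fin N → ℕ)
    (c : Fin N → R) (i : Fin N) :
    symbolSeries (p + Pi.single i 1) K c = geomSeries R i (K i) * symbolSeries p K c := by
  have : ∏ j, geomSeries R j (K j) ^ (p + Pi.single i 1 : Fin N → ℕ) j =
      geomSeries R i (K i) * ∏ j, geomSeries R j (K j) ^ p j := by
    simp only [Pi.add_apply, pow_add, Finset.prod_mul_distrib]
    rw [mul_comm]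
    congr 1
    rw [Finset.prod_eq_single i]
    · simp
    · intro j _ hj
      simp [hj]
    · simp
  rw [symbolSeries, this, symbolSeries]
  ring

theorem symbolSeries_add_single_right {R : Type} [CommRing R] [Algebra ℚ R] (p K : Fin N → ℕ)
    (c : Fin N → R) (s : R) (i : Fin N) : symbolSeries p K (c + Pi.single i s) =
      varSeries i (PowerSeries.rescale s (PowerSeries.exp R)) * symbolSeries p K c := by
  have : ∏ j, varSeries j (PowerSeries.rescale ((c + Pi.single i s : Fin N → R) j)
      (PowerSeries.exp R)) = varSeries i (PowerSeries.rescale s (PowerSeries.exp R)) *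
        ∏ j, varSeries j (PowerSeries.rescale (c j) (PowerSeries.exp R)) := by
    simp only [Pi.add_apply, ← PowerSeries.exp_mul_exp_eq_exp_add, map_mul,
      Finset.prod_mul_distrib]
    rw [mul_comm]
    congr 1
    rw [Finset.prod_eq_single i]
    · simp
    · intro j _ hj
      simp [hj, PowerSeries.rescale_zero]
    · simp
  rw [symbolSeries, this, symbolSeries]
  ring

/-! ### Evaluation of convergent Laurent series -/

/-- The Laurent series `φ` converges absolutely at `t`, with sum `v`. -/
def HasEval (φ : MvLaurentSeries N ℂ) (t : Fin N → ℂ) (v : ℂ) : Prop :=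
  HasSum (fun m => φ.coeff m * ∏ i, t i ^ m i) v

theorem hasEval_single (m : Fin N → ℤ) (a : ℂ) (t : Fin N → ℂ) :
    HasEval (HahnSeries.single m a) t (a * ∏ i, t i ^ m i) := by
  have h := hasSum_single (f := fun m' => (HahnSeries.single m a).coeff m' * ∏ i, t i ^ m' i) m
    (fun m' hm' => by rw [HahnSeries.coeff_single_of_ne hm', zero_mul])
  rwa [HahnSeries.coeff_single_same] at h

theorem hasEval_one (t : Fin N → ℂ) : HasEval 1 t 1 := by
  have h := hasEval_single 0 1 t
  simpa using h

theorem hasSum_mul_prod {ι : Type*} {f g : ι → ℂ} {a b : ℂ} (hf : HasSum f a) (hg : HasSum g b) :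
    HasSum (fun x : ι × ι => f x.1 * g x.2) (a * b) :=
  hf.mul hg (summable_mul_of_summable_norm (f := f) (g := g) hf.summable.norm hg.summable.norm)

theorem HasEval.mul {φ ψ : MvLaurentSeries N ℂ} {t : Fin N → ℂ} (ht : ∀ i, t i ≠ 0) {v w : ℂ}
    (hφ : HasEval φ t v) (hψ : HasEval ψ t w) : HasEval (φ * ψ) t (v * w) := by
  classical
  have h1 := hasSum_mul_prod hφ hψ
  -- The pairs of exponents are regrouped by their sum: `(d, m)` stands for the pair `(m, d - m)`.
  -- For fixed `d` only finitely many `m` contribute, by the finiteness of antidiagonals of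
  -- partially well-ordered sets.
  let e : (Fin N → ℤ) × (Fin N → ℤ) ≃ (Fin N → ℤ) × (Fin N → ℤ) :=
    { toFun := fun x => (x.2, x.1 - x.2)
      invFun := fun x => (x.1 + x.2, x.1)
      left_inv := fun x => by simp
      right_inv := fun x => by simp }
  have h2 := (e.hasSum_iff).2 h1
  refine h2.prod_fiberwise fun d => ?_
  have hterm : ∀ m : Fin N → ℤ,
      φ.coeff m * (∏ i, t i ^ m i) * (ψ.coeff (d - m) * ∏ i, t i ^ (d - m) i) =
        φ.coeff m * ψ.coeff (d - m) * ∏ i, t i ^ d i := by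
    intro m
    have : ∏ i, t i ^ d i = (∏ i, t i ^ m i) * ∏ i, t i ^ (d - m) i := by
      rw [← Finset.prod_mul_distrib]
      refine Finset.prod_congr rfl fun i _ => ?_
      rw [← zpow_add₀ (ht i)]
      simp
    rw [this]
    ring
  have hsum : (φ * ψ).coeff d = ∑ m ∈ (Finset.antidiagonal φ.isPWO_support ψ.isPWO_support d).image
      Prod.fst, φ.coeff m * ψ.coeff (d - m) := by
    rw [HahnSeries.coeff_mul, Finset.sum_image]
    · refine Finset.sum_congr rfl fun x hx => ?_
      have := (Finset.mem_antidiagonal.1 hx).2.2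
      rw [← this, add_sub_cancel_left]
    · intro x hx y hy hxy
      have h3 := (Finset.mem_antidiagonal.1 hx).2.2
      have h4 := (Finset.mem_antidiagonal.1 hy).2.2
      refine Prod.ext hxy ?_
      rw [← h4, hxy] at h3
      exact add_left_cancel h3
  rw [hsum, Finset.sum_mul]
  have h5 : ∀ m ∉ (Finset.antidiagonal φ.isPWO_support ψ.isPWO_support d).image Prod.fst,
      φ.coeff m * ψ.coeff (d - m) * ∏ i, t i ^ d i = 0 := by
    intro m hm
    by_contra hne
    refine hm (Finset.mem_image.2 ⟨(m, d - m), Finset.mem_antidiagonal.2 ⟨?_, ?_, by simp⟩, rfl⟩)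
    · intro h0; simp [h0] at hne
    · intro h0; simp [h0] at hne
  have h6 := hasSum_sum_of_ne_finset_zero (L := SummationFilter.unconditional _) h5
  refine h6.congr_fun ?_
  intro m
  exact (hterm m)

theorem HasEval.pow {φ : MvLaurentSeries N ℂ} {t : Fin N → ℂ} (ht : ∀ i, t i ≠ 0) {v : ℂ}
    (hφ : HasEval φ t v) (n : ℕ) : HasEval (φ ^ n) t (v ^ n) := by
  induction n with
  | zero => simpa using hasEval_one t
  | succ n ih => rw [pow_succ, pow_succ]; exact ih.mul ht hφ

theorem HasEval.prod {ι : Type*} {φ : ι → MvLaurentSeries N ℂ} {t : Fin N → ℂ}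
    (ht : ∀ i, t i ≠ 0) {v : ι → ℂ} (hφ : ∀ j, HasEval (φ j) t (v j)) (s : Finset ι) :
    HasEval (∏ j ∈ s, φ j) t (∏ j ∈ s, v j) := by
  classical
  induction s using Finset.induction_on with
  | empty => simpa using hasEval_one t
  | insert j s hj ih => rw [Finset.prod_insert hj, Finset.prod_insert hj]; exact (hφ j).mul ht ih

theorem hasEval_varSeries (i : Fin N) {c : PowerSeries ℂ} {t : Fin N → ℂ} {v : ℂ}
    (h : HasSum (fun n => PowerSeries.coeff n c * t i ^ n) v) : HasEval (varSeries i c) t v := by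
  have hinj : Function.Injective fun n : ℕ => (Pi.single i (n : ℤ) : Fin N → ℤ) :=
    (Pi.single_injective i).comp Nat.cast_injective
  refine (hinj.hasSum_iff ?_).1 (h.congr_fun ?_)
  · intro m hm
    rw [varSeries_coeff_of_forall_ne, zero_mul]
    intro n hn
    exact hm ⟨n, hn⟩
  · intro n
    simp only [Function.comp_apply, varSeries_coeff_single]
    rw [Finset.prod_eq_single i]
    · simp
    · intro j _ hj
      simp [hj]
    · simp

theorem hasSum_rescale_exp (a x : ℂ) : HasSum
    (fun n => PowerSeries.coeff n (PowerSeries.rescale a (PowerSeries.exp ℂ)) * x ^ n)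
    (Complex.exp (a * x)) := by
  rw [Complex.exp_eq_exp_ℂ]
  refine (NormedSpace.expSeries_div_hasSum_exp (a * x)).congr_fun ?_
  intro n
  rw [PowerSeries.coeff_rescale, PowerSeries.coeff_exp, mul_pow]
  simp
  ring

/-! ### Convergence of the expansion of `1 / (1 - e^{kt})` -/

theorem bernoulliPowerSeries_recursion (n : ℕ) (hn : 0 < n) :
    PowerSeries.coeff n (bernoulliPowerSeries ℂ) = -∑ k ∈ Finset.range n,
      PowerSeries.coeff k (bernoulliPowerSeries ℂ) * (((n + 1 - k).factorial : ℕ) : ℂ)⁻¹ := by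
  have h := congrArg (PowerSeries.coeff (n + 1)) (bernoulliPowerSeries_mul_exp_sub_one ℂ)
  rw [PowerSeries.coeff_mul, Finset.Nat.sum_antidiagonal_eq_sum_range_succ_mk,
    Finset.sum_range_succ, Finset.sum_range_succ, PowerSeries.coeff_X, if_neg (by omega)] at h
  simp only [map_sub, PowerSeries.coeff_exp, PowerSeries.coeff_one] at h
  have h1 : ∀ k ∈ Finset.range n, PowerSeries.coeff k (bernoulliPowerSeries ℂ) *
      (algebraMap ℚ ℂ (1 / ((n + 1 - k).factorial : ℕ)) - if n + 1 - k = 0 then 1 else 0) =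
      PowerSeries.coeff k (bernoulliPowerSeries ℂ) * (((n + 1 - k).factorial : ℕ) : ℂ)⁻¹ := by
    intro k hk
    have := Finset.mem_range.1 hk
    rw [if_neg (by omega)]
    simp
  rw [Finset.sum_congr rfl h1] at h
  simp at h
  linear_combination h

/-- By the recursion and `2^j ≤ (j+1)!`, the coefficient is bounded by a partial sum of `∑ 2^{-j}`
over `j ≥ 1`, which stays below `1`. This gives convergence in the unit disc, which is enough near
the origin. -/
theorem norm_coeff_bernoulliPowerSeries_le (n : ℕ) :
    ‖PowerSeries.coeff n (bernoulliPowerSeries ℂ)‖ ≤ 1 := by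
  induction n using Nat.strong_induction_on with
  | _ n ih =>
    rcases Nat.eq_zero_or_pos n with rfl | hn
    · simp [bernoulliPowerSeries]
    · rw [bernoulliPowerSeries_recursion n hn, norm_neg]
      refine (norm_sum_le _ _).trans ?_
      have h1 : ∀ k ∈ Finset.range n, ‖PowerSeries.coeff k (bernoulliPowerSeries ℂ) *
          (((n + 1 - k).factorial : ℕ) : ℂ)⁻¹‖ ≤ (1 / 2 : ℝ) ^ (n - k) := by
        intro k hk
        have hk' := Finset.mem_range.1 hk
        rw [norm_mul, norm_inv, Complex.norm_natCast]
        have h2 : 2 ^ (n - k) ≤ (n + 1 - k).factorial := by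
          have h3 : ∀ j : ℕ, 2 ^ j ≤ (j + 1).factorial := by
            intro j
            induction j with
            | zero => simp
            | succ j ihj =>
              rw [pow_succ, Nat.factorial_succ, mul_comm]
              exact Nat.mul_le_mul (by omega) ihj
          have h4 := h3 (n - k)
          rwa [show n - k + 1 = n + 1 - k by omega] at h4
        have h5 : (2 : ℝ) ^ (n - k) ≤ ((n + 1 - k).factorial : ℝ) := by exact_mod_cast h2
        calc _ ≤ 1 * ((2 : ℝ) ^ (n - k))⁻¹ :=
              mul_le_mul (ih k hk') (inv_anti₀ (by positivity) h5) (by positivity) zero_le_one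
          _ = _ := by rw [one_mul, one_div, inv_pow]
      refine (Finset.sum_le_sum h1).trans ?_
      have h6 : ∀ n : ℕ, ∑ k ∈ Finset.range n, (1 / 2 : ℝ) ^ (n - k) = 1 - (1 / 2) ^ n := by
        intro n
        induction n with
        | zero => simp
        | succ n ihn =>
          rw [Finset.sum_range_succ]
          have : ∀ k ∈ Finset.range n, (1 / 2 : ℝ) ^ (n + 1 - k) = (1 / 2) ^ (n - k) * (1 / 2) := by
            intro k hk
            have := Finset.mem_range.1 hk
            rw [← pow_succ]
            congr 1
            omega
          rw [Finset.sum_congr rfl this, ← Finset.sum_mul, ihn, Nat.add_sub_cancel_left]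
          ring
      rw [h6]
      linarith [pow_pos (show (0 : ℝ) < 1 / 2 by norm_num) n]

theorem geomSeries_mul (i : Fin N) {k : ℕ} (hk : 0 < k) :
    geomSeries ℂ i k * (varSeries i (PowerSeries.rescale (k : ℂ) (PowerSeries.exp ℂ)) - 1) = -1 := by
  have h1 : varSeries i (PowerSeries.rescale (k : ℂ) (PowerSeries.exp ℂ)) - 1 =
      varSeries (N := N) i (PowerSeries.rescale (k : ℂ) (PowerSeries.exp ℂ - 1)) := by
    rw [map_sub, map_sub, map_one, map_one]
  have hk0 : (k : ℂ) ≠ 0 := Nat.cast_ne_zero.2 hk.ne'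
  rw [h1, geomSeries, mul_assoc, ← map_mul, mul_assoc, ← map_mul,
    bernoulliPowerSeries_mul_exp_sub_one, PowerSeries.rescale_X, ← mul_assoc, ← map_mul,
    map_mul, varSeries_C, varSeries_X, HahnSeries.single_mul_single, HahnSeries.single_mul_single]
  have h2 : (algebraMap ℚ ℂ (-(k : ℚ)⁻¹)) * (k : ℂ) = -1 := by
    rw [map_neg, map_inv₀, map_natCast]
    field_simp
  rw [h2, zero_add, neg_add_cancel, one_mul, mul_one, HahnSeries.single_neg]
  rfl

/-- Only convergence is proved directly. The value is then forced by evaluating the formal identity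
`geomSeries_mul`, in which the exponential series has a known sum. -/
theorem hasEval_geomSeries (i : Fin N) {k : ℕ} (hk : 0 < k) {t : Fin N → ℂ} (ht : ∀ i, t i ≠ 0)
    (htk : ‖(k : ℂ) * t i‖ < 1) :
    HasEval (geomSeries ℂ i k) t (1 - Complex.exp (k * t i))⁻¹ := by
  have hs : Summable fun n => PowerSeries.coeff n (PowerSeries.C (algebraMap ℚ ℂ (-(k : ℚ)⁻¹)) *
      PowerSeries.rescale (k : ℂ) (bernoulliPowerSeries ℂ)) * t i ^ n := by
    refine Summable.of_norm_bounded ((summable_geometric_of_lt_one (norm_nonneg _) htk).mul_left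
      ‖algebraMap ℚ ℂ (-(k : ℚ)⁻¹)‖) fun n => ?_
    rw [PowerSeries.coeff_C_mul, PowerSeries.coeff_rescale]
    have : algebraMap ℚ ℂ (-(k : ℚ)⁻¹) * ((k : ℂ) ^ n *
        PowerSeries.coeff n (bernoulliPowerSeries ℂ)) * t i ^ n = algebraMap ℚ ℂ (-(k : ℚ)⁻¹) *
        ((k * t i) ^ n * PowerSeries.coeff n (bernoulliPowerSeries ℂ)) := by
      rw [mul_pow]; ring
    rw [this, norm_mul, norm_mul, norm_pow]
    refine mul_le_mul_of_nonneg_left ?_ (norm_nonneg _)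
    exact mul_le_of_le_one_right (by positivity) (norm_coeff_bernoulliPowerSeries_le n)
  obtain ⟨v, hev⟩ : ∃ v, HasEval (geomSeries ℂ i k) t v :=
    ⟨_, (hasEval_single (-Pi.single i 1) 1 t).mul ht (hasEval_varSeries i hs.hasSum)⟩
  have hexp : HasEval (varSeries i (PowerSeries.rescale (k : ℂ) (PowerSeries.exp ℂ)) - 1) t
      (Complex.exp (k * t i) - 1) := by
    have := (hasEval_varSeries i (hasSum_rescale_exp k (t i))).sub (hasEval_one t)
    refine this.congr_fun fun m => ?_
    rw [HahnSeries.coeff_sub]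
    ring
  have hprod := hev.mul ht hexp
  rw [geomSeries_mul i hk] at hprod
  have hneg : HasEval (-1 : MvLaurentSeries N ℂ) t (-1) := by
    refine (hasEval_one t).neg.congr_fun fun m => ?_
    rw [HahnSeries.coeff_neg, neg_mul]
  have heq := hprod.unique hneg
  have hval : v * (1 - Complex.exp (k * t i)) = 1 := by
    linear_combination -heq
  rw [← eq_inv_of_mul_eq_one_left hval]
  exact hev

theorem hasEval_symbolSeries (p K : Fin N → ℕ) (hK : ∀ i, 0 < K i) (c : Fin N → ℂ)
    {t : Fin N → ℂ} (ht : ∀ i, t i ≠ 0) (htK : ∀ i, ‖(K i : ℂ) * t i‖ < 1) :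
    HasEval (symbolSeries p K c) t
      ((∏ i, Complex.exp (c i * t i)) * ∏ i, (1 - Complex.exp (K i * t i))⁻¹ ^ p i) :=
  (HasEval.prod ht (fun i => hasEval_varSeries i (hasSum_rescale_exp (c i) (t i))) _).mul ht
    (HasEval.prod ht (fun i => (hasEval_geomSeries i (hK i) ht (htK i)).pow ht (p i)) _)

/-! ### Uniqueness of the coefficients -/

/-- After division by the lowest power of `s`, the limit `s → 0+` isolates the lowest coefficient.
Dominated convergence applies because absolute convergence at `s = 1` supplies the majorant `‖A d‖`.
-/
theorem eq_zero_of_hasSum_zpow {A : ℤ → ℂ} (hA : {d | A d ≠ 0}.IsWF)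
    (h : ∀ s : ℝ, 0 < s → s ≤ 1 → HasSum (fun d => A d * (s : ℂ) ^ d) 0) : A = 0 := by
  by_contra hne
  obtain ⟨d, hd⟩ := Function.ne_iff.1 hne
  have hn : {d | A d ≠ 0}.Nonempty := ⟨d, hd⟩
  set d₀ := hA.min hn with hd₀
  have hmin : ∀ d, d < d₀ → A d = 0 := fun d hdlt => by
    by_contra hAd
    exact hA.not_lt_min hn hAd hdlt
  have hmem : A d₀ ≠ 0 := hA.min_mem hn
  have hs1 : Summable fun d => ‖A d‖ := by
    have := (h 1 one_pos le_rfl).summable.norm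
    simpa using this
  have hsc : ∀ s : ℝ, 0 < s → s ≤ 1 → HasSum (fun d => A d * (s : ℂ) ^ (d - d₀)) 0 := by
    intro s hs hs1
    have h0 : (s : ℂ) ≠ 0 := Complex.ofReal_ne_zero.2 hs.ne'
    have := (h s hs hs1).mul_right ((s : ℂ) ^ (-d₀))
    rw [zero_mul] at this
    refine this.congr_fun fun d => ?_
    rw [mul_assoc, ← zpow_add₀ h0, sub_eq_add_neg]
  have hlim : Tendsto (fun s : ℝ => ∑' d, A d * (s : ℂ) ^ (d - d₀)) (𝓝[>] 0)
      (𝓝 (∑' d, if d = d₀ then A d₀ else 0)) := by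
    refine tendsto_tsum_of_dominated_convergence hs1 (fun d => ?_) ?_
    · rcases lt_trichotomy d d₀ with hlt | rfl | hgt
      · simp [hmin d hlt, hlt.ne]
      · simp
      · rw [if_neg hgt.ne']
        obtain ⟨k, hk⟩ := Int.eq_ofNat_of_zero_le (sub_nonneg.2 hgt.le)
        have hk0 : k ≠ 0 := by rintro rfl; simp at hk; omega
        rw [hk]
        have h1 : Tendsto (fun s : ℝ => A d * (s : ℂ) ^ k) (𝓝 0) (𝓝 (A d * ((0 : ℝ) : ℂ) ^ k)) :=
          (Continuous.tendsto (by fun_prop) 0)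
        simp only [Complex.ofReal_zero, zero_pow hk0, mul_zero] at h1
        simpa using h1.mono_left nhdsWithin_le_nhds
    · filter_upwards [Ioc_mem_nhdsGT one_pos] with s hs d
      by_cases hd : d < d₀
      · simp [hmin d hd]
      · rw [norm_mul, norm_zpow, Complex.norm_real, Real.norm_eq_abs, abs_of_pos hs.1]
        obtain ⟨k, hk⟩ := Int.eq_ofNat_of_zero_le (sub_nonneg.2 (not_lt.1 hd))
        rw [hk, zpow_natCast]
        exact mul_le_of_le_one_right (norm_nonneg _) (pow_le_one₀ hs.1.le hs.2)
  rw [tsum_ite_eq] at hlim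
  have hlim0 : Tendsto (fun s : ℝ => ∑' d, A d * (s : ℂ) ^ (d - d₀)) (𝓝[>] 0) (𝓝 0) := by
    refine tendsto_const_nhds.congr' ?_
    filter_upwards [Ioc_mem_nhdsGT one_pos] with s hs
    exact (hsc s hs.1 hs.2).tsum_eq.symm
  exact hmem (tendsto_nhds_unique hlim hlim0)

/-- A finite Laurent polynomial that vanishes on a box is zero. -/
theorem coeff_eq_zero_of_sum_eq_zero (s : Finset (Fin N → ℤ)) (a : (Fin N → ℤ) → ℂ) {r : ℝ}
    (hr : 0 < r) (h : ∀ x : Fin N → ℂ, (∀ i, ∃ y ∈ Set.Ioo (-r) 0, x i = ((y : ℝ) : ℂ)) →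
      ∑ m ∈ s, a m * ∏ i, x i ^ m i = 0) : ∀ m ∈ s, a m = 0 := by
  classical
  -- Multiplication by `∏ x_i^L` clears all denominators, so the claim becomes the vanishing of a
  -- polynomial on a product of infinite sets.
  obtain ⟨L, hL⟩ : ∃ L : ℕ, ∀ m ∈ s, ∀ i, 0 ≤ m i + L := by
    refine ⟨∑ m ∈ s, ∑ i, (m i).natAbs, fun m hm i => ?_⟩
    have h1 : (m i).natAbs ≤ ∑ m ∈ s, ∑ i, (m i).natAbs :=
      (Finset.single_le_sum (f := fun i => (m i).natAbs) (fun _ _ => Nat.zero_le _)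
        (Finset.mem_univ i)).trans
        (Finset.single_le_sum (f := fun m => ∑ i, (m i).natAbs) (fun _ _ => Nat.zero_le _) hm)
    omega
  set e : (Fin N → ℤ) → (Fin N →₀ ℕ) := fun m =>
    Finsupp.equivFunOnFinite.symm fun i => (m i + L).toNat with he
  have hinj : Set.InjOn e s := by
    intro m hm m' hm' hmm
    funext i
    have h1 : (m i + L).toNat = (m' i + L).toNat := by
      have := DFunLike.congr_fun hmm i
      simpa [he] using this
    have h2 := hL m hm i
    have h3 := hL m' hm' i
    omega
  have hP : (∑ m ∈ s, MvPolynomial.monomial (e m) (a m) : MvPolynomial (Fin N) ℂ) = 0 := by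
    refine MvPolynomial.funext_set (fun _ => (fun y : ℝ => (y : ℂ)) '' Set.Ioo (-r) 0)
      (fun i => ?_) fun x hx => ?_
    · exact (Set.Ioo_infinite (by linarith)).image Complex.ofReal_injective.injOn
    · rw [map_zero, map_sum]
      have hx' : ∀ i, ∃ y ∈ Set.Ioo (-r) 0, x i = ((y : ℝ) : ℂ) := by
        intro i
        obtain ⟨y, hy, hyx⟩ := hx i (Set.mem_univ i)
        exact ⟨y, hy, hyx.symm⟩
      have hx0 : ∀ i, x i ≠ 0 := by
        intro i
        obtain ⟨y, hy, hyx⟩ := hx' i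
        rw [hyx]
        exact Complex.ofReal_ne_zero.2 hy.2.ne
      have h4 := congrArg (fun z => z * ∏ i, x i ^ L) (h x hx')
      simp only [zero_mul, Finset.sum_mul] at h4
      rw [← h4]
      refine Finset.sum_congr rfl fun m hm => ?_
      rw [MvPolynomial.eval_monomial, mul_assoc, ← Finset.prod_mul_distrib, Finsupp.prod_fintype _ _
        (fun i => pow_zero _)]
      congr 1
      refine Finset.prod_congr rfl fun i _ => ?_
      rw [← zpow_natCast, ← zpow_natCast, ← zpow_add₀ (hx0 i)]
      congr 1
      have := hL m hm i
      simp [he, this]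
  intro m hm
  have h5 := congrArg (MvPolynomial.coeff (e m)) hP
  rw [MvPolynomial.coeff_sum, MvPolynomial.coeff_zero, Finset.sum_eq_single m] at h5
  · simpa using h5
  · intro m' hm' hne
    rw [MvPolynomial.coeff_monomial, if_neg fun h6 => hne (hinj hm' hm h6)]
  · exact fun h6 => absurd hm h6

/-- Along a ray `s x` with negative real `x_i`, grouping by total degree gives a one-variable
Laurent series in `s` that sums to zero. Its coefficients, the finite homogeneous parts of `φ`,
therefore vanish on a whole box. -/
theorem eq_zero_of_hasEval_zero {φ : MvLaurentSeries N ℂ} {r : ℝ} (hr : 0 < r)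
    (h : ∀ t : Fin N → ℂ, (∀ i, (t i).re < 0 ∧ ‖t i‖ < r) → HasEval φ t 0) : φ = 0 := by
  classical
  have hfin := finite_support_totalDegree φ
  have key : ∀ x : Fin N → ℂ, (∀ i, ∃ y ∈ Set.Ioo (-r) 0, x i = ((y : ℝ) : ℂ)) → ∀ d,
      ∑ m ∈ (hfin d).toFinset, φ.coeff m * ∏ i, x i ^ m i = 0 := by
    intro x hx
    choose y hy hxy using hx
    set A : ℤ → ℂ := fun d => ∑ m ∈ (hfin d).toFinset, φ.coeff m * ∏ i, x i ^ m i with hA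
    suffices A = 0 from fun d => congrFun this d
    refine eq_zero_of_hasSum_zpow ?_ fun s hs hs1 => ?_
    · have hmono : Monotone fun m : Fin N → ℤ => ∑ i, m i :=
        fun _ _ h => Finset.sum_le_sum fun i _ => h i
      refine ((φ.isPWO_support.image_of_monotone hmono).mono ?_).isWF
      intro d hd
      obtain ⟨m, hm, -⟩ := Finset.exists_ne_zero_of_sum_ne_zero hd
      have := (hfin d).mem_toFinset.1 hm
      exact ⟨m, this.1, this.2⟩
    · have h0 : (s : ℂ) ≠ 0 := Complex.ofReal_ne_zero.2 hs.ne'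
      have hev := h (fun i => s * x i) (fun i => by
        rw [hxy i, ← Complex.ofReal_mul, Complex.ofReal_re, Complex.norm_real, Real.norm_eq_abs]
        refine ⟨mul_neg_of_pos_of_neg hs (hy i).2, abs_lt.2 ⟨?_, ?_⟩⟩
        · nlinarith [(hy i).1, (hy i).2]
        · nlinarith [(hy i).1, (hy i).2])
      have hfw := HasSum.tsum_fiberwise hev (fun m : Fin N → ℤ => ∑ i, m i)
      refine hfw.congr_fun fun d => ?_
      have hterm : ∀ m : Fin N → ℤ, ∑ i, m i = d → φ.coeff m * ∏ i, ((s : ℂ) * x i) ^ m i =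
          φ.coeff m * (∏ i, x i ^ m i) * (s : ℂ) ^ d := by
        intro m hm
        simp only [mul_zpow, Finset.prod_mul_distrib]
        have : ∏ i, (s : ℂ) ^ m i = (s : ℂ) ^ d := by
          rw [← hm]
          generalize (Finset.univ : Finset (Fin N)) = S
          induction S using Finset.induction_on with
          | empty => simp
          | insert j S hj ih => rw [Finset.prod_insert hj, Finset.sum_insert hj, ih, zpow_add₀ h0]
        rw [this]
        ring
      rw [tsum_subtype ((fun m : Fin N → ℤ => ∑ i, m i) ⁻¹' {d})
        (fun m => φ.coeff m * ∏ i, ((s : ℂ) * x i) ^ m i),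
        tsum_eq_sum (s := (hfin d).toFinset)]
      · rw [hA, Finset.sum_mul]
        refine Finset.sum_congr rfl fun m hm => ?_
        have hm' := (hfin d).mem_toFinset.1 hm
        rw [Set.indicator_of_mem (by exact hm'.2), hterm m hm'.2]
      · intro m hm
        by_cases hmd : ∑ i, m i = d
        · rw [Set.indicator_of_mem (by exact hmd)]
          have : φ.coeff m = 0 := by
            by_contra hne
            exact hm ((hfin d).mem_toFinset.2 ⟨hne, hmd⟩)
          rw [this, zero_mul]
        · rw [Set.indicator_of_notMem (by exact hmd)]
  ext m
  by_contra hne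
  refine hne ?_
  exact coeff_eq_zero_of_sum_eq_zero (hfin (∑ i, m i)).toFinset φ.coeff hr
    (fun x hx => key x hx _) m ((hfin _).mem_toFinset.2 ⟨hne, rfl⟩)

theorem IsGeneratingSeries.unique {lam : Fin N → ℤ} {F : (Fin N → ℤ) → ℂ}
    {φ ψ : MvLaurentSeries N (MvPolynomial (Fin N) ℂ)} (hφ : IsGeneratingSeries lam F φ)
    (hψ : IsGeneratingSeries lam F ψ) : ψ = φ := by
  ext m : 2
  refine MvPolynomial.funext fun u => ?_
  obtain ⟨r, hr, h1⟩ := (hφ u).2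
  obtain ⟨r', hr', h2⟩ := (hψ u).2
  have h0 : ψ.map (MvPolynomial.eval u) - φ.map (MvPolynomial.eval u) = (0 : MvLaurentSeries N ℂ) := by
    refine eq_zero_of_hasEval_zero (lt_min hr hr') fun t ht => ?_
    have h3 := h1 t fun i => ⟨(ht i).1, (ht i).2.trans_le (min_le_left _ _)⟩
    have h4 := h2 t fun i => ⟨(ht i).1, (ht i).2.trans_le (min_le_right _ _)⟩
    have h5 := h4.sub h3
    rw [sub_self] at h5
    refine h5.congr_fun fun m => ?_
    rw [HahnSeries.coeff_sub, HahnSeries.map_coeff, HahnSeries.map_coeff]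
    ring
  have h6 := congrArg (fun χ => HahnSeries.coeff χ m) (sub_eq_zero.1 h0)
  simpa using h6

/-! ### Calculus of asymptotic expansions -/

/-- `φ(t) ∼ ∑ a_d t^d` as `t → +0`, where the `n`-th approximation may contain further terms
of order at least `n`. -/
def Asym (φ : ℝ → ℂ) (a : ℤ → ℂ) : Prop :=
  ∀ n : ℤ, ∃ b : ℤ →₀ ℂ, (∀ d < n, b d = a d) ∧
    (fun t : ℝ => φ t - Finsupp.linearCombination ℂ (fun d : ℤ => (t : ℂ) ^ d) b) =O[𝓝[>] 0]
      fun t : ℝ => t ^ n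

theorem Asym.add {φ ψ : ℝ → ℂ} {a b : ℤ → ℂ} (hφ : Asym φ a) (hψ : Asym ψ b) :
    Asym (fun t => φ t + ψ t) (fun d => a d + b d) := by
  intro n
  obtain ⟨a', ha, h1⟩ := hφ n
  obtain ⟨b', hb, h2⟩ := hψ n
  refine ⟨a' + b', fun d hd => by rw [Finsupp.add_apply, ha d hd, hb d hd],
    (h1.add h2).congr_left fun t => ?_⟩
  rw [map_add]
  ring

theorem Asym.const_mul {φ : ℝ → ℂ} {a : ℤ → ℂ} (hφ : Asym φ a) (c : ℂ) :
    Asym (fun t => c * φ t) (fun d => c * a d) := by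
  intro n
  obtain ⟨a', ha, h1⟩ := hφ n
  refine ⟨c • a', fun d hd => by rw [Finsupp.smul_apply, ha d hd, smul_eq_mul],
    (h1.const_mul_left c).congr_left fun t => ?_⟩
  rw [map_smul, smul_eq_mul]
  ring

theorem asym_zero : Asym (fun _ => 0) (fun _ => 0) := fun n =>
  ⟨0, fun _ _ => rfl, by simpa using Asymptotics.isBigO_zero _ _⟩

theorem Asym.sum {ι : Type*} {φ : ι → ℝ → ℂ} {a : ι → ℤ → ℂ} (s : Finset ι)
    (h : ∀ j, Asym (φ j) (a j)) : Asym (fun t => ∑ j ∈ s, φ j t) (fun d => ∑ j ∈ s, a j d) := by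
  classical
  induction s using Finset.induction_on with
  | empty => simpa using asym_zero
  | insert j s hj ih => simpa only [Finset.sum_insert hj] using (h j).add ih

theorem Asym.zpow_mul {φ : ℝ → ℂ} {a : ℤ → ℂ} (hφ : Asym φ a) (j : ℤ) :
    Asym (fun t => (t : ℂ) ^ j * φ t) (fun d => a (d - j)) := by
  intro n
  obtain ⟨b, hb, h1⟩ := hφ (n - j)
  refine ⟨b.equivMapDomain (Equiv.addRight j), fun d hd => ?_, ?_⟩
  · rw [Finsupp.equivMapDomain_apply, Equiv.addRight_symm]
    exact hb (d - j) (by omega)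
  · have h2 : (fun t : ℝ => (t : ℂ) ^ j) =O[𝓝[>] 0] fun t : ℝ => t ^ j :=
      Asymptotics.IsBigO.of_norm_eventuallyLE (by
        filter_upwards [self_mem_nhdsWithin] with t ht
        rw [norm_zpow, Complex.norm_real, Real.norm_eq_abs, abs_of_pos ht])
    refine (h2.mul h1).congr' ?_ ?_
    · filter_upwards [self_mem_nhdsWithin] with t ht
      have ht0 : (t : ℂ) ≠ 0 := Complex.ofReal_ne_zero.2 (ne_of_gt ht)
      rw [mul_sub, Finsupp.linearCombination_equivMapDomain, Finsupp.linearCombination_apply,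
        Finsupp.linearCombination_apply, Finsupp.mul_sum]
      congr 1
      refine Finsupp.sum_congr fun d _ => ?_
      simp only [Function.comp_apply, Equiv.coe_addRight, smul_eq_mul]
      rw [zpow_add₀ ht0]
      ring
    · filter_upwards [self_mem_nhdsWithin] with t ht
      rw [← zpow_add₀ (ne_of_gt ht)]
      congr 1
      ring

theorem Asym.of_approx {φ : ℝ → ℂ} {a : ℤ → ℂ} (h : ∀ n : ℤ, ∃ (ψ : ℝ → ℂ) (b : ℤ → ℂ),
    Asym ψ b ∧ (∀ d < n, b d = a d) ∧ (fun t => φ t - ψ t) =O[𝓝[>] 0] fun t : ℝ => t ^ n) :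
    Asym φ a := by
  intro n
  obtain ⟨ψ, b, hψ, hb, h1⟩ := h n
  obtain ⟨b', hb', h2⟩ := hψ n
  refine ⟨b', fun d hd => (hb' d hd).trans (hb d hd), (h1.add h2).congr_left fun t => ?_⟩
  ring

theorem isBigO_zpow_of_le {m n : ℤ} (h : n ≤ m) :
    (fun t : ℝ => t ^ m) =O[𝓝[>] 0] fun t : ℝ => t ^ n := by
  refine Asymptotics.IsBigO.of_bound 1 ?_
  filter_upwards [Ioc_mem_nhdsGT one_pos] with t ht
  rw [one_mul, norm_zpow, norm_zpow, Real.norm_eq_abs, abs_of_pos ht.1]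
  exact zpow_le_zpow_right_of_le_one₀ ht.1 ht.2 h

/-- The terms of order at least `n` allowed by `Asym` are themselves `O(t^n)`, so they may be
discarded; below `n` the coefficients are prescribed. -/
theorem Asym.isBigO_sub_sum {φ : ℝ → ℂ} {a : ℤ → ℂ} (hφ : Asym φ a) (n : ℤ) (s : Finset ℤ)
    (hs : ∀ d ∈ s, d < n) (ha : ∀ d < n, a d ≠ 0 → d ∈ s) :
    (fun t : ℝ => φ t - ∑ d ∈ s, a d * (t : ℂ) ^ d) =O[𝓝[>] 0] fun t : ℝ => t ^ n := by
  obtain ⟨b, hb, h⟩ := hφ n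
  have h1 : (fun t : ℝ => ∑ d ∈ b.support.filter (fun d => ¬ d < n), b d * (t : ℂ) ^ d)
      =O[𝓝[>] 0] fun t : ℝ => t ^ n := by
    refine Asymptotics.IsBigO.fun_sum fun d hd => ?_
    refine Asymptotics.IsBigO.const_mul_left ?_ _
    refine Asymptotics.IsBigO.trans ?_ (isBigO_zpow_of_le (not_lt.1 (Finset.mem_filter.1 hd).2))
    exact Asymptotics.IsBigO.of_norm_left (Asymptotics.IsBigO.of_bound 1 (by
      filter_upwards with t
      rw [norm_norm, one_mul, norm_zpow, Complex.norm_real, norm_zpow]))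
  refine (h.add h1).congr_left fun t => ?_
  have h2 : ∑ d ∈ s, a d * (t : ℂ) ^ d =
      ∑ d ∈ b.support.filter (fun d => d < n), b d * (t : ℂ) ^ d := by
    symm
    calc ∑ d ∈ b.support.filter (fun d => d < n), b d * (t : ℂ) ^ d
        = ∑ d ∈ b.support.filter (fun d => d < n), a d * (t : ℂ) ^ d :=
          Finset.sum_congr rfl fun d hd => by rw [hb d (Finset.mem_filter.1 hd).2]
      _ = _ := by
        refine Finset.sum_subset (fun d hd => ?_) fun d hd hd' => ?_
        · obtain ⟨h3, h4⟩ := Finset.mem_filter.1 hd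
          refine ha d h4 ?_
          rw [← hb d h4]
          exact Finsupp.mem_support_iff.1 h3
        · have : b d = 0 := by
            by_contra hne
            exact hd' (Finset.mem_filter.2 ⟨Finsupp.mem_support_iff.2 hne, hs d hd⟩)
          rw [← hb d (hs d hd), this, zero_mul]
  rw [h2, Finsupp.linearCombination_apply, Finsupp.sum,
    ← Finset.sum_filter_add_sum_filter_not b.support (fun d => d < n)]
  simp only [smul_eq_mul]
  ring

theorem Asym.hasAsymptoticExpansion {φ : ℝ → ℂ} {a : LaurentSeries ℂ} (h : Asym φ a.coeff) :
    HasAsymptoticExpansion φ a := by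
  -- Adding `1` makes the bound a positive integer even when the order is `0`.
  have hL : ∀ m : ℤ, m < -((a.order.natAbs + 1 : ℕ) : ℤ) → a.coeff m = 0 := fun m hm =>
    HahnSeries.coeff_eq_zero_of_lt_order (by omega)
  refine ⟨a.order.natAbs + 1, Nat.succ_pos _, hL, fun M hM => ?_⟩
  -- For real `M`, the error `O(t^{⌊M⌋+1})` is also `O(t^M)`, as `t` is kept below `1`.
  obtain ⟨C, hC⟩ := (h.isBigO_sub_sum (⌊M⌋ + 1)
    (Finset.Icc (-((a.order.natAbs + 1 : ℕ) : ℤ)) ⌊M⌋)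
    (fun d hd => Int.lt_add_one_iff.2 (Finset.mem_Icc.1 hd).2)
    (fun d hd hne => Finset.mem_Icc.2 ⟨not_lt.1 fun hlt => hne (hL d hlt),
      Int.lt_add_one_iff.1 hd⟩)).bound
  obtain ⟨ε, hε, hsub⟩ := mem_nhdsGT_iff_exists_Ioo_subset.1 hC
  refine ⟨max C 1, lt_max_of_lt_right one_pos, min ε 1, lt_min hε one_pos, fun t ht hlt => ?_⟩
  have h1 := hsub ⟨ht, hlt.trans_le (min_le_left _ _)⟩
  have ht1 : t ≤ 1 := (hlt.trans_le (min_le_right _ _)).le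
  refine (Set.mem_ofPred_eq ▸ h1).trans ?_
  rw [norm_zpow, Real.norm_eq_abs, abs_of_pos ht]
  refine mul_le_mul (le_max_left _ _) ?_ (by positivity) (by positivity)
  rw [← Real.rpow_intCast]
  refine Real.rpow_le_rpow_of_exponent_ge ht ht1 ?_
  push_cast
  exact (Int.lt_floor_add_one M).le

/-! ### Coefficients of Hadamard products -/

theorem hadamard_coeff (φ : MvLaurentSeries N ℂ) (f : (Fin N → ℝ) → ℂ) (d : ℤ) :
    (hadamard φ f).coeff d =
      ∑ᶠ m ∈ {m : Fin N → ℤ | ∑ i, m i = d}, φ.coeff m * mixedDeriv m f 0 := rfl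

theorem finite_hadamard (φ : MvLaurentSeries N ℂ) (f : (Fin N → ℝ) → ℂ) (d : ℤ) :
    ({m : Fin N → ℤ | ∑ i, m i = d} ∩
      Function.support fun m => φ.coeff m * mixedDeriv m f 0).Finite := by
  refine (finite_support_totalDegree φ d).subset fun m hm => ⟨fun h0 => hm.2 ?_, hm.1⟩
  simp [h0]

/-- The coefficients of the Hadamard product are linear in the Laurent series. -/
def hadamardCoeff (f : (Fin N → ℝ) → ℂ) (d : ℤ) : MvLaurentSeries N ℂ →ₗ[ℂ] ℂ where
  toFun φ := (hadamard φ f).coeff d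
  map_add' φ ψ := by
    simp only [hadamard_coeff]
    rw [← finsum_mem_add_distrib' (finite_hadamard φ f d) (finite_hadamard ψ f d)]
    refine finsum_mem_congr rfl fun m _ => ?_
    rw [HahnSeries.coeff_add, add_mul]
  map_smul' c φ := by
    simp only [hadamard_coeff, RingHom.id_apply, smul_eq_mul]
    rw [mul_finsum_mem]
    refine finsum_mem_congr rfl fun m _ => ?_
    rw [HahnSeries.coeff_smul, smul_eq_mul, mul_assoc]

/-- Reindexing by `m ↦ m + j e_i` shows that multiplication of the series by `t_i^j` corresponds to
`(t∂_i)^j` acting on `f`, for negative `j` as well. This justifies reading `φ ⊙ f` as `φ(t∂) f (0)`.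
-/
theorem hadamardCoeff_single_mul (φ : MvLaurentSeries N ℂ) (f : rapidDecay N) (i : Fin N) (j d : ℤ) :
    hadamardCoeff f d (HahnSeries.single (Pi.single i j) 1 * φ) =
      hadamardCoeff ((derivEquiv i ^ j) f) (d - j) φ := by
  change (hadamard _ _).coeff _ = (hadamard _ _).coeff _
  rw [hadamard_coeff, hadamard_coeff]
  symm
  refine finsum_mem_eq_of_bijOn (fun m => m + Pi.single i j) ⟨?_, ?_, ?_⟩ ?_
  · intro m hm
    simp only [Set.mem_ofPred_eq, Pi.add_apply, Finset.sum_add_distrib] at hm ⊢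
    rw [hm, Finset.sum_pi_single']
    simp
  · exact (add_left_injective _).injOn
  · intro m hm
    refine ⟨m - Pi.single i j, ?_, sub_add_cancel _ _⟩
    simp only [Set.mem_ofPred_eq, Pi.sub_apply, Finset.sum_sub_distrib] at hm ⊢
    rw [hm, Finset.sum_pi_single']
    simp
  · intro m _
    rw [HahnSeries.coeff_single_mul_add, one_mul, mixedDeriv_add_single]

theorem hadamardCoeff_eq_zero {φ : MvLaurentSeries N ℂ} {L : ℤ}
    (hL : ∀ m, ∑ i, m i < L → φ.coeff m = 0) (f : (Fin N → ℝ) → ℂ) {d : ℤ} (hd : d < L) :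
    hadamardCoeff f d φ = 0 :=
  finsum_mem_eq_zero_of_forall_eq_zero fun m hm => by
    rw [hL m (by rw [hm]; exact hd), zero_mul]

theorem exists_totalDegree_bound (φ : MvLaurentSeries N ℂ) :
    ∃ L : ℤ, ∀ m, ∑ i, m i < L → φ.coeff m = 0 := by
  have hmono : Monotone fun m : Fin N → ℤ => ∑ i, m i :=
    fun _ _ h => Finset.sum_le_sum fun i _ => h i
  have hwf := (φ.isPWO_support.image_of_monotone hmono).isWF
  by_cases hn : ((fun m : Fin N → ℤ => ∑ i, m i) '' φ.support).Nonempty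
  · refine ⟨hwf.min hn, fun m hm => ?_⟩
    by_contra hne
    exact hwf.not_lt_min hn ⟨m, hne, rfl⟩ hm
  · refine ⟨0, fun m _ => ?_⟩
    by_contra hne
    exact hn ⟨_, m, hne, rfl⟩

theorem varSeries_mul_totalDegree {φ : MvLaurentSeries N ℂ} {L : ℤ}
    (hL : ∀ m, ∑ i, m i < L → φ.coeff m = 0) (i : Fin N) (c : PowerSeries ℂ) (m : Fin N → ℤ)
    (hm : ∑ i, m i < L) : (varSeries i c * φ).coeff m = 0 := by
  rw [HahnSeries.coeff_mul]
  refine Finset.sum_eq_zero fun x hx => ?_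
  obtain ⟨-, -, h3⟩ := Finset.mem_antidiagonal.1 hx
  by_cases h : ∃ n : ℕ, Pi.single i (n : ℤ) = x.1
  · obtain ⟨n, hn⟩ := h
    rw [hL x.2, mul_zero]
    rw [← h3, ← hn] at hm
    simp only [Pi.add_apply, Finset.sum_add_distrib] at hm
    rw [Finset.sum_pi_single'] at hm
    simp at hm
    omega
  · push Not at h
    rw [varSeries_coeff_of_forall_ne i c h, zero_mul]

/-! ### Symbols of functionals -/

/-- The functionals `T` have the symbol `Φ`: `T_t f ∼ Φ ⊙ f (t)` as `t → +0`. -/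
def HasSymbol (T : ℝ → rapidDecay N → ℂ) (Φ : MvLaurentSeries N ℂ) : Prop :=
  ∀ f : rapidDecay N, Asym (fun t => T t f) fun d => hadamardCoeff f d Φ

theorem HasSymbol.shift {T : ℝ → rapidDecay N → ℂ} {Φ : MvLaurentSeries N ℂ} (h : HasSymbol T Φ)
    (i : Fin N) (j : ℤ) : HasSymbol (fun t f => (t : ℂ) ^ j * T t ((derivEquiv i ^ j) f))
      (HahnSeries.single (Pi.single i j) 1 * Φ) := by
  intro f
  simp only [hadamardCoeff_single_mul]
  exact (h ((derivEquiv i ^ j) f)).zpow_mul j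

/-- Everything after the first `J` terms is divisible by `t_i^J`, hence invisible to Hadamard
coefficients of low total degree. -/
theorem varSeries_mul_eq (i : Fin N) (c : PowerSeries ℂ) (Φ : MvLaurentSeries N ℂ) (J : ℕ) :
    varSeries i c * Φ = ∑ j ∈ Finset.range J, PowerSeries.coeff j c •
        (HahnSeries.single (Pi.single i (j : ℤ)) 1 * Φ) +
      HahnSeries.single (Pi.single i (J : ℤ)) 1 *
        (varSeries i (PowerSeries.mk fun k => PowerSeries.coeff (k + J) c) * Φ) := by
  induction J with
  | zero =>
    have : PowerSeries.mk (fun k => PowerSeries.coeff (k + 0) c) = c := by ext k; simp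
    rw [this]
    simp
  | succ J ih =>
    rw [ih, Finset.sum_range_succ, add_assoc]
    congr 1
    have h1 : PowerSeries.mk (fun k => PowerSeries.coeff (k + J) c) =
        PowerSeries.C (PowerSeries.coeff J c) +
          PowerSeries.X * PowerSeries.mk fun k => PowerSeries.coeff (k + (J + 1)) c := by
      ext k
      cases k with
      | zero => simp
      | succ k =>
        rw [map_add, PowerSeries.coeff_succ_X_mul, PowerSeries.coeff_mk, PowerSeries.coeff_mk,
          PowerSeries.coeff_C, if_neg (Nat.succ_ne_zero k), zero_add]
        congr 2
        omega
    have h2 : (HahnSeries.single (Pi.single i ((J + 1 : ℕ) : ℤ)) 1 : MvLaurentSeries N ℂ) =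
        HahnSeries.single (Pi.single i (J : ℤ)) 1 * HahnSeries.single (Pi.single i 1) 1 := by
      rw [HahnSeries.single_mul_single, ← Pi.single_add]
      simp
    have h3 : PowerSeries.coeff J c • (HahnSeries.single (Pi.single i (J : ℤ)) 1 * Φ) =
        HahnSeries.single 0 (PowerSeries.coeff J c) *
          (HahnSeries.single (Pi.single i (J : ℤ)) 1 * Φ) := by
      ext m
      rw [HahnSeries.coeff_smul, HahnSeries.coeff_single_zero_mul, smul_eq_mul]
    rw [h1, h2, h3, map_add, map_mul, varSeries_X, varSeries_C]
    ring

/-- The kept terms of the operator have known symbols by `HasSymbol.shift`. The tail of the operator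
is small as `t → 0`, and the tail of the series lies in high total degree, so both are negligible at
order `n`. -/
theorem HasSymbol.operator {T T' : ℝ → rapidDecay N → ℂ} {Φ : MvLaurentSeries N ℂ}
    (h : HasSymbol T Φ) {i : Fin N} {c : PowerSeries ℂ}
    (hT : IsOperatorExpansion T T' i fun j => PowerSeries.coeff j c) :
    HasSymbol T' (varSeries i c * Φ) := by
  intro f
  refine Asym.of_approx fun n => ?_
  obtain ⟨L, hL⟩ := exists_totalDegree_bound Φ
  obtain ⟨q, hq⟩ := hT
  -- The order is chosen so as to recover the loss `t^q` and to give `n ≤ J + L`, which places the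
  -- tail of the series in degrees at least `n`.
  obtain ⟨J, hJ, C, hC⟩ := hq f (n.natAbs + q + (n - L).natAbs)
  have hterm : ∀ j : ℕ, Asym (fun t => PowerSeries.coeff j c * (t : ℂ) ^ j *
      T t ((derivEquiv i ^ j) f)) (fun d => PowerSeries.coeff j c *
        hadamardCoeff f d (HahnSeries.single (Pi.single i (j : ℤ)) 1 * Φ)) := by
    intro j
    have := ((h.shift i (j : ℤ)) f).const_mul (PowerSeries.coeff j c)
    simpa only [zpow_natCast, mul_assoc] using this
  refine ⟨_, _, Asym.sum (Finset.range J) hterm, fun d hd => ?_, ?_⟩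
  · rw [varSeries_mul_eq i c Φ J, map_add, map_sum, hadamardCoeff_single_mul,
      hadamardCoeff_eq_zero (varSeries_mul_totalDegree hL i _) _ (by omega), add_zero]
    simp only [map_smul, smul_eq_mul]
  · refine Asymptotics.IsBigO.of_bound (max C 0) ?_
    filter_upwards [Ioc_mem_nhdsGT one_pos] with t ht
    have h1 := hC t ht.1 ht.2
    have htq : 0 < t ^ q := pow_pos ht.1 q
    rw [norm_zpow, Real.norm_eq_abs, abs_of_pos ht.1]
    refine le_of_mul_le_mul_right (h1.trans ?_) htq
    rw [mul_assoc, ← zpow_natCast t q, ← zpow_add₀ ht.1.ne', ← zpow_natCast]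
    have h2 : t ^ ((n.natAbs + q + (n - L).natAbs : ℕ) : ℤ) ≤ t ^ (n + (q : ℤ)) :=
      zpow_le_zpow_right_of_le_one₀ ht.1 ht.2 (by omega)
    have h3 : 0 ≤ t ^ ((n.natAbs + q + (n - L).natAbs : ℕ) : ℤ) := (zpow_pos ht.1 _).le
    calc C * t ^ ((n.natAbs + q + (n - L).natAbs : ℕ) : ℤ)
        ≤ max C 0 * t ^ ((n.natAbs + q + (n - L).natAbs : ℕ) : ℤ) :=
          mul_le_mul_of_nonneg_right (le_max_left _ _) h3
      _ ≤ _ := mul_le_mul_of_nonneg_left h2 (le_max_right _ _)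

theorem hadamardCoeff_one (f : rapidDecay N) (d : ℤ) :
    hadamardCoeff f.1 d 1 = if d = 0 then f.1 0 else 0 := by
  change (hadamard _ _).coeff _ = _
  rw [hadamard_coeff]
  split_ifs with hd
  · rw [finsum_mem_inter_support_eq' _ _ {0}, finsum_mem_singleton, mixedDeriv_zero,
      HahnSeries.coeff_one, if_pos rfl, one_mul]
    intro m hm
    have hm0 : m = 0 := by
      by_contra hne
      exact hm (by simp [HahnSeries.coeff_one, hne])
    subst hm0
    simp [hd]
  · refine finsum_mem_eq_zero_of_forall_eq_zero fun m hm => ?_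
    rw [HahnSeries.coeff_one, if_neg, zero_mul]
    rintro rfl
    have h0 : ∑ i, (0 : Fin N → ℤ) i = d := hm
    exact hd (by simpa using h0.symm)

theorem latticeSum_zero (K : Fin N → ℕ) (t : ℝ) (f : (Fin N → ℝ) → ℂ) :
    latticeSum 0 K 0 t f = f 0 := by
  rw [latticeSum, tsum_eq_single 0]
  · rw [multiWeight_zero_left, if_pos rfl, Nat.cast_one, one_mul]
    congr 1
    funext i
    simp [samplePoint]
  · intro n hn
    rw [multiWeight_zero_left, if_neg hn, Nat.cast_zero, zero_mul]

theorem hasSymbol_zero (K : Fin N → ℕ) :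
    HasSymbol (fun t f => latticeSum 0 K 0 t f.1) (1 : MvLaurentSeries N ℂ) := by
  intro f n
  simp only [latticeSum_zero, hadamardCoeff_one]
  refine ⟨Finsupp.single 0 (f.1 0), fun d _ => ?_, ?_⟩
  · rw [Finsupp.single_apply]
    simp only [eq_comm]
  · simpa using Asymptotics.isBigO_zero _ _

theorem hasSymbol_latticeSum_zero_left (K : Fin N → ℕ) (hK : ∀ i, 0 < K i) (c : Fin N → ℝ) :
    HasSymbol (fun t f => latticeSum 0 K c t f.1) (symbolSeries 0 K fun i => (c i : ℂ)) := by
  classical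
  -- The coordinates of `c` are switched on one at a time, each by a translation starting from
  -- evaluation at the origin.
  suffices ∀ s : Finset (Fin N), HasSymbol
      (fun t f => latticeSum 0 K (fun j => if j ∈ s then c j else 0) t f.1)
      (symbolSeries 0 K fun i => ((if i ∈ s then c i else 0 : ℝ) : ℂ)) by
    simpa using this Finset.univ
  intro s
  induction s using Finset.induction_on with
  | empty =>
    have h := hasSymbol_zero K
    rw [← symbolSeries_zero K] at h
    simpa [Pi.zero_def] using h
  | insert i s hi ih =>
    have h1 : (fun j => if j ∈ insert i s then c j else 0) =
        (fun j => if j ∈ s then c j else 0) + c i • (Pi.single i 1 : Fin N → ℝ) := by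
      funext j
      rcases eq_or_ne j i with rfl | hj
      · simp [hi]
      · simp [hj]
    have h2 : (fun j => ((if j ∈ insert i s then c j else 0 : ℝ) : ℂ)) =
        (fun j => ((if j ∈ s then c j else 0 : ℝ) : ℂ)) + Pi.single i (c i : ℂ) := by
      funext j
      rcases eq_or_ne j i with rfl | hj
      · simp [hi]
      · simp [hj]
    rw [h1, h2, symbolSeries_add_single_right]
    refine ih.operator ?_
    have h3 := latticeSum_shift 0 K hK (fun j => if j ∈ s then c j else 0) (c i) i
    convert h3 using 2 with j
    rw [PowerSeries.coeff_rescale, PowerSeries.coeff_exp]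
    simp
    ring

/-- Induction on `∑ p_i`. The pole of `1/(1-e^{K_i t_i})` is a shift by `t_i^{-1}`, realized by
`t^{-1} ∂_i^{-1}`; the remaining Bernoulli factor is a power series, to which `HasSymbol.operator`
applies. -/
theorem hasSymbol_latticeSum (p K : Fin N → ℕ) (hK : ∀ i, 0 < K i) (c : Fin N → ℝ) :
    HasSymbol (fun t f => latticeSum p K c t f.1) (symbolSeries p K fun i => (c i : ℂ)) := by
  induction hs : ∑ i, p i generalizing p with
  | zero =>
    have : p = 0 := by
      funext i
      exact (Finset.sum_eq_zero_iff.1 hs) i (Finset.mem_univ i)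
    subst this
    exact hasSymbol_latticeSum_zero_left K hK c
  | succ k ih =>
    obtain ⟨i, -, hi⟩ := Finset.exists_ne_zero_of_sum_ne_zero (s := Finset.univ) (f := p)
      (by omega)
    obtain ⟨p', rfl⟩ := add_single_mem_range hi
    have hk : ∑ i, p' i = k := by
      simp only [Pi.add_apply, Finset.sum_add_distrib, Finset.sum_pi_single',
        Finset.mem_univ, if_true] at hs
      omega
    have h := (ih p' hk).shift i (-1)
    rw [symbolSeries_add_single_left, geomSeries, mul_comm (HahnSeries.single _ _), mul_assoc]
    rw [Pi.single_neg] at h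
    refine h.operator ?_
    -- The coefficientwise form of `B e^X = B + X`, where `B = X/(e^X - 1)`.
    have hb : ∀ d, ∑ k ∈ Finset.range (d + 1), PowerSeries.coeff k (bernoulliPowerSeries ℂ) *
        (((d - k).factorial : ℕ) : ℂ)⁻¹ =
        PowerSeries.coeff d (bernoulliPowerSeries ℂ) + if d = 1 then 1 else 0 := by
      intro d
      have h1 : bernoulliPowerSeries ℂ * PowerSeries.exp ℂ =
          bernoulliPowerSeries ℂ + PowerSeries.X := by
        rw [← bernoulliPowerSeries_mul_exp_sub_one ℂ]
        ring
      have h2 := congrArg (PowerSeries.coeff d) h1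
      rw [PowerSeries.coeff_mul, Finset.Nat.sum_antidiagonal_eq_sum_range_succ_mk, map_add,
        PowerSeries.coeff_X] at h2
      rw [← h2]
      refine Finset.sum_congr rfl fun k _ => ?_
      rw [PowerSeries.coeff_exp]
      simp
    have h3 := latticeSum_div p' K hK c i _ hb
    convert h3 using 2 with j
    · funext f
      rw [zpow_neg_one]
    · rw [PowerSeries.coeff_C_mul, PowerSeries.coeff_rescale, map_neg, map_inv₀, map_natCast]

/-! ### Decomposition of the summands -/

/-- The span contains the constants, as `multichoose 1 n = 1`, and is stable under multiplication by
`n`, because `n * multichoose p n = p * (multichoose (p+1) n - multichoose p n)`. -/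
theorem eval_mem_span_multichoose (q : Polynomial ℂ) :
    (fun n : ℕ => q.eval (n : ℂ)) ∈
      Submodule.span ℂ (Set.range fun (p n : ℕ) => (p.multichoose n : ℂ)) := by
  set V := Submodule.span ℂ (Set.range fun (p n : ℕ) => (p.multichoose n : ℂ)) with hV
  have hX : ∀ v ∈ V, (fun n : ℕ => (n : ℂ) * v n) ∈ V := by
    intro v hv
    induction hv using Submodule.span_induction with
    | mem v hv =>
      obtain ⟨p, rfl⟩ := hv
      have h : (fun n : ℕ => (n : ℂ) * (p.multichoose n : ℂ)) =
          (p : ℂ) • ((fun n : ℕ => ((p + 1).multichoose n : ℂ)) - fun n => (p.multichoose n : ℂ)) := by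
        funext n
        simp only [Pi.smul_apply, Pi.sub_apply, smul_eq_mul]
        cases n with
        | zero => simp
        | succ n =>
          rw [Nat.multichoose_succ_succ]
          have h1 : (n + 1) * p.multichoose (n + 1) = p * (p + 1).multichoose n := by
            cases p with
            | zero => simp
            | succ p =>
              rw [Nat.multichoose_eq, Nat.multichoose_eq]
              have e1 : p + 1 + (n + 1) - 1 = p + n + 1 := by omega
              have e2 : p + 1 + 1 + n - 1 = p + n + 1 := by omega
              rw [e1, e2]
              have h2 := Nat.choose_succ_right_eq (p + n + 1) n
              have e3 : p + n + 1 - n = p + 1 := by omega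
              rw [e3] at h2
              linarith
          have h2 : ((n + 1 : ℕ) : ℂ) * (p.multichoose (n + 1) : ℂ) =
              (p : ℂ) * ((p + 1).multichoose n : ℂ) := by exact_mod_cast h1
          rw [h2]
          push_cast
          ring
      rw [h]
      exact V.smul_mem _ (V.sub_mem (Submodule.subset_span ⟨p + 1, rfl⟩)
        (Submodule.subset_span ⟨p, rfl⟩))
    | zero =>
      convert V.zero_mem using 1
      funext n
      simp
    | add v w _ _ hv hw =>
      convert V.add_mem hv hw using 1
      funext n
      simp [mul_add]
    | smul c v _ hv =>
      convert V.smul_mem c hv using 1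
      funext n
      simp [mul_left_comm]
  induction q using Polynomial.induction_on with
  | C a =>
    have : (fun n : ℕ => (Polynomial.C a).eval (n : ℂ)) =
        a • fun n : ℕ => (Nat.multichoose 1 n : ℂ) := by
      funext n
      simp
    rw [this]
    exact V.smul_mem _ (Submodule.subset_span ⟨1, rfl⟩)
  | add p q hp hq =>
    convert V.add_mem hp hq using 1
    funext n
    simp
  | monomial k a h =>
    convert hX _ h using 1
    funext n
    simp [pow_succ]
    ring

/-- Extension by zero along `n ↦ a + K n`. -/
def extendProg (a : ℤ) (K : ℕ) : (ℕ → ℂ) →ₗ[ℂ] (ℤ → ℂ) where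
  toFun v y := if a ≤ y ∧ (K : ℤ) ∣ y - a then v ((y - a) / K).toNat else 0
  map_add' v w := by
    funext y
    simp only [Pi.add_apply]
    split_ifs <;> simp
  map_smul' c v := by
    funext y
    simp only [Pi.smul_apply, RingHom.id_apply]
    split_ifs <;> simp

theorem extendProg_apply_add {a : ℤ} {K : ℕ} (hK : 0 < K) (v : ℕ → ℂ) (n : ℕ) :
    extendProg a K v (a + K * n) = v n := by
  have hK' : (K : ℤ) ≠ 0 := by exact_mod_cast hK.ne'
  change (if _ then _ else _) = _
  rw [if_pos ⟨by nlinarith [mul_nonneg (Int.natCast_nonneg K) (Int.natCast_nonneg n)],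
    ⟨n, by ring⟩⟩]
  congr 1
  rw [add_sub_cancel_left, Int.mul_ediv_cancel_left _ hK']
  simp

theorem extendProg_apply_of_forall_ne {a : ℤ} {K : ℕ} (v : ℕ → ℂ) {y : ℤ}
    (h : ∀ n : ℕ, y ≠ a + K * n) : extendProg a K v y = 0 := by
  change (if _ then _ else _) = _
  rcases Nat.eq_zero_or_pos K with rfl | hK
  · rw [if_neg]
    rintro ⟨-, h2⟩
    have : y - a = 0 := by simpa using h2
    exact h 0 (by simp; omega)
  · rw [if_neg]
    rintro ⟨h1, j, hj⟩
    have hK' : (0 : ℤ) < K := by exact_mod_cast hK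
    have hj0 : 0 ≤ j := by
      by_contra hneg
      nlinarith
    obtain ⟨n, rfl⟩ := Int.eq_ofNat_of_zero_le hj0
    exact h n (by linarith)

/-- The functions supported on a progression `a + K ℤ_{≥ 0}` in `ℤ_{≥ lam}` whose values there are
the numbers of multisets with a fixed number of elements. -/
def progWeights (lam : ℤ) : Set (ℤ → ℂ) :=
  {h | ∃ (a : ℤ) (K p : ℕ), lam ≤ a ∧ 0 < K ∧ h = extendProg a K fun n => (p.multichoose n : ℂ)}

theorem extendProg_eval_mem {lam a : ℤ} (ha : lam ≤ a) {K : ℕ} (hK : 0 < K) (q : Polynomial ℂ) :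
    extendProg a K (fun n => q.eval (n : ℂ)) ∈ Submodule.span ℂ (progWeights lam) := by
  have h := Submodule.mem_map_of_mem (f := extendProg a K) (eval_mem_span_multichoose q)
  rw [Submodule.map_span] at h
  refine Submodule.span_mono ?_ h
  rintro _ ⟨_, ⟨p, rfl⟩, rfl⟩
  exact ⟨a, K, p, ha, hK, rfl⟩

/-- The functions on `ℤ` that agree with a quasi-polynomial near `+∞`. -/
def quasiPolynomials : Subalgebra ℂ (ℤ → ℂ) where
  carrier := {g | ∃ (K : ℕ) (P : ℤ → Polynomial ℂ) (L : ℤ), 0 < K ∧ Function.Periodic P (K : ℤ) ∧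
    ∀ y, L ≤ y → g y = (P y).eval (y : ℂ)}
  mul_mem' := by
    rintro g h ⟨K, P, L, hK, hP, hg⟩ ⟨K', P', L', hK', hP', hh⟩
    refine ⟨K * K', P * P', max L L', Nat.mul_pos hK hK', ?_, fun y hy => ?_⟩
    · have h1 := hP.int_mul (K' : ℤ)
      have h2 := hP'.int_mul (K : ℤ)
      push_cast
      rw [mul_comm] at h1
      exact h1.mul h2
    · simp [hg y (le_of_max_le_left hy), hh y (le_of_max_le_right hy)]
  add_mem' := by
    rintro g h ⟨K, P, L, hK, hP, hg⟩ ⟨K', P', L', hK', hP', hh⟩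
    refine ⟨K * K', P + P', max L L', Nat.mul_pos hK hK', ?_, fun y hy => ?_⟩
    · have h1 := hP.int_mul (K' : ℤ)
      have h2 := hP'.int_mul (K : ℤ)
      push_cast
      rw [mul_comm] at h1
      exact h1.add h2
    · simp [hg y (le_of_max_le_left hy), hh y (le_of_max_le_right hy)]
  algebraMap_mem' c := ⟨1, fun _ => Polynomial.C c, 0, one_pos, fun _ => rfl, fun y _ => by simp⟩

theorem coe_mem_quasiPolynomials : (fun y : ℤ => (y : ℂ)) ∈ quasiPolynomials :=
  ⟨1, fun _ => Polynomial.X, 0, one_pos, fun _ => rfl, fun y _ => by simp⟩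

/-- For `k = 0` the singleton is invisible near `+∞`; otherwise the indicator is a constant
polynomial on each residue class modulo `|k|`. -/
theorem indicator_progression_mem_quasiPolynomials (a k : ℤ) :
    Set.indicator {y : ℤ | ∃ j : ℤ, y = a + k * j} (1 : ℤ → ℂ) ∈ quasiPolynomials := by
  classical
  by_cases hk : k = 0
  · refine ⟨1, 0, a + 1, one_pos, fun _ => rfl, fun y hy => ?_⟩
    rw [Set.indicator_of_notMem]
    · simp
    · rintro ⟨j, hj⟩
      rw [hk, zero_mul] at hj
      omega
  · refine ⟨k.natAbs, fun y => if ∃ j : ℤ, y = a + k * j then 1 else 0, 0, Int.natAbs_pos.2 hk,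
      fun y => ?_, fun y _ => ?_⟩
    · have : (∃ j : ℤ, y + (k.natAbs : ℤ) = a + k * j) ↔ ∃ j : ℤ, y = a + k * j := by
        obtain ⟨e, he⟩ : k ∣ (k.natAbs : ℤ) := Int.dvd_natAbs_self
        rw [he]
        constructor
        · rintro ⟨j, hj⟩
          exact ⟨j - e, by linear_combination hj⟩
        · rintro ⟨j, hj⟩
          exact ⟨j + e, by linear_combination hj⟩
      simp only [this]
    · rw [Set.indicator_apply]
      simp only [Set.mem_ofPred_eq, Pi.one_apply]
      split_ifs <;> simp

theorem indicator_quasiPolynomial_mem_span (lam : ℤ) {g : ℤ → ℂ} (hg : g ∈ quasiPolynomials) :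
    Set.indicator (Set.Ici lam) g ∈ Submodule.span ℂ (progWeights lam) := by
  classical
  obtain ⟨K, P, L₀, hK, hP, hg⟩ := hg
  set L := max L₀ lam with hL
  have hKz : (0 : ℤ) < K := by exact_mod_cast hK
  set q : ℕ → Polynomial ℂ := fun r =>
    (P (L + r)).comp (Polynomial.C ((L : ℂ) + r) + Polynomial.C (K : ℂ) * Polynomial.X) with hq
  -- The finitely many points below `L` enter as point masses, since `multichoose 0 n` is `1` at `n
  -- = 0` and `0` elsewhere. From `L` on, each residue class modulo `K` is a progression along which
  -- `g` is a polynomial in the index.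
  have key : Set.indicator (Set.Ici lam) g =
      ∑ y ∈ Finset.Ico lam L, g y • extendProg y 1 (fun n => (Nat.multichoose 0 n : ℂ)) +
        ∑ r ∈ Finset.range K, extendProg (L + r) K (fun n => (q r).eval (n : ℂ)) := by
    funext x
    rw [Pi.add_apply, Finset.sum_apply, Finset.sum_apply]
    have h1 : ∀ y : ℤ, extendProg y 1 (fun n => (Nat.multichoose 0 n : ℂ)) x =
        if y = x then 1 else 0 := by
      intro y
      by_cases hyx : y ≤ x
      · obtain ⟨n, hn⟩ := Int.eq_ofNat_of_zero_le (sub_nonneg.2 hyx)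
        have hx : x = y + (1 : ℕ) * (n : ℕ) := by push_cast; linarith
        rw [hx, extendProg_apply_add one_pos]
        cases n with
        | zero => simp
        | succ n => rw [if_neg (by push_cast; omega)]; simp
      · rw [extendProg_apply_of_forall_ne, if_neg (by omega)]
        intro n hn
        push_cast at hn
        omega
    have h2 : ∑ y ∈ Finset.Ico lam L,
        (g y • extendProg y 1 (fun n => (Nat.multichoose 0 n : ℂ))) x =
        if x ∈ Finset.Ico lam L then g x else 0 := by
      simp only [Pi.smul_apply, h1, smul_eq_mul, mul_ite, mul_one, mul_zero]
      rw [Finset.sum_ite_eq']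
    rw [h2]
    by_cases hx : L ≤ x
    · have hr0 := Int.emod_nonneg (x - L) hKz.ne'
      have hr1 := Int.emod_lt_of_pos (x - L) hKz
      have hd0 : 0 ≤ (x - L) / K := Int.ediv_nonneg (by omega) hKz.le
      have hdm := Int.emod_add_mul_ediv (x - L) K
      obtain ⟨r, hr⟩ := Int.eq_ofNat_of_zero_le hr0
      obtain ⟨n, hn⟩ := Int.eq_ofNat_of_zero_le hd0
      rw [hr, hn] at hdm
      have hxe : x = L + r + K * n := by
        change (r : ℤ) + K * (n : ℤ) = x - L at hdm
        linarith
      rw [Set.indicator_of_mem (show x ∈ Set.Ici lam from (le_max_right _ _).trans hx),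
        if_neg (by rw [Finset.mem_Ico]; omega), zero_add, Finset.sum_eq_single r]
      · have hPx : P x = P (L + r) := by
          rw [hxe, mul_comm]
          exact hP.int_mul n (L + r)
        rw [hg x ((le_max_left _ _).trans hx), hPx]
        conv_rhs => rw [hxe, extendProg_apply_add hK]
        rw [hq]
        simp only [Polynomial.eval_comp, Polynomial.eval_add, Polynomial.eval_C,
          Polynomial.eval_mul, Polynomial.eval_X]
        rw [hxe]
        push_cast
        rfl
      · intro r' hr' hne
        refine extendProg_apply_of_forall_ne _ fun n' hn' => hne ?_
        have hr'K := Finset.mem_range.1 hr'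
        have h3 : (x - L) % K = r' := by
          have : x - L = r' + K * n' := by rw [hn']; ring
          rw [this, Int.add_mul_emod_self_left]
          exact Int.emod_eq_of_lt (by omega) (by omega)
        rw [hr] at h3
        exact (Int.ofNat.inj h3).symm
      · intro h
        exfalso
        refine h (Finset.mem_range.2 ?_)
        rw [hr] at hr1
        exact Int.ofNat_lt.1 hr1
    · rw [Finset.sum_eq_zero, add_zero]
      · by_cases hl : lam ≤ x
        · rw [Set.indicator_of_mem (show x ∈ Set.Ici lam from hl),
            if_pos (Finset.mem_Ico.2 ⟨hl, not_le.1 hx⟩)]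
        · rw [Set.indicator_of_notMem (show x ∉ Set.Ici lam from hl),
            if_neg fun h => hl (Finset.mem_Ico.1 h).1]
      · intro r _
        refine extendProg_apply_of_forall_ne _ fun n hn => hx ?_
        have : (0 : ℤ) ≤ K * n := by positivity
        omega
  rw [key]
  refine Submodule.add_mem _ (Submodule.sum_mem _ fun y hy => ?_)
    (Submodule.sum_mem _ fun r _ => ?_)
  · exact Submodule.smul_mem _ _ (Submodule.subset_span
      ⟨y, 1, 0, (Finset.mem_Ico.1 hy).1, one_pos, rfl⟩)
  · refine extendProg_eval_mem ?_ hK (q r)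
    have := le_max_right L₀ lam
    omega

/-- The product `∏ h_i(y_i)` of weights on progressions. -/
def coneWeight (a : Fin N → ℤ) (K p : Fin N → ℕ) (y : Fin N → ℤ) : ℂ :=
  ∏ i, extendProg (a i) (K i) (fun n => ((p i).multichoose n : ℂ)) (y i)

/-- The products of weights on progressions in the cone. -/
def coneWeights (lam : Fin N → ℤ) : Set ((Fin N → ℤ) → ℂ) :=
  {H | ∃ (a : Fin N → ℤ) (K p : Fin N → ℕ), (∀ i, lam i ≤ a i) ∧ (∀ i, 0 < K i) ∧
    H = coneWeight a K p}

/-- Products of one-variable quasi-polynomials contain the generators and are closed under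
multiplication, so their linear span is already an algebra. -/
theorem deltaPolynomials_le_span (N : ℕ) : Subalgebra.toSubmodule (deltaPolynomials N) ≤
    Submodule.span ℂ {G | ∃ g : Fin N → ℤ → ℂ, (∀ i, g i ∈ quasiPolynomials) ∧
      G = fun y => ∏ i, g i (y i)} := by
  classical
  set S : Set ((Fin N → ℤ) → ℂ) := {G | ∃ g : Fin N → ℤ → ℂ, (∀ i, g i ∈ quasiPolynomials) ∧
      G = fun y => ∏ i, g i (y i)} with hS
  have hsingle : ∀ (i : Fin N) (g : ℤ → ℂ), g ∈ quasiPolynomials → (fun y => g (y i)) ∈ S := by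
    intro i g hg
    refine ⟨Pi.mulSingle i g, fun j => ?_, funext fun y => ?_⟩
    · rcases eq_or_ne j i with rfl | hj
      · simpa using hg
      · rw [Pi.mulSingle_eq_of_ne hj]; exact one_mem _
    · rw [Finset.prod_eq_single i]
      · simp
      · intro j _ hj
        rw [Pi.mulSingle_eq_of_ne hj]; rfl
      · simp
  intro G hG
  change G ∈ Algebra.adjoin ℂ _ at hG
  induction hG using Algebra.adjoin_induction with
  | mem G hG =>
    refine Submodule.subset_span ?_
    rcases hG with ⟨i, rfl⟩ | ⟨i, a, k, rfl⟩
    · exact hsingle i _ coe_mem_quasiPolynomials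
    · exact hsingle i _ (indicator_progression_mem_quasiPolynomials a k)
  | algebraMap c =>
    have h1 : (1 : (Fin N → ℤ) → ℂ) ∈ S :=
      ⟨fun _ => 1, fun _ => one_mem _, funext fun y => by simp⟩
    rw [Algebra.algebraMap_eq_smul_one]
    exact Submodule.smul_mem _ _ (Submodule.subset_span h1)
  | add G H _ _ hG hH => exact Submodule.add_mem _ hG hH
  | mul G H _ _ hG hH =>
    have h := Submodule.mul_mem_mul hG hH
    rw [Submodule.span_mul_span] at h
    refine Submodule.span_mono ?_ h
    rintro _ ⟨_, ⟨g, hg, rfl⟩, _, ⟨g', hg', rfl⟩, rfl⟩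
    refine ⟨fun i => g i * g' i, fun i => mul_mem (hg i) (hg' i), funext fun y => ?_⟩
    simp [Finset.prod_mul_distrib]

/-- Composition with the `i`-th coordinate. -/
def pullback (i : Fin N) : (ℤ → ℂ) →ₗ[ℂ] ((Fin N → ℤ) → ℂ) where
  toFun g y := g (y i)
  map_add' _ _ := rfl
  map_smul' _ _ := rfl

theorem prod_mem_prod_submodule {R A ι : Type*} [CommSemiring R] [CommSemiring A] [Algebra R A]
    (s : Finset ι) (M : ι → Submodule R A) (x : ι → A) (h : ∀ i, x i ∈ M i) :
    ∏ i ∈ s, x i ∈ ∏ i ∈ s, M i := by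
  classical
  induction s using Finset.induction_on with
  | empty =>
    rw [Finset.prod_empty, Finset.prod_empty]
    exact Submodule.one_le.1 (le_refl (1 : Submodule R A))
  | insert i s hi ih =>
    rw [Finset.prod_insert hi, Finset.prod_insert hi]
    exact Submodule.mul_mem_mul (h i) ih

/-- The indicator of the cone factors over the coordinates, so each product splits into truncated
one-variable functions. These are decomposed separately, and a product of spans is the span of the
products. -/
theorem coneDeltaPolynomials_subset_span (lam : Fin N → ℤ) :
    coneDeltaPolynomials lam ⊆ Submodule.span ℂ (coneWeights lam) := by
  classical
  rintro F ⟨G, hG, rfl⟩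
  have hG' := deltaPolynomials_le_span N hG
  clear hG
  induction hG' using Submodule.span_induction with
  | zero => rw [mul_zero]; exact Submodule.zero_mem _
  | add G H _ _ hG hH => rw [mul_add]; exact Submodule.add_mem _ hG hH
  | smul c G _ hG => rw [mul_smul_comm]; exact Submodule.smul_mem _ _ hG
  | mem G hG =>
    obtain ⟨g, hg, rfl⟩ := hG
    have h1 : Set.indicator (cone lam) (1 : (Fin N → ℤ) → ℂ) * (fun y => ∏ i, g i (y i)) =
        ∏ i, pullback i (Set.indicator (Set.Ici (lam i)) (g i)) := by
      funext y
      rw [Pi.mul_apply, Finset.prod_apply]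
      change _ = ∏ i, Set.indicator (Set.Ici (lam i)) (g i) (y i)
      by_cases hy : ∀ i, lam i ≤ y i
      · rw [Set.indicator_of_mem, Pi.one_apply, one_mul]
        · refine Finset.prod_congr rfl fun i _ => ?_
          rw [Set.indicator_of_mem (show y i ∈ Set.Ici (lam i) from hy i)]
        · exact ⟨fun i => (y i - lam i).toNat, fun i => by
            rw [Int.toNat_of_nonneg (sub_nonneg.2 (hy i)), sub_add_cancel]⟩
      · push Not at hy
        obtain ⟨i, hi⟩ := hy
        rw [Set.indicator_of_notMem, zero_mul, Finset.prod_eq_zero (Finset.mem_univ i)]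
        · rw [Set.indicator_of_notMem]
          exact not_le.2 hi
        · rintro ⟨n, hn⟩
          have := hn i
          omega
    have h2 : ∀ i, pullback i (Set.indicator (Set.Ici (lam i)) (g i)) ∈
        Submodule.span ℂ (pullback i '' progWeights (lam i)) := by
      intro i
      rw [← Submodule.map_span]
      exact Submodule.mem_map_of_mem (indicator_quasiPolynomial_mem_span (lam i) (hg i))
    have h3 := prod_mem_prod_submodule Finset.univ _ _ h2
    rw [Submodule.prod_span] at h3
    rw [h1]
    refine Submodule.span_mono ?_ h3
    intro H hH
    obtain ⟨h, hh, rfl⟩ := (Set.mem_finsetProd _ _ _).1 hH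
    choose w hw hwh using fun i => hh (Finset.mem_univ i)
    choose a K p ha hK hp using hw
    refine ⟨a, K, p, ha, hK, funext fun y => ?_⟩
    rw [Finset.prod_apply, coneWeight]
    refine Finset.prod_congr rfl fun i _ => ?_
    rw [← hwh i, hp i]
    rfl

/-! ### Generating series of products of weights -/

theorem summable_multiWeight_geometric (p : Fin N → ℕ) {x : Fin N → ℂ} (hx0 : ∀ i, x i ≠ 0)
    (hx : ∀ i, ‖x i‖ < 1) : Summable fun n => (multiWeight p n : ℂ) * ∏ i, x i ^ n i := by
  have hs : ∀ i, Summable fun n : ℕ => ((n : ℝ) + 1) ^ p i * ‖x i‖ ^ n := by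
    intro i
    have h1 := (summable_nat_add_iff 1).2
      (summable_pow_mul_geometric_of_norm_lt_one (R := ℝ) (p i) (r := ‖x i‖) (by simpa using hx i))
    refine (h1.mul_right ‖x i‖⁻¹).congr fun n => ?_
    have : ‖x i‖ ≠ 0 := norm_ne_zero_iff.2 (hx0 i)
    push_cast
    rw [pow_succ ‖x i‖]
    field_simp
  refine Summable.of_norm_bounded (summable_pi_prod
    (f := fun i n => ((n : ℝ) + 1) ^ p i * ‖x i‖ ^ n) (fun i n => by positivity) hs) fun n => ?_
  rw [norm_mul, Complex.norm_natCast, norm_prod, multiWeight, Finset.prod_mul_distrib]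
  push_cast
  simp only [norm_pow]
  refine mul_le_mul_of_nonneg_right ?_ (Finset.prod_nonneg fun i _ => by positivity)
  refine Finset.prod_le_prod (fun i _ => by positivity) fun i _ => ?_
  exact_mod_cast multichoose_le_pow (p i) (n i)

/-- The same summation by parts as for the asymptotics, now with a geometric summand: raising `p_i`
by one divides the sum by `1 - x_i`. -/
theorem tsum_multiWeight_geometric (p : Fin N → ℕ) {x : Fin N → ℂ} (hx0 : ∀ i, x i ≠ 0)
    (hx : ∀ i, ‖x i‖ < 1) : ∑' n, (multiWeight p n : ℂ) * ∏ i, x i ^ n i =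
      ∏ i, (1 - x i)⁻¹ ^ p i := by
  induction hs : ∑ i, p i generalizing p with
  | zero =>
    have : p = 0 := by
      funext i
      exact (Finset.sum_eq_zero_iff.1 hs) i (Finset.mem_univ i)
    subst this
    rw [tsum_eq_single 0]
    · simp [multiWeight_zero_left]
    · intro n hn
      rw [multiWeight_zero_left, if_neg hn, Nat.cast_zero, zero_mul]
  | succ k ih =>
    obtain ⟨i, -, hi⟩ := Finset.exists_ne_zero_of_sum_ne_zero (s := Finset.univ) (f := p)
      (by omega)
    obtain ⟨p', rfl⟩ := add_single_mem_range hi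
    have hk : ∑ i, p' i = k := by
      simp only [Pi.add_apply, Finset.sum_add_distrib, Finset.sum_pi_single',
        Finset.mem_univ, if_true] at hs
      omega
    have hprod : ∀ {M : Type} [CommMonoid M] (z : Fin N → M) (m : Fin N → ℕ),
        ∏ j, z j ^ (m + Pi.single i 1 : Fin N → ℕ) j = z i * ∏ j, z j ^ m j := by
      intro M _ z m
      simp only [Pi.add_apply, pow_add, Finset.prod_mul_distrib]
      rw [mul_comm]
      congr 1
      rw [Finset.prod_eq_single i]
      · simp
      · intro j _ hj
        simp [hj]
      · simp
    have h := (tsum_multiWeight_add_single p' i (g := fun n => ∏ i, x i ^ n i)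
      (summable_multiWeight_geometric _ hx0 hx)).2
    simp only [hprod] at h
    have h2 : ∀ n, (multiWeight (p' + Pi.single i 1) n : ℂ) * (x i * ∏ j, x j ^ n j) =
        x i * ((multiWeight (p' + Pi.single i 1) n : ℂ) * ∏ j, x j ^ n j) := fun n => by ring
    simp only [h2] at h
    rw [tsum_mul_left, ih p' hk] at h
    have hne : 1 - x i ≠ 0 := by
      intro h0
      have h3 := hx i
      rw [← sub_eq_zero.1 h0, norm_one] at h3
      exact lt_irrefl _ h3
    rw [hprod, inv_mul_eq_div, eq_div_iff hne]
    linear_combination h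

section Cone

variable {lam a : Fin N → ℤ} {K p : Fin N → ℕ}

theorem coneWeight_apply_add (hK : ∀ i, 0 < K i) (n : Fin N → ℕ) :
    coneWeight a K p (fun i => a i + K i * n i) = multiWeight p n := by
  rw [coneWeight, multiWeight, Nat.cast_prod]
  exact Finset.prod_congr rfl fun i _ => extendProg_apply_add (hK i) _ _

/-- Sums over a cone against a product of weights are sums over `ℕ^N` with binomial weights. -/
theorem hasSum_coneWeight_iff (ha : ∀ i, lam i ≤ a i) (hK : ∀ i, 0 < K i)
    (G : (Fin N → ℤ) → ℂ) (v : ℂ) :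
    HasSum (fun l : cone lam => coneWeight a K p l * G l) v ↔
      HasSum (fun n => (multiWeight p n : ℂ) * G fun i => a i + K i * n i) v := by
  let e : (Fin N → ℕ) → cone lam := fun n => ⟨fun i => a i + K i * n i,
    fun i => (a i - lam i).toNat + K i * n i, fun i => by
      push_cast
      rw [Int.toNat_of_nonneg (sub_nonneg.2 (ha i))]
      ring⟩
  have he : Function.Injective e := by
    intro n m hnm
    funext i
    have h1 := congrFun (congrArg Subtype.val hnm) i
    have h2 : (K i : ℤ) * n i = K i * m i := add_left_cancel h1
    have hK' : (K i : ℤ) ≠ 0 := by exact_mod_cast (hK i).ne'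
    exact_mod_cast mul_left_cancel₀ hK' h2
  have h := he.hasSum_iff (f := fun l : cone lam => coneWeight a K p l * G l) (a := v) ?_
  · rw [← h]
    have : ((fun l : cone lam => coneWeight a K p l * G l) ∘ e) =
        fun n => (multiWeight p n : ℂ) * G fun i => a i + K i * n i := by
      funext n
      change coneWeight a K p (fun i => a i + K i * n i) * _ = _
      rw [coneWeight_apply_add hK]
    rw [this]
  · rintro ⟨l, hl⟩ hne
    have : ∃ i, ∀ n : ℕ, l i ≠ a i + K i * n := by
      by_contra hcon
      push Not at hcon
      choose n hn using hcon
      exact hne ⟨n, Subtype.ext (funext fun i => (hn i).symm)⟩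
    obtain ⟨i, hi⟩ := this
    change coneWeight a K p l * _ = 0
    rw [coneWeight, Finset.prod_eq_zero (Finset.mem_univ i)
      (extendProg_apply_of_forall_ne _ hi), zero_mul]

theorem summable_coneWeight_iff (ha : ∀ i, lam i ≤ a i) (hK : ∀ i, 0 < K i)
    (G : (Fin N → ℤ) → ℂ) :
    (Summable fun l : cone lam => coneWeight a K p l * G l) ↔
      Summable fun n => (multiWeight p n : ℂ) * G fun i => a i + K i * n i :=
  exists_congr fun v => hasSum_coneWeight_iff ha hK G v

theorem tsum_coneWeight (ha : ∀ i, lam i ≤ a i) (hK : ∀ i, 0 < K i) (G : (Fin N → ℤ) → ℂ) :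
    ∑' l : cone lam, coneWeight a K p l * G l =
      ∑' n, (multiWeight p n : ℂ) * G fun i => a i + K i * n i := by
  by_cases h : Summable fun n => (multiWeight p n : ℂ) * G fun i => a i + K i * n i
  · exact ((hasSum_coneWeight_iff ha hK G _).2 h.hasSum).tsum_eq
  · rw [tsum_eq_zero_of_not_summable h,
      tsum_eq_zero_of_not_summable (mt (summable_coneWeight_iff ha hK G).1 h)]

theorem exp_sum_eq (a : Fin N → ℤ) (K n : Fin N → ℕ) (u t : Fin N → ℂ) :
    Complex.exp (∑ i, t i * (((a i + K i * n i : ℤ) : ℂ) + u i)) =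
      (∏ i, Complex.exp ((a i + u i) * t i)) * ∏ i, Complex.exp (K i * t i) ^ n i := by
  rw [Complex.exp_sum, ← Finset.prod_mul_distrib]
  refine Finset.prod_congr rfl fun i _ => ?_
  rw [← Complex.exp_nat_mul, ← Complex.exp_add]
  congr 1
  push_cast
  ring

/-- The generating series of a product of weights on progressions. -/
def coneSeries (a : Fin N → ℤ) (K p : Fin N → ℕ) : MvLaurentSeries N (MvPolynomial (Fin N) ℂ) :=
  symbolSeries p K fun i => MvPolynomial.C (a i : ℂ) + MvPolynomial.X i

theorem map_coneSeries (u : Fin N → ℂ) :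
    (coneSeries a K p).map (MvPolynomial.eval u) = symbolSeries p K fun i => (a i : ℂ) + u i := by
  rw [coneSeries, map_symbolSeries]
  simp

theorem isGeneratingSeries_coneSeries (ha : ∀ i, lam i ≤ a i) (hK : ∀ i, 0 < K i) :
    IsGeneratingSeries lam (coneWeight a K p) (coneSeries a K p) := by
  intro u
  have hnorm : ∀ t : Fin N → ℂ, (∀ i, (t i).re < 0) → ∀ i, ‖Complex.exp (K i * t i)‖ < 1 := by
    intro t ht i
    rw [Complex.norm_exp, Real.exp_lt_one_iff]
    have hKi : (0 : ℝ) < K i := Nat.cast_pos.2 (hK i)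
    simpa using mul_neg_of_pos_of_neg hKi (ht i)
  have hterm : ∀ (t : Fin N → ℂ) (n : Fin N → ℕ), (multiWeight p n : ℂ) *
      Complex.exp (∑ i, t i * (((a i + K i * n i : ℤ) : ℂ) + u i)) =
      (∏ i, Complex.exp ((a i + u i) * t i)) *
        ((multiWeight p n : ℂ) * ∏ i, Complex.exp (K i * t i) ^ n i) := by
    intro t n
    rw [exp_sum_eq]
    ring
  -- This radius forces `‖K_i t_i‖ < 1` for all `i`, the range in which the Bernoulli expansions are
  -- known to converge.
  refine ⟨fun t ht => ?_, (1 + ∑ i, (K i : ℝ))⁻¹, by positivity, fun t ht => ?_⟩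
  · refine (summable_coneWeight_iff ha hK
      fun l => Complex.exp (∑ i, t i * ((l i : ℂ) + u i))).2 ?_
    simp only [hterm]
    exact (summable_multiWeight_geometric p (fun i => Complex.exp_ne_zero _) (hnorm t ht)).mul_left _
  · have ht0 : ∀ i, t i ≠ 0 := by
      intro i h0
      have := (ht i).1
      simp [h0] at this
    have htK : ∀ i, ‖(K i : ℂ) * t i‖ < 1 := by
      intro i
      have h1 : (K i : ℝ) ≤ ∑ i, (K i : ℝ) :=
        Finset.single_le_sum (f := fun i => (K i : ℝ)) (fun _ _ => Nat.cast_nonneg _)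
          (Finset.mem_univ i)
      have hS : 0 < 1 + ∑ i, (K i : ℝ) := by positivity
      rw [norm_mul, Complex.norm_natCast]
      have hKi : (0 : ℝ) < K i := Nat.cast_pos.2 (hK i)
      calc (K i : ℝ) * ‖t i‖ < K i * (1 + ∑ i, (K i : ℝ))⁻¹ :=
            mul_lt_mul_of_pos_left (ht i).2 hKi
        _ ≤ (1 + ∑ i, (K i : ℝ)) * (1 + ∑ i, (K i : ℝ))⁻¹ := by gcongr; linarith
        _ = 1 := mul_inv_cancel₀ hS.ne'
    have hev := hasEval_symbolSeries p K hK (fun i => (a i : ℂ) + u i) ht0 htK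
    rw [← map_coneSeries] at hev
    have hval : ∑' l : cone lam, genTerm (coneWeight a K p) u t l =
        (∏ i, Complex.exp ((a i + u i) * t i)) * ∏ i, (1 - Complex.exp (K i * t i))⁻¹ ^ p i := by
      have h1 := tsum_coneWeight (p := p) ha hK
        fun l => Complex.exp (∑ i, t i * ((l i : ℂ) + u i))
      refine h1.trans ?_
      simp only [hterm]
      rw [tsum_mul_left, tsum_multiWeight_geometric p (fun i => Complex.exp_ne_zero _)
        (hnorm t fun i => (ht i).1)]
    rw [hval]
    exact hev

end Cone

/-! ### Linearity -/

/-- The summand `F` has a generating series that governs the asymptotics of the sums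
`∑ F(l) f(t(l + α))`. -/
def HasAsymptoticSeries (lam : Fin N → ℤ) (F : (Fin N → ℤ) → ℂ) : Prop :=
  ∃ φ : MvLaurentSeries N (MvPolynomial (Fin N) ℂ), IsGeneratingSeries lam F φ ∧
    ∀ (α : Fin N → ℝ) (f : rapidDecay N),
      (∀ t : ℝ, 0 < t →
        Summable fun l : cone lam => F l * f.1 (fun i => t * ((l.1 i : ℝ) + α i))) ∧
      Asym (fun t : ℝ => ∑' l : cone lam, F l * f.1 (fun i => t * ((l.1 i : ℝ) + α i)))
        (fun d => hadamardCoeff f.1 d (specialize α φ))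

theorem Asym.congr {φ ψ : ℝ → ℂ} {a : ℤ → ℂ} (h : Asym φ a) (hφψ : ∀ t, 0 < t → φ t = ψ t) :
    Asym ψ a := by
  intro n
  obtain ⟨b, hb, h1⟩ := h n
  refine ⟨b, hb, h1.congr' ?_ EventuallyEq.rfl⟩
  filter_upwards [self_mem_nhdsWithin] with t ht
  rw [hφψ t ht]

theorem hasAsymptoticSeries_zero (lam : Fin N → ℤ) : HasAsymptoticSeries lam 0 := by
  refine ⟨0, fun u => ⟨fun t _ => ?_, 1, one_pos, fun t _ => ?_⟩, fun α f => ⟨fun t _ => ?_, ?_⟩⟩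
  · simp [genTerm, summable_zero]
  · simp [genTerm, hasSum_zero]
  · simp [summable_zero]
  · have : specialize α 0 = 0 := by
      ext m
      simp [specialize]
    simp only [this, map_zero]
    simpa using asym_zero

theorem HasAsymptoticSeries.add {lam : Fin N → ℤ} {F G : (Fin N → ℤ) → ℂ}
    (hF : HasAsymptoticSeries lam F) (hG : HasAsymptoticSeries lam G) :
    HasAsymptoticSeries lam (F + G) := by
  obtain ⟨φ, hφ, h1⟩ := hF
  obtain ⟨ψ, hψ, h2⟩ := hG
  have hgen : ∀ u t l, genTerm (F + G) u t l = genTerm F u t l + genTerm G u t l := fun u t l =>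
    add_mul _ _ _
  refine ⟨φ + ψ, fun u => ⟨fun t ht => ?_, ?_⟩, fun α f => ⟨fun t ht => ?_, ?_⟩⟩
  · simp only [hgen]
    exact ((hφ u).1 t ht).add ((hψ u).1 t ht)
  · obtain ⟨r, hr, h3⟩ := (hφ u).2
    obtain ⟨r', hr', h4⟩ := (hψ u).2
    refine ⟨min r r', lt_min hr hr', fun t ht => ?_⟩
    have h5 := (h3 t fun i => ⟨(ht i).1, (ht i).2.trans_le (min_le_left _ _)⟩).add
      (h4 t fun i => ⟨(ht i).1, (ht i).2.trans_le (min_le_right _ _)⟩)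
    simp only [hgen]
    rw [((hφ u).1 t fun i => (ht i).1).tsum_add ((hψ u).1 t fun i => (ht i).1)]
    refine h5.congr_fun fun m => ?_
    rw [HahnSeries.coeff_add, map_add, add_mul]
  · simp only [Pi.add_apply, add_mul]
    exact ((h1 α f).1 t ht).add ((h2 α f).1 t ht)
  · have hsp : specialize α (φ + ψ) = specialize α φ + specialize α ψ := by
      ext m
      simp [specialize]
    simp only [hsp, map_add]
    refine ((h1 α f).2.add (h2 α f).2).congr fun t ht => ?_
    rw [← ((h1 α f).1 t ht).tsum_add ((h2 α f).1 t ht)]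
    simp only [Pi.add_apply, add_mul]

theorem HasAsymptoticSeries.smul {lam : Fin N → ℤ} {F : (Fin N → ℤ) → ℂ}
    (hF : HasAsymptoticSeries lam F) (c : ℂ) : HasAsymptoticSeries lam (c • F) := by
  obtain ⟨φ, hφ, h1⟩ := hF
  have hgen : ∀ u t l, genTerm (c • F) u t l = c * genTerm F u t l := fun u t l =>
    mul_assoc _ _ _
  refine ⟨c • φ, fun u => ⟨fun t ht => ?_, ?_⟩, fun α f => ⟨fun t ht => ?_, ?_⟩⟩
  · simp only [hgen]
    exact ((hφ u).1 t ht).mul_left c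
  · obtain ⟨r, hr, h3⟩ := (hφ u).2
    refine ⟨r, hr, fun t ht => ?_⟩
    simp only [hgen]
    rw [tsum_mul_left]
    refine ((h3 t ht).mul_left c).congr_fun fun m => ?_
    rw [HahnSeries.coeff_smul, MvPolynomial.smul_eval, mul_assoc]
  · simp only [Pi.smul_apply, smul_eq_mul, mul_assoc]
    exact ((h1 α f).1 t ht).mul_left c
  · have hsp : specialize α (c • φ) = c • specialize α φ := by
      ext m
      simp [specialize, MvPolynomial.smul_eval]
    simp only [hsp, map_smul, smul_eq_mul]
    refine ((h1 α f).2.const_mul c).congr fun t _ => ?_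
    rw [← tsum_mul_left]
    simp only [Pi.smul_apply, smul_eq_mul, mul_assoc]

theorem hasAsymptoticSeries_coneWeight {lam a : Fin N → ℤ} {K p : Fin N → ℕ}
    (ha : ∀ i, lam i ≤ a i) (hK : ∀ i, 0 < K i) :
    HasAsymptoticSeries lam (coneWeight a K p) := by
  refine ⟨coneSeries a K p, isGeneratingSeries_coneSeries ha hK, fun α f => ?_⟩
  have hpt : ∀ (t : ℝ) (n : Fin N → ℕ), (fun i => t * (((a i + K i * n i : ℤ) : ℝ) + α i)) =
      samplePoint K (fun i => a i + α i) t n := by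
    intro t n
    funext i
    simp only [samplePoint]
    push_cast
    ring
  have hsp : specialize α (coneSeries a K p) =
      symbolSeries p K fun i => (((a i : ℝ) + α i : ℝ) : ℂ) := by
    rw [specialize, map_coneSeries]
    simp
  refine ⟨fun t ht => ?_, ?_⟩
  · refine (summable_coneWeight_iff ha hK fun l => f.1 fun i => t * ((l i : ℝ) + α i)).2 ?_
    simp only [hpt]
    exact summable_latticeSum p K hK _ ht (IsRapidDecay.decays f.2)
  · rw [hsp]
    refine (hasSymbol_latticeSum p K hK (fun i => a i + α i) f).congr fun t ht => ?_
    have h := tsum_coneWeight (p := p) ha hK fun l => f.1 fun i => t * ((l i : ℝ) + α i)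
    simp only [hpt] at h
    exact h.symm

/-- Generating series and asymptotics are carried together through the decomposition, so that the
series in the asymptotic statement is the one characterized by convergence. -/
theorem hasAsymptoticSeries_of_mem {lam : Fin N → ℤ} {F : (Fin N → ℤ) → ℂ}
    (hF : F ∈ coneDeltaPolynomials lam) : HasAsymptoticSeries lam F := by
  have h : F ∈ Submodule.span ℂ (coneWeights lam) := coneDeltaPolynomials_subset_span lam hF
  clear hF
  induction h using Submodule.span_induction with
  | mem F hF =>
    obtain ⟨a, K, p, ha, hK, rfl⟩ := hF
    exact hasAsymptoticSeries_coneWeight ha hK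
  | zero => exact hasAsymptoticSeries_zero lam
  | add F G _ _ hF hG => exact hF.add hG
  | smul c F _ hF => exact hF.smul c

end AsympLim

end

theorem proposition3 (N : ℕ) (hN : 0 < N) (lam : Fin N → ℤ) (F : (Fin N → ℤ) → ℂ)
    (hF : F ∈ AsympLim.coneDeltaPolynomials lam) :
    ∃ φ : AsympLim.MvLaurentSeries N (MvPolynomial (Fin N) ℂ),
      (AsympLim.IsGeneratingSeries lam F φ ∧
        ∀ ψ : AsympLim.MvLaurentSeries N (MvPolynomial (Fin N) ℂ),
          AsympLim.IsGeneratingSeries lam F ψ → ψ = φ) ∧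
      ∀ (α : Fin N → ℝ) (f : (Fin N → ℝ) → ℂ), AsympLim.IsRapidDecay f →
        (∀ t : ℝ, 0 < t →
          Summable fun l : AsympLim.cone lam => F l * f (fun i => t * ((l.1 i : ℝ) + α i))) ∧
        AsympLim.HasAsymptoticExpansion
          (fun t : ℝ =>
            ∑' l : AsympLim.cone lam, F l * f (fun i => t * ((l.1 i : ℝ) + α i)))
          (AsympLim.hadamard (AsympLim.specialize α φ) f) := by
  obtain ⟨φ, hφ, h⟩ := AsympLim.hasAsymptoticSeries_of_mem hF
  exact ⟨φ, ⟨hφ, fun ψ hψ => hφ.unique hψ⟩, fun α f hf =>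
    ⟨(h α ⟨f, hf⟩).1, AsympLim.Asym.hasAsymptoticExpansion (h α ⟨f, hf⟩).2⟩⟩
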